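/- Let $q$ be an odd prime power, let $\mathbb{K}$ be an algebraic closure of $\mathbb{F}_{q^4}$, and let $\beta\in\mathbb{F}_{q^4}$ satisfy $\beta^{2q}\neq\beta^{2}$. For $\eta\in\mathbb{F}_{q^4}$ let $\mathcal{V}=\mathcal{V}_{\beta,\eta}\subset\mathbb{P}^7(\mathbb{K})$, with homogeneous coordinates $(W_0:W_1:W_2:X_3:Y_0:Y_1:Y_2:Y_3)$, be the projective variety defined by the four quadrics \[ \begin{aligned} W_0^2 &= \eta Y_0^2+\eta^{q}Y_1^2-2\beta\,\eta^{\frac{q+1}{2}}\,Y_0Y_1,\\ W_1^2 &= \eta^{q} Y_1^2+\eta^{q^2}Y_2^2-2\bigl(\beta\,\eta^{\frac{q+1}{2}}\bigr)^{q}\,Y_1Y_2,\\ W_2^2 &= \eta^{q^2} Y_2^2+\eta^{q^3}Y_3^2-2\bigl(\beta\,\eta^{\frac{q+1}{2}}\bigr)^{q^2}\,Y_2Y_3,\\ (W_0+W_1+W_2)^2 &= \eta^{q^3} Y_3^2+\eta Y_0^2-2\bigl(\beta\,\eta^{\frac{q+1}{2}}\bigr)^{q^3}\,Y_3Y_0 .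 \end{aligned} \] (These are the equation $(S^q-S)^2=\eta Z^2+\eta^qZ^{2q}-2\beta\eta^{\frac{q+1}{2}}Z^{q+1}$ and its Frobenius conjugates, with $Y_i=Z^{q^i}$ and $W_i=S^{q^{i+1}}-S^{q^i}$. For a non-square $\eta$ the last coefficient $\bigl(\beta\eta^{\frac{q+1}{2}}\bigr)^{q^3}$ equals $-\beta^{q^3}\eta^{\frac{1+q^3}{2}}$.) Then there is a non-square $\eta$ of $\mathbb{F}_{q^4}$ such that both of the following hold: 1. $\mathcal{V}$ has exactly one absolutely irreducible component $\mathcal{V}'$ of dimension $3$, and $\mathcal{V}'$ has degree $16$; 2. for infinitely many $k\in\mathbb{K}$ the intersection of $\mathcal{V}$ with the hyperplane $\Pi_k: Y_2=Y_1+kY_0$ (affine equation $Y_2=Y_1+k$) is a non-repeated absolutely irreducible surface; that is, $\mathcal{V}\cap\Pi_k$ is irreducible over $\mathbb{K}$ of dimension $2$, and the four quadratic forms together with the linear form $Y_2-Y_1-kY_0$ generate a radical ideal of $\mathbb{K}[W_0,W_1,W_2,X_3,Y_0,Y_1,Y_2,Y_3]$. -/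

import Mathlib

open MvPolynomial Filter Topology
open scoped LinearAlgebra.Projectivization Nat

/-! ### Projective varieties over a field, as sets of points -/

section Projective

variable {K : Type*} [Field K] {σ : Type*}

/-- The Zariski topology on the projective space of `σ → K`: it is generated by the
non-vanishing loci of the homogeneous polynomials (whether a homogeneous polynomial vanishes at a
point does not depend on the representative). -/
instance projectiveZariskiTopology : TopologicalSpace (ℙ K (σ → K)) :=
  TopologicalSpace.generateFrom
    {U | ∃ (f : MvPolynomial σ K) (n : ℕ), f.IsHomogeneous n ∧ U = {P | eval P.rep f ≠ 0}}

/-- The set of common zeros in projective space of a set of homogeneous polynomials. -/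
def projectiveZeroLocus (S : Set (MvPolynomial σ K)) : Set (ℙ K (σ → K)) :=
  {P | ∀ f ∈ S, eval P.rep f = 0}

/-- `Z` is an irreducible component of `V`, for the Zariski topology. Over an algebraically closed
field these are the absolutely irreducible components. -/
def IsProjectiveComponent (Z V : Set (ℙ K (σ → K))) : Prop :=
  Maximal (fun T : Set (ℙ K (σ → K)) => IsIrreducible T ∧ T ⊆ V) Z

/-- The affine cone over a set of points of projective space (with the origin). -/
def affineCone (Z : Set (ℙ K (σ → K))) : Set (σ → K) :=
  {v | ∀ hv : v ≠ 0, Projectivization.mk K v hv ∈ Z}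

/-- The Hilbert function of `Z`: the dimension of the degree `n` part of the homogeneous
coordinate ring of `Z`. -/
noncomputable def hilbertFunction (Z : Set (ℙ K (σ → K))) (n : ℕ) : ℕ :=
  Module.finrank K
    ((homogeneousSubmodule σ K n).map
      (Ideal.Quotient.mkₐ K (vanishingIdeal K (affineCone Z))).toLinearMap)

/-- `Z` has degree `d`: the Hilbert function of `Z` grows like `d * n ^ r / r!`, where `r` is
the dimension of `Z`. -/
def HasDegree (Z : Set (ℙ K (σ → K))) (d : ℕ) : Prop :=
  ∃ r : ℕ, topologicalKrullDim Z = r ∧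
    Tendsto (fun n : ℕ => (r ! : ℝ) * (hilbertFunction Z n : ℝ) / (n : ℝ) ^ r) atTop (𝓝 (d : ℝ))

end Projective

/-! ### The variety attached to `q`, `β`, `η`

The coordinates `(W₀ : W₁ : W₂ : X₃ : Y₀ : Y₁ : Y₂ : Y₃)` are numbered from `0` to `7`. -/

section Variety

variable {F : Type*} [Field F] (K : Type*) [Field K] [Algebra F K]

/-- The constant polynomial `a ^ (q ^ i)`. -/
noncomputable def frobConst (q i : ℕ) (a : F) : MvPolynomial (Fin 8) K :=
  C (algebraMap F K (a ^ q ^ i))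

/-- The four quadratic forms obtained from
`(S ^ q - S) ^ 2 = η Z ^ 2 + η ^ q Z ^ (2 q) - 2 β η ^ ((q + 1) / 2) Z ^ (q + 1)`
by taking its `q ^ i`-th power, for `i = 0, 1, 2, 3`, and writing `Yᵢ` for `Z ^ (q ^ i)` and `Wᵢ`
for `S ^ (q ^ (i + 1)) - S ^ (q ^ i)`, so that `W₃ = - (W₀ + W₁ + W₂)`. -/
noncomputable def quadrics (q : ℕ) (β η : F) : Set (MvPolynomial (Fin 8) K) :=
  {X 0 ^ 2 - (frobConst K q 0 η * X 4 ^ 2 + frobConst K q 1 η * X 5 ^ 2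
      - 2 * frobConst K q 0 (β * η ^ ((q + 1) / 2)) * X 4 * X 5),
   X 1 ^ 2 - (frobConst K q 1 η * X 5 ^ 2 + frobConst K q 2 η * X 6 ^ 2
      - 2 * frobConst K q 1 (β * η ^ ((q + 1) / 2)) * X 5 * X 6),
   X 2 ^ 2 - (frobConst K q 2 η * X 6 ^ 2 + frobConst K q 3 η * X 7 ^ 2
      - 2 * frobConst K q 2 (β * η ^ ((q + 1) / 2)) * X 6 * X 7),
   (X 0 + X 1 + X 2) ^ 2 - (frobConst K q 3 η * X 7 ^ 2 + frobConst K q 0 η * X 4 ^ 2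
      - 2 * frobConst K q 3 (β * η ^ ((q + 1) / 2)) * X 7 * X 4)}

/-- The variety `V` in seven-dimensional projective space. -/
def varietyV (q : ℕ) (β η : F) : Set (ℙ K (Fin 8 → K)) :=
  projectiveZeroLocus (quadrics K q β η)

/-- The linear form `Y₂ - Y₁ - k Y₀`, which defines the hyperplane with affine equation
`Y₂ = Y₁ + k` (in the chart `Y₀ = 1`). -/
noncomputable def hyperplaneForm {K : Type*} [Field K] (k : K) : MvPolynomial (Fin 8) K :=
  X 6 - X 5 - C k * X 4

/-- The intersection of `V` with the hyperplane `Y₂ = Y₁ + k Y₀` is an absolutely irreducible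
surface, and it is non-repeated: the intersection is reduced, that is, the five defining forms
generate a radical ideal. -/
def IsNonRepeatedIrreducibleSection (q : ℕ) (β η : F) (k : K) : Prop :=
  IsIrreducible (varietyV K q β η ∩ projectiveZeroLocus {hyperplaneForm k}) ∧
  topologicalKrullDim ↥(varietyV K q β η ∩ projectiveZeroLocus {hyperplaneForm k}) = 2 ∧
  (Ideal.span (insert (hyperplaneForm k) (quadrics K q β η))).IsRadical

end Variety

/-! Let s be a square root of η in K, σᵢ = s^(qⁱ) and yᵢ = σᵢ Yᵢ. As η is a non-square, s^(q⁴) = -s,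
and the quadrics become wᵢ² = yᵢ² + yᵢ₊₁² - 2 cᵢ yᵢ yᵢ₊₁ for i = 0, 1, 2 and (w₀ + w₁ + w₂)² = y₃² +
y₀² - 2 c₃ y₃ y₀, where cᵢ = β^(qⁱ) for i ≤ 2 and c₃ = -β^(q³). The heart of the matter is that
these quadrics generate a prime ideal, and still do after adding the form of all but finitely many
of the hyperplanes.

Primality. Let D be a polynomial ring P containing y₀, y₁, y₂ with w₀, w₁ adjoined. The fourth
quadric minus the third is linear in w₂ and y₃: it reads 2 v w₂ = 2 m y₃ + n with v = w₀ + w₁, m =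
c₂ y₂ - c₃ y₀, n = y₀² - y₂² - v². So the coordinate ring is a conic over D cut by a line.
Eliminating w₂ leaves a quadratic in y₃ with discriminant (4v)² Δ, where Δ is the product of the two
factors v² - (y₀² + y₂² - 2 (c₂c₃ ± ς) y₀ y₂) and ς² = (1 - c₂²)(1 - c₃²). If Δ is not a square in
the fraction field of D, the two intersection points are conjugate, and `isPrime_span_conicLine`
gives primality, provided v and m² - v² may be cancelled modulo the line.

Non-squareness of Δ. Since Δ involves w₀, w₁ only through w₀w₁, it suffices by
`NonsquareFrac.biquadratic` that w₀², w₁² and their product are non-squares and that the norm of Δ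
to P, a product of two `heron` expressions, is a non-square. This is tested on a line y₀ = 1, y₂ = t
y₁ + k, where the norm is an octic in y₁ with constant leading coefficient. Being a square is then a
closed condition on k (`finite_isSquare_octic`). At k = 0 the octic is, up to a constant, y₁⁴ times
two quadratics with equal leading and different middle coefficients, one of them separable
(`IsGenericCosines.not_isSquare_octic`). The sign of c₃ and the hypothesis on β give the
separability, once t = σ₂/σ₁ = η^(q(q-1)/2) avoids the roots of two polynomials; there are enough
non-squares η for that.

Consequences. The ideals of the first one, two and three quadrics are prime as well, and each omits
the next quadric. This gives codimension 4 (and 5 for the section), and makes the Hilbert function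
an iterated difference of that of the polynomial ring, whence the degree 2⁴ = 16. -/

/-! ### Non-squares and relatively prime elements -/

/-- `q` is not a square in the field of fractions. -/
def NonsquareFrac {R : Type*} [CommRing R] (q : R) : Prop :=
  ∀ a b : R, a ^ 2 = q * b ^ 2 → b = 0

/-- `e` is a nonzerodivisor modulo `d`. -/
def RegularMod {R : Type*} [CommRing R] (d e : R) : Prop :=
  ∀ x : R, d ∣ e * x → d ∣ x

section RegularMod

variable {R : Type*} [CommRing R]

/-- In a domain, coprimality in this sense is symmetric. It is usually easier to check modulo
elements of the base ring, and is turned around afterwards. -/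
theorem RegularMod.swap [IsDomain R] {a b : R} (hb : b ≠ 0) (h : RegularMod b a) :
    RegularMod a b := by
  rintro x ⟨y, hy⟩
  obtain ⟨z, rfl⟩ := h y ⟨x, hy.symm⟩
  exact ⟨z, mul_left_cancel₀ hb (by rw [hy]; ring)⟩

theorem RegularMod.of_mul {b a a' : R} (h : RegularMod b (a * a')) : RegularMod b a := by
  intro x hx
  refine h x ?_
  rw [mul_right_comm]
  exact hx.mul_right _

theorem RegularMod.mul {b a a' : R} (h : RegularMod b a) (h' : RegularMod b a') :
    RegularMod b (a * a') := by
  intro x hx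
  exact h' x (h _ (by rwa [← mul_assoc]))

theorem RegularMod.pow {b a : R} (h : RegularMod b a) (n : ℕ) : RegularMod b (a ^ n) := by
  induction n with
  | zero => intro x hx; simpa using hx
  | succ n ih => rw [pow_succ]; exact ih.mul h

theorem RegularMod.congr {b a : R} (h : RegularMod b a) {a' : R} (c : R) (h' : a' = a + b * c) :
    RegularMod b a' := by
  intro x hx
  refine h x ?_
  rw [h', add_mul, mul_assoc] at hx
  exact (dvd_add_left (dvd_mul_right _ _)).1 hx

theorem RegularMod.of_isUnit {b a : R} (h : IsUnit a) : RegularMod b a := by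
  intro x hx
  exact (h.dvd_mul_left).1 hx

theorem Prime.regularMod {p a : R} (hp : Prime p) (h : ¬ p ∣ a) : RegularMod p a := by
  intro x hx
  exact (hp.dvd_or_dvd hx).resolve_left h

theorem RegularMod.mul_left [IsDomain R] {p p' a : R} (hp : p ≠ 0) (h : RegularMod p a)
    (h' : RegularMod p' a) : RegularMod (p * p') a := by
  intro x hx
  obtain ⟨y, rfl⟩ := h x ((dvd_mul_right _ _).trans hx)
  obtain ⟨z, rfl⟩ := h' y (by
    obtain ⟨w, hw⟩ := hx
    exact ⟨w, mul_left_cancel₀ hp (by linear_combination hw)⟩)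
  exact ⟨z, by ring⟩

/-- If some coefficient of `f` is a nonzerodivisor modulo `d`, then so is `f`. -/
theorem RegularMod.polynomial {d : R} {f : Polynomial R} (n : ℕ) (h : RegularMod d (f.coeff n)) :
    RegularMod (Polynomial.C d) f := by
  intro x hx
  let ψ := Polynomial.mapRingHom (Ideal.Quotient.mk (Ideal.span {d}))
  have key : ∀ y : Polynomial R, ψ y = 0 ↔ Polynomial.C d ∣ y := by
    intro y
    rw [Polynomial.C_dvd_iff_dvd_coeff, Polynomial.ext_iff]
    simp [ψ, Ideal.Quotient.eq_zero_iff_mem, Ideal.mem_span_singleton]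
  rw [← key, map_mul] at hx
  rw [← key]
  by_contra hne
  obtain ⟨a, ha, hfa⟩ := (Polynomial.notMem_nonZeroDivisors_iff (P := ψ f)).1 (by
    intro hmem
    exact hne (mem_nonZeroDivisors_iff.1 hmem |>.1 _ hx))
  obtain ⟨a, rfl⟩ := Ideal.Quotient.mk_surjective a
  apply ha
  rw [Ideal.Quotient.eq_zero_iff_mem, Ideal.mem_span_singleton]
  apply h
  have := congrArg (fun g => Polynomial.coeff g n) hfa
  simp only [ψ, Polynomial.coe_mapRingHom, Polynomial.coeff_smul, Polynomial.coeff_map,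
    Polynomial.coeff_zero, smul_eq_mul, ← map_mul] at this
  rwa [Ideal.Quotient.eq_zero_iff_mem, Ideal.mem_span_singleton, mul_comm] at this

theorem RegularMod.quadraticAlgebra {d e q : R} (h : RegularMod d e) :
    RegularMod (algebraMap R (QuadraticAlgebra R q 0) d) (algebraMap R _ e) := by
  rintro x ⟨y, hy⟩
  obtain ⟨z, hz⟩ := h x.re ⟨y.re, by simpa using congrArg QuadraticAlgebra.re hy⟩
  obtain ⟨w, hw⟩ := h x.im ⟨y.im, by simpa using congrArg QuadraticAlgebra.im hy⟩
  exact ⟨⟨z, w⟩, by ext <;> simp [hz, hw]⟩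

end RegularMod

/-! ### Non-squares after adjoining square roots. -/

section NonsquareFrac

variable {R : Type*} [CommRing R]

/-- A factorial ring is integrally closed, so a square root of `q` among the fractions already lies
in `R`. -/
theorem nonsquareFrac_of_not_isSquare [IsDomain R] [UniqueFactorizationMonoid R] {q : R}
    (h : ¬ IsSquare q) : NonsquareFrac q := by
  intro a b hab
  by_contra hb
  have hd : b ^ 2 ∣ a ^ 2 := ⟨q, by rw [hab]; ring⟩
  rw [IsIntegrallyClosed.pow_dvd_pow_iff two_ne_zero] at hd
  obtain ⟨c, rfl⟩ := hd
  exact h ⟨c, mul_left_cancel₀ (pow_ne_zero 2 hb) (by linear_combination -hab)⟩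

theorem NonsquareFrac.eq_zero_of_norm {q a b : R} (h : NonsquareFrac q)
    [IsDomain R] (hab : a ^ 2 - q * b ^ 2 = 0) : a = 0 ∧ b = 0 := by
  have hb : b = 0 := h a b (by linear_combination hab)
  subst hb
  exact ⟨by simpa using hab, rfl⟩

/-- The norm a² - q b² is multiplicative and vanishes only at zero. -/
theorem NonsquareFrac.isDomain [IsDomain R] {q : R} (h : NonsquareFrac q) :
    IsDomain (QuadraticAlgebra R q 0) := by
  have : NoZeroDivisors (QuadraticAlgebra R q 0) := by
    refine ⟨fun {x y} hxy => ?_⟩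
    have hn : ∀ z : QuadraticAlgebra R q 0, z.norm = 0 → z = 0 := by
      intro z hz
      rw [QuadraticAlgebra.norm_def] at hz
      obtain ⟨h1, h2⟩ := h.eq_zero_of_norm (a := z.re) (b := z.im) (by linear_combination hz)
      ext <;> simp [h1, h2]
    have := congrArg QuadraticAlgebra.norm hxy
    rw [map_mul, QuadraticAlgebra.norm_zero, mul_eq_zero] at this
    exact this.imp (hn x) (hn y)
  exact NoZeroDivisors.to_isDomain _

/-- The Kummer argument: multiplying by the conjugate of `b` makes the denominator an element n of
`R`. The numerator z₀ + z₁√p then has square q n² in `R`, so z₀z₁ = 0, and either q or pq becomes a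
square of a fraction unless n = 0. -/
theorem NonsquareFrac.quadraticAlgebra [IsDomain R] {p q : R} (h2 : (2 : R) ≠ 0)
    (hp : NonsquareFrac p) (hq : NonsquareFrac q) (hpq : NonsquareFrac (p * q)) :
    NonsquareFrac (algebraMap R (QuadraticAlgebra R p 0) q) := by
  intro a b hab
  have hre := congrArg QuadraticAlgebra.re hab
  have him := congrArg QuadraticAlgebra.im hab
  simp only [pow_two, QuadraticAlgebra.re_mul, QuadraticAlgebra.im_mul, zero_mul, mul_zero,
    QuadraticAlgebra.algebraMap_re, QuadraticAlgebra.algebraMap_im, add_zero] at hre him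
  set n := b.re ^ 2 - p * b.im ^ 2 with hn
  set z0 := a.re * b.re - p * a.im * b.im
  set z1 := a.im * b.re - a.re * b.im
  have e1 : z0 ^ 2 + p * z1 ^ 2 = q * n ^ 2 := by
    linear_combination (b.re ^ 2 + p * b.im ^ 2) * hre - 2 * p * b.re * b.im * him
  have e2 : 2 * (z0 * z1) = 0 := by
    linear_combination (b.re ^ 2 + p * b.im ^ 2) * him - 2 * b.re * b.im * hre
  have hn0 : n = 0 := by
    rcases mul_eq_zero.1 ((mul_eq_zero.1 e2).resolve_left h2) with h | h
    · rw [h] at e1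
      exact hpq (p * z1) n (by linear_combination p * e1)
    · rw [h] at e1
      exact hq z0 n (by linear_combination e1)
  obtain ⟨h1, h2⟩ := hp.eq_zero_of_norm (hn.symm.trans hn0)
  ext <;> simp [h1, h2]

/-- In the biquadratic extension by `√p` and `√q`, an element `α + β √p √q` whose norm is not a
square is not a square. -/
theorem NonsquareFrac.biquadratic [IsDomain R] {p q α β : R} (h2 : (2 : R) ≠ 0)
    (hp : NonsquareFrac p) (hq : NonsquareFrac q) (hpq : NonsquareFrac (p * q))
    (h : NonsquareFrac (α ^ 2 - p * q * β ^ 2)) :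
    NonsquareFrac (⟨⟨α, 0⟩, ⟨0, β⟩⟩ :
      QuadraticAlgebra (QuadraticAlgebra R p 0) (algebraMap R _ q) 0) := by
  have hD1 := hp.isDomain
  have hq1 := hp.quadraticAlgebra h2 hq hpq
  have hD2 := hq1.isDomain
  rintro a b hab
  -- The image of `b` under the automorphism that negates both √p and √q. It fixes √p√q, so `b * σb`
  -- lies in R[√p√q].
  let σb : QuadraticAlgebra (QuadraticAlgebra R p 0) (algebraMap R _ q) 0 :=
    ⟨⟨b.re.re, -b.re.im⟩, ⟨-b.im.re, b.im.im⟩⟩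
  have hn : ∃ n0 n3 : R, b * σb = ⟨⟨n0, 0⟩, ⟨0, n3⟩⟩ := by
    refine ⟨b.re.re ^ 2 + p * q * b.im.im ^ 2 - p * b.re.im ^ 2 - q * b.im.re ^ 2,
      2 * b.re.re * b.im.im - 2 * b.re.im * b.im.re, ?_⟩
    ext <;> simp [σb] <;> ring
  obtain ⟨n0, n3, hn⟩ := hn
  obtain ⟨z, hz⟩ : ∃ z, z = a * σb := ⟨_, rfl⟩
  have hzz : z ^ 2 = (⟨⟨α, 0⟩, ⟨0, β⟩⟩ :
      QuadraticAlgebra (QuadraticAlgebra R p 0) (algebraMap R _ q) 0) * ⟨⟨n0, 0⟩, ⟨0, n3⟩⟩ ^ 2 := by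
    rw [← hn, hz]
    linear_combination σb ^ 2 * hab
  have e0 := congrArg (fun x => x.re.re) hzz
  have e1 := congrArg (fun x => x.re.im) hzz
  have e2 := congrArg (fun x => x.im.re) hzz
  have e3 := congrArg (fun x => x.im.im) hzz
  simp [pow_two] at e0 e1 e2 e3
  -- The square of z is fixed by the automorphism, so z itself is either fixed or negated: z lies in
  -- R + R√p√q or in R√p + R√q.
  have hsplit : z.re.re = 0 ∧ z.im.im = 0 ∨ z.re.im = 0 ∧ z.im.re = 0 := by
    have : (⟨⟨z.re.re, 0⟩, ⟨0, z.im.im⟩⟩ :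
      QuadraticAlgebra (QuadraticAlgebra R p 0) (algebraMap R _ q) 0) *
      ⟨⟨0, z.re.im⟩, ⟨z.im.re, 0⟩⟩ = 0 := by
      ext
      · simp
      · simp
        exact mul_left_cancel₀ h2 (by linear_combination e1)
      · simp
        exact mul_left_cancel₀ h2 (by linear_combination e2)
      · simp
    rcases mul_eq_zero.1 this with h | h
    · left
      exact ⟨congrArg (fun x => x.re.re) h, congrArg (fun x => x.im.im) h⟩
    · right
      exact ⟨congrArg (fun x => x.re.im) h, congrArg (fun x => x.im.re) h⟩
  -- Take norms from R[√p√q] to `R`. In both cases the norm of z² is a square in `R`, and it equals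
  -- the norm of α + β√p√q times the square of the norm of n₀ + n₃√p√q.
  have hN : n0 ^ 2 - p * q * n3 ^ 2 = 0 := by
    have hW := e3
    have hU := e0
    rcases hsplit with ⟨h1, h2⟩ | ⟨h1, h2⟩
    · rw [h1, h2] at hU hW
      refine h (z.re.im ^ 2 * p - z.im.re ^ 2 * q) _ ?_
      linear_combination (z.re.im ^ 2 * p + z.im.re ^ 2 * q + α * (n0 * n0 + p * (q * n3) * n3) +
        p * (q * β) * (n0 * n3 + n3 * n0)) * hU - p * q * (2 * z.re.im * z.im.re +
        α * (n0 * n3 + n3 * n0) + β * (n0 * n0 + p * (q * n3) * n3)) * hW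
    · rw [h1, h2] at hU hW
      refine h (z.re.re ^ 2 - z.im.im ^ 2 * (p * q)) _ ?_
      linear_combination (z.re.re ^ 2 + z.im.im ^ 2 * (p * q) + α * (n0 * n0 + p * (q * n3) * n3) +
        p * (q * β) * (n0 * n3 + n3 * n0)) * hU - p * q * (2 * z.re.re * z.im.im +
        α * (n0 * n3 + n3 * n0) + β * (n0 * n0 + p * (q * n3) * n3)) * hW
  obtain ⟨h1, h2⟩ := hpq.eq_zero_of_norm hN
  rw [h1, h2] at hn
  have hbσ : b * σb = 0 := hn
  rcases mul_eq_zero.1 hbσ with h | h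
  · exact h
  · have g0 := congrArg (fun x => x.re.re) h
    have g1 := congrArg (fun x => x.re.im) h
    have g2 := congrArg (fun x => x.im.re) h
    have g3 := congrArg (fun x => x.im.im) h
    simp [σb] at g0 g1 g2 g3
    ext <;> simp [*]

end NonsquareFrac

/-! ### A prime ideal generated by a line section of a conic -/

section Conic

theorem exists_pseudo_division {D : Type*} [CommRing D] (A B E : D) (H : Polynomial D) :
    ∃ (m : ℕ) (Z : Polynomial D) (r₁ r₀ : D), Polynomial.C A ^ m * H =
      (Polynomial.C A * Polynomial.X ^ 2 + Polynomial.C B * Polynomial.X + Polynomial.C E) * Z +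
        (Polynomial.C r₁ * Polynomial.X + Polynomial.C r₀) := by
  induction H using Polynomial.induction_on with
  | C a => exact ⟨0, 0, 0, a, by simp⟩
  | add p q hp hq =>
    obtain ⟨m, Z, r₁, r₀, h⟩ := hp
    obtain ⟨m', Z', r₁', r₀', h'⟩ := hq
    refine ⟨m + m', Polynomial.C A ^ m' * Z + Polynomial.C A ^ m * Z',
      A ^ m' * r₁ + A ^ m * r₁', A ^ m' * r₀ + A ^ m * r₀', ?_⟩
    simp only [map_add, map_mul, map_pow]
    linear_combination Polynomial.C A ^ m' * h + Polynomial.C A ^ m * h'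
  | monomial n a h =>
    obtain ⟨m, Z, r₁, r₀, h⟩ := h
    refine ⟨m + 1, Polynomial.C A * Polynomial.X * Z + Polynomial.C r₁,
      A * r₀ - r₁ * B, -(r₁ * E), ?_⟩
    simp only [map_sub, map_mul, map_neg]
    linear_combination Polynomial.C A * Polynomial.X * h

/-- The ring homomorphism out of a quadratic algebra that is given by a square root. -/
def QuadraticAlgebra.liftRingHom {R S : Type*} [CommRing R] [CommRing S] {q : R} (f : R →+* S)
    (u : S) (hu : u ^ 2 = f q) : QuadraticAlgebra R q 0 →+* S where
  toFun x := f x.re + f x.im * u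
  map_zero' := by simp
  map_one' := by
    change f 1 + f 0 * u = 1
    simp
  map_add' x y := by simp; ring
  map_mul' x y := by
    simp
    linear_combination - f x.im * f y.im * hu

@[simp] theorem QuadraticAlgebra.liftRingHom_algebraMap {R S : Type*} [CommRing R] [CommRing S]
    {q : R} (f : R →+* S) (u : S) (hu : u ^ 2 = f q) (r : R) :
    QuadraticAlgebra.liftRingHom f u hu (algebraMap R _ r) = f r := by
  simp [QuadraticAlgebra.liftRingHom]

@[simp] theorem QuadraticAlgebra.liftRingHom_omega {R S : Type*} [CommRing R] [CommRing S]
    {q : R} (f : R →+* S) (u : S) (hu : u ^ 2 = f q) :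
    QuadraticAlgebra.liftRingHom f u hu QuadraticAlgebra.omega = u := by
  simp [QuadraticAlgebra.liftRingHom]

theorem QuadraticAlgebra.eq_add_omega {R : Type*} [CommRing R] {q : R}
    (x : QuadraticAlgebra R q 0) :
    x = algebraMap R _ x.re + algebraMap R _ x.im * QuadraticAlgebra.omega := by
  ext <;> simp

theorem QuadraticAlgebra.omega_sq {R : Type*} [CommRing R] {q : R} :
    (QuadraticAlgebra.omega : QuadraticAlgebra R q 0) ^ 2 = algebraMap R _ q := by
  ext <;> simp [pow_two]

variable {D : Type*} [CommRing D]

/-- The conic `w ^ 2 = Y ^ 2 - 2 b Y + e`. -/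
noncomputable def conicPoly (b e : D) : Polynomial D :=
  Polynomial.X ^ 2 - Polynomial.C (2 * b) * Polynomial.X + Polynomial.C e

theorem map_conicPoly {S : Type*} [CommRing S] (f : Polynomial D →+* S) (b e : D) :
    f (conicPoly b e) =
      f Polynomial.X ^ 2 - 2 * f (Polynomial.C b) * f Polynomial.X + f (Polynomial.C e) := by
  simp [conicPoly, map_ofNat]

/-- The line `2 v w = 2 m Y + n`. -/
noncomputable def conicLine (b e v m n : D) : QuadraticAlgebra (Polynomial D) (conicPoly b e) 0 :=
  ⟨-(Polynomial.C (2 * m) * Polynomial.X + Polynomial.C n), Polynomial.C (2 * v)⟩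

variable {b e v m n : D}

/-- The cofactor is the conjugate under w ↦ -w, so the product is the norm of the line: the
quadratic in Y left after eliminating w. -/
theorem conicLine_dvd :
    conicLine b e v m n ∣ algebraMap (Polynomial D) _
      (Polynomial.C (4 * (m ^ 2 - v ^ 2)) * Polynomial.X ^ 2 +
        Polynomial.C (4 * m * n + 8 * v ^ 2 * b) * Polynomial.X +
        Polynomial.C (n ^ 2 - 4 * v ^ 2 * e)) := by
  refine ⟨⟨-(Polynomial.C (2 * m) * Polynomial.X + Polynomial.C n), -Polynomial.C (2 * v)⟩, ?_⟩
  ext1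
  · simp only [conicLine, QuadraticAlgebra.re_mul, QuadraticAlgebra.im_mul,
      QuadraticAlgebra.algebraMap_re, QuadraticAlgebra.algebraMap_im]
    simp [conicPoly, map_ofNat]
    ring
  · simp only [conicLine, QuadraticAlgebra.re_mul, QuadraticAlgebra.im_mul,
      QuadraticAlgebra.algebraMap_re, QuadraticAlgebra.algebraMap_im]
    simp [map_ofNat]
    ring

variable [IsDomain D]

/-- Modulo v the line degenerates to -(2mY + n), whose leading coefficient is regular modulo v.
Hence v divides the cofactor y componentwise, and v can be cancelled. -/
theorem regularMod_conicLine_v (h2 : IsUnit (2 : D)) (hv : v ≠ 0) (hvm : RegularMod v m) :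
    RegularMod (conicLine b e v m n) (algebraMap (Polynomial D) _ (Polynomial.C v)) := by
  have hG : RegularMod (Polynomial.C v) (Polynomial.C (2 * m) * Polynomial.X + Polynomial.C n) :=
    RegularMod.polynomial 1 (by simpa using (RegularMod.of_isUnit h2).mul hvm)
  rintro x ⟨y, hy⟩
  have hre := congrArg QuadraticAlgebra.re hy
  have him := congrArg QuadraticAlgebra.im hy
  simp only [conicLine, QuadraticAlgebra.re_mul, QuadraticAlgebra.im_mul,
    QuadraticAlgebra.algebraMap_re, QuadraticAlgebra.algebraMap_im, zero_mul, mul_zero, add_zero,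
    map_mul, map_ofNat] at hre him
  obtain ⟨z0, hz0⟩ := hG y.re ⟨2 * conicPoly b e * y.im - x.re, by
    simp only [map_mul, map_ofNat]
    linear_combination hre⟩
  obtain ⟨z1, hz1⟩ := hG y.im ⟨2 * y.re - x.im, by
    simp only [map_mul, map_ofNat]
    linear_combination him⟩
  have hv' : Polynomial.C v ≠ 0 := by simpa using hv
  refine ⟨⟨z0, z1⟩, ?_⟩
  ext1
  · apply mul_left_cancel₀ hv'
    simp only [conicLine, QuadraticAlgebra.re_mul, QuadraticAlgebra.im_mul, zero_mul, add_zero,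
      map_mul, map_ofNat]
    rw [hz0, hz1] at hre
    linear_combination hre
  · apply mul_left_cancel₀ hv'
    simp only [conicLine, QuadraticAlgebra.re_mul, QuadraticAlgebra.im_mul, zero_mul, add_zero,
      map_mul, map_ofNat]
    rw [hz0, hz1] at him
    linear_combination him

/-- The constant term of the norm quadratic is coprime to m² - v², hence so is the norm, and so is
its divisor, the line. -/
theorem regularMod_conicLine_lead (hA : m ^ 2 - v ^ 2 ≠ 0)
    (hAE : RegularMod (m ^ 2 - v ^ 2) (n ^ 2 - 4 * v ^ 2 * e)) :
    RegularMod (conicLine b e v m n)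
      (algebraMap (Polynomial D) _ (Polynomial.C (m ^ 2 - v ^ 2))) := by
  have hR := (RegularMod.polynomial (d := m ^ 2 - v ^ 2)
    (f := Polynomial.C (4 * (m ^ 2 - v ^ 2)) * Polynomial.X ^ 2 +
        Polynomial.C (4 * m * n + 8 * v ^ 2 * b) * Polynomial.X +
        Polynomial.C (n ^ 2 - 4 * v ^ 2 * e)) 0 (by simpa [-map_sub, -map_pow, -map_mul, -map_add] using hAE)).quadraticAlgebra
        (q := conicPoly b e)
  obtain ⟨z, hz⟩ := conicLine_dvd (b := b) (e := e) (v := v) (m := m) (n := n)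
  rw [hz] at hR
  have h := hR.of_mul
  rintro x ⟨y, hy⟩
  obtain ⟨w, rfl⟩ := h y ⟨x, hy.symm⟩
  refine ⟨w, ?_⟩
  have hA' : Polynomial.C (m ^ 2 - v ^ 2) ≠ 0 := Polynomial.C_ne_zero.2 hA
  have hre := congrArg QuadraticAlgebra.re hy
  have him := congrArg QuadraticAlgebra.im hy
  simp only [QuadraticAlgebra.re_mul, QuadraticAlgebra.im_mul, QuadraticAlgebra.algebraMap_re,
    QuadraticAlgebra.algebraMap_im] at hre him
  ext1
  · apply mul_left_cancel₀ hA'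
    simp only [QuadraticAlgebra.re_mul]
    linear_combination hre
  · apply mul_left_cancel₀ hA'
    simp only [QuadraticAlgebra.im_mul]
    linear_combination him

theorem exists_embedding_isAlgClosed.{u} (D : Type u) [CommRing D] [IsDomain D] :
    ∃ (Ω : Type u) (_ : Field Ω) (_ : IsAlgClosed Ω) (ι : D →+* Ω), Function.Injective ι := by
  refine ⟨AlgebraicClosure (FractionRing D), inferInstance, inferInstance,
    (algebraMap (FractionRing D) _).comp (algebraMap D (FractionRing D)), ?_⟩
  rw [RingHom.coe_comp]
  exact (RingHom.injective _).comp (IsFractionRing.injective _ _)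

/-- The ideal is the kernel of evaluation at one of the two points where the line meets the conic,
taken in an algebraically closed field Ω. If an element vanishes there, multiply it by 2v to
eliminate w, then divide by the quadratic of which ζ is a root. The remainder is zero because ζ is
not rational over the fractions of `D`. The multipliers A^k and 2v are cancelled by coprimality with
the line. -/
theorem isPrime_span_conicLine {Δ : D} (h2 : IsUnit (2 : D)) (hv : v ≠ 0) (hvm : RegularMod v m)
    (hA : m ^ 2 - v ^ 2 ≠ 0) (hAE : RegularMod (m ^ 2 - v ^ 2) (n ^ 2 - 4 * v ^ 2 * e))
    (hΔ : NonsquareFrac Δ)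
    (hdisc : (4 * m * n + 8 * v ^ 2 * b) ^ 2 -
      4 * (4 * (m ^ 2 - v ^ 2)) * (n ^ 2 - 4 * v ^ 2 * e) = (4 * v) ^ 2 * Δ) :
    (Ideal.span {conicLine b e v m n}).IsPrime := by
  have h20 : (2 : D) ≠ 0 := h2.ne_zero
  have h40 : (4 : D) ≠ 0 := by
    have : (4 : D) = 2 * 2 := by norm_num
    rw [this]; exact mul_ne_zero h20 h20
  obtain ⟨Ω, _, _, ι, hι⟩ := exists_embedding_isAlgClosed D
  have hι0 : ∀ x : D, x ≠ 0 → ι x ≠ 0 := fun x hx => (map_ne_zero_iff ι hι).2 hx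
  set A := 4 * (m ^ 2 - v ^ 2) with hAdef
  set B := 4 * m * n + 8 * v ^ 2 * b with hBdef
  set E := n ^ 2 - 4 * v ^ 2 * e with hEdef
  have hA4 : A ≠ 0 := mul_ne_zero h40 hA
  have h2' : (2 : Ω) ≠ 0 := by simpa [map_ofNat] using hι0 2 h20
  obtain ⟨ζ, hζ⟩ : ∃ ζ : Ω, ι A * ζ ^ 2 + ι B * ζ + ι E = 0 := by
    obtain ⟨δ, hδ⟩ := IsAlgClosed.exists_pow_nat_eq (ι (B ^ 2 - 4 * A * E)) (n := 2) (by norm_num)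
    have hA' : ι A ≠ 0 := hι0 A hA4
    refine ⟨(-ι B + δ) / (2 * ι A), ?_⟩
    field_simp
    simp only [map_sub, map_mul, map_pow, map_ofNat] at hδ
    linear_combination hδ
  have hvι : ι v ≠ 0 := hι0 v hv
  have hvΩ : (2 : Ω) * ι v ≠ 0 := mul_ne_zero h2' hvι
  -- A nontrivial linear relation would make ζ a fraction: the identity (2A r₀ - B r₁)² = (B² - 4AE)
  -- r₁² would exhibit Δ as a square.
  have hind : ∀ r₁ r₀ : D, ι r₁ * ζ + ι r₀ = 0 → r₁ = 0 ∧ r₀ = 0 := by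
    intro r₁ r₀ hr
    have h : A * r₀ ^ 2 - B * r₀ * r₁ + E * r₁ ^ 2 = 0 := by
      apply hι
      simp only [map_add, map_sub, map_mul, map_pow, map_zero]
      linear_combination (ι r₁) ^ 2 * hζ + (ι A * ι r₀ - ι A * ζ * ι r₁ - ι B * ι r₁) * hr
    have h1 : 4 * v * r₁ = 0 := hΔ (2 * A * r₀ - B * r₁) _ (by
      linear_combination 4 * A * h + r₁ ^ 2 * hdisc)
    have h1' : r₁ = 0 := by
      rcases mul_eq_zero.1 h1 with h | h
      · exact absurd h (mul_ne_zero h40 hv)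
      · exact h
    subst h1'
    refine ⟨rfl, hι ?_⟩
    simpa using hr
  let f : Polynomial D →+* Ω := Polynomial.eval₂RingHom ι ζ
  let u : Ω := (2 * ι m * ζ + ι n) / (2 * ι v)
  have hu2 : 2 * ι v * u = 2 * ι m * ζ + ι n := by simp only [u]; field_simp
  have hu : u ^ 2 = f (conicPoly b e) := by
    simp only [hAdef, hBdef, hEdef, map_sub, map_add, map_mul, map_pow, map_ofNat] at hζ
    simp [f, conicPoly, u, map_ofNat]
    field_simp
    linear_combination hζ
  clear_value u
  let Φ := QuadraticAlgebra.liftRingHom f u hu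
  have hΦ : ∀ x, Φ x = f x.re + f x.im * u := fun _ => rfl
  have hΦg : Φ (conicLine b e v m n) = 0 := by
    simp [hΦ, conicLine, f, map_ofNat]
    linear_combination hu2
  have hreg : RegularMod (conicLine b e v m n) (algebraMap (Polynomial D) _ (Polynomial.C 2)) := by
    apply RegularMod.of_isUnit
    exact (h2.map Polynomial.C).map _
  have hreg4 : RegularMod (conicLine b e v m n) (algebraMap (Polynomial D) _ (Polynomial.C A)) := by
    have := (hreg.mul hreg).mul (regularMod_conicLine_lead hA hAE (b := b))
    convert this using 1
    rw [hAdef, ← map_mul, ← map_mul, ← map_mul, ← map_mul]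
    congr 2
    ring
  have hregv := hreg.mul (regularMod_conicLine_v (b := b) (e := e) (n := n) h2 hv hvm)
  have hker : ∀ x, Φ x = 0 → conicLine b e v m n ∣ x := by
    intro x hx
    -- This is 2v x after substituting 2vw = 2mY + n, hence a polynomial in Y alone.
    set H : Polynomial D := Polynomial.C (2 * v) * x.re +
      x.im * (Polynomial.C (2 * m) * Polynomial.X + Polynomial.C n) with hH
    have hHx : algebraMap (Polynomial D) _ H =
        algebraMap (Polynomial D) _ (Polynomial.C 2) * algebraMap (Polynomial D) _ (Polynomial.C v)
          * x - conicLine b e v m n * algebraMap (Polynomial D) _ x.im := by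
      ext1
      · simp [conicLine, hH]; ring
      · simp [conicLine]
    have hfH : f H = 0 := by
      have : f H = Φ (algebraMap (Polynomial D) _ H) := by simp [hΦ]
      rw [this, hHx, map_sub, map_mul, map_mul, map_mul, hx, hΦg]
      ring
    obtain ⟨k, Z, r₁, r₀, hZ⟩ := exists_pseudo_division A B E H
    have hr := congrArg f hZ
    obtain ⟨h1, h0⟩ := hind r₁ r₀ (by
      rw [map_mul, hfH] at hr
      simp [f] at hr
      rw [hζ] at hr
      linear_combination -hr)
    rw [h1, h0] at hZ
    simp only [map_zero, zero_mul, add_zero] at hZ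
    have hdvd : conicLine b e v m n ∣ algebraMap (Polynomial D) _ H := by
      apply hreg4.pow k
      rw [← map_pow, ← map_mul, hZ, map_mul]
      exact conicLine_dvd.mul_right _
    apply hregv
    rw [hHx] at hdvd
    exact (dvd_sub_left (dvd_mul_right _ _)).1 hdvd
  have : Ideal.span {conicLine b e v m n} = RingHom.ker Φ := by
    ext x
    rw [Ideal.mem_span_singleton, RingHom.mem_ker]
    refine ⟨?_, hker x⟩
    rintro ⟨y, rfl⟩
    rw [map_mul, hΦg, zero_mul]
  rw [this]
  exact RingHom.ker_isPrime Φ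

end Conic

/-! ### The tower of square roots -/

section Tower

/-- The ring `R[√p, √q]`. -/
abbrev BiquadraticAlgebra (R : Type*) [CommRing R] (p q : R) : Type _ :=
  QuadraticAlgebra (QuadraticAlgebra R p 0) (algebraMap R _ q) 0

/-- The norm of `√p + √q + √r` where `r = a ^ 2 + b ^ 2 - 2 c a b`. -/
def heron {R : Type*} [CommRing R] (p q a b c : R) : R :=
  (a ^ 2 + b ^ 2 - 2 * c * a * b - p - q) ^ 2 - 4 * (p * q)

variable {R : Type*} [CommRing R]

theorem RegularMod.biquadraticAlgebra {d e p q : R} (h : RegularMod d e) :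
    RegularMod (algebraMap R (BiquadraticAlgebra R p q) d) (algebraMap R _ e) :=
  h.quadraticAlgebra.quadraticAlgebra

/-- The element `√p + √q`. -/
def sumRoots (p q : R) : BiquadraticAlgebra R p q := ⟨⟨0, 1⟩, ⟨1, 0⟩⟩

/-- The element `√p - √q`. -/
def diffRoots (p q : R) : BiquadraticAlgebra R p q := ⟨⟨0, 1⟩, ⟨-1, 0⟩⟩

theorem BiquadraticAlgebra.algebraMap_eq {p q : R} (r : R) :
    algebraMap R (BiquadraticAlgebra R p q) r = ⟨⟨r, 0⟩, ⟨0, 0⟩⟩ := rfl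

theorem BiquadraticAlgebra.algebraMap_injective {p q : R} :
    Function.Injective (algebraMap R (BiquadraticAlgebra R p q)) := by
  intro a b h
  exact congrArg (fun x => x.re.re) h

theorem sumRoots_mul_diffRoots (p q : R) :
    sumRoots p q * diffRoots p q = algebraMap R _ (p - q) := by
  rw [BiquadraticAlgebra.algebraMap_eq]
  ext <;> simp [sumRoots, diffRoots] <;> ring

theorem sumRoots_sq (p q : R) : sumRoots p q ^ 2 = ⟨⟨p + q, 0⟩, ⟨0, 2⟩⟩ := by
  ext <;> simp [sumRoots, pow_two] <;> ring

theorem diffRoots_sq (p q : R) : diffRoots p q ^ 2 = ⟨⟨p + q, 0⟩, ⟨0, -2⟩⟩ := by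
  ext <;> simp [diffRoots, pow_two] <;> ring

/-- The hypotheses of `isPrime_span_conicLine` are brought down to `R` by conjugation. The element v
divides v(√p - √q) = p - q, and M² - v² divides (M² - p - q)² - 4pq. Modulo M² - v² the constant
term n² - 4v²e is a polynomial in y₀, y₂ only. The norm of Δ is the product of the two `heron`
values. With c₂, c₃ read as cosines, c₂c₃ ∓ ς are the cosines of the sum and of the difference of
the angles, which is what factors the discriminant. -/
theorem isPrime_span_conicLine_tower [IsDomain R] {y₀ y₂ p q c₂ c₃ ς : R} (h2 : IsUnit (2 : R))
    (hp : NonsquareFrac p) (hq : NonsquareFrac q) (hpq : NonsquareFrac (p * q))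
    (hς : ς ^ 2 = (1 - c₂ ^ 2) * (1 - c₃ ^ 2))
    (hR : NonsquareFrac (heron p q y₀ y₂ (c₂ * c₃ - ς) * heron p q y₀ y₂ (c₂ * c₃ + ς)))
    (hM : c₂ * y₂ - c₃ * y₀ ≠ 0) (hMreg : RegularMod (c₂ * y₂ - c₃ * y₀) (p - q))
    (hN : (y₀ ^ 2 - y₂ ^ 2 - (c₂ * y₂ - c₃ * y₀) ^ 2) ^ 2 -
      4 * (c₂ * y₂ - c₃ * y₀) ^ 2 * y₂ ^ 2 ≠ 0)
    (hNreg : RegularMod ((y₀ ^ 2 - y₂ ^ 2 - (c₂ * y₂ - c₃ * y₀) ^ 2) ^ 2 -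
      4 * (c₂ * y₂ - c₃ * y₀) ^ 2 * y₂ ^ 2)
      (((c₂ * y₂ - c₃ * y₀) ^ 2 - p - q) ^ 2 - 4 * (p * q))) :
    (Ideal.span {conicLine (algebraMap R (BiquadraticAlgebra R p q) (c₂ * y₂))
      (algebraMap R _ (y₂ ^ 2)) (sumRoots p q) (algebraMap R _ (c₂ * y₂ - c₃ * y₀))
      (algebraMap R _ (y₀ ^ 2 - y₂ ^ 2) - sumRoots p q ^ 2)}).IsPrime := by
  have h20 : (2 : R) ≠ 0 := h2.ne_zero
  have := hp.isDomain
  have := (hp.quadraticAlgebra h20 hq hpq).isDomain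
  set v := sumRoots p q with hv
  have hι : Function.Injective (algebraMap R (BiquadraticAlgebra R p q)) :=
    BiquadraticAlgebra.algebraMap_injective
  set M := c₂ * y₂ - c₃ * y₀ with hMdef
  have hv0 : v ≠ 0 := by
    intro h
    have := congrArg (fun x => x.re.im) h
    simp [hv, sumRoots] at this
  have hvM : RegularMod v (algebraMap R _ M) := by
    apply RegularMod.swap
    · exact (map_ne_zero_iff _ hι).2 hM
    · have := hMreg.biquadraticAlgebra (p := p) (q := q)
      rw [← sumRoots_mul_diffRoots] at this
      exact this.of_mul
  have hA : (algebraMap R (BiquadraticAlgebra R p q) M) ^ 2 - v ^ 2 ≠ 0 := by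
    intro h
    rw [hv, sumRoots_sq, ← map_pow] at h
    have := congrArg (fun x => x.im.im) h
    simp [BiquadraticAlgebra.algebraMap_eq] at this
    exact h20 this
  refine isPrime_span_conicLine (Δ := (v ^ 2 - algebraMap R _ (y₀ ^ 2 + y₂ ^ 2 -
    2 * (c₂ * c₃ - ς) * y₀ * y₂)) * (v ^ 2 - algebraMap R _ (y₀ ^ 2 + y₂ ^ 2 -
    2 * (c₂ * c₃ + ς) * y₀ * y₂))) ?_ hv0 hvM hA ?_ ?_ ?_
  · simpa [map_ofNat] using h2.map (algebraMap R (BiquadraticAlgebra R p q))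
  · have h1 := hNreg.biquadraticAlgebra (p := p) (q := q)
    have h3 : algebraMap R (BiquadraticAlgebra R p q) ((M ^ 2 - p - q) ^ 2 - 4 * (p * q)) =
        ((algebraMap R (BiquadraticAlgebra R p q) M) ^ 2 - v ^ 2) *
        ((algebraMap R (BiquadraticAlgebra R p q) M) ^ 2 - diffRoots p q ^ 2) := by
      rw [hv, sumRoots_sq, diffRoots_sq, ← map_pow]
      simp only [BiquadraticAlgebra.algebraMap_eq]
      ext <;> simp <;> ring
    rw [h3] at h1
    have h4 := h1.of_mul.swap ((map_ne_zero_iff _ hι).2 hN)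
    refine h4.congr (2 * algebraMap R _ (y₀ ^ 2 - y₂ ^ 2) - v ^ 2 - algebraMap R _ M ^ 2 +
      4 * algebraMap R _ (y₂ ^ 2)) ?_
    simp only [map_sub, map_mul, map_pow, map_ofNat]
    ring
  · have h := NonsquareFrac.biquadratic (α := (p + q) ^ 2 + 4 * (p * q) -
      (2 * (y₀ ^ 2 + y₂ ^ 2) - 4 * (c₂ * c₃) * y₀ * y₂) * (p + q) +
      (y₀ ^ 2 + y₂ ^ 2 - 2 * (c₂ * c₃ - ς) * y₀ * y₂) *
      (y₀ ^ 2 + y₂ ^ 2 - 2 * (c₂ * c₃ + ς) * y₀ * y₂))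
      (β := 4 * (p + q) - 2 * (2 * (y₀ ^ 2 + y₂ ^ 2) - 4 * (c₂ * c₃) * y₀ * y₂)) h20 hp hq hpq (by
        convert hR using 1
        simp only [heron]
        ring)
    convert h using 1
    rw [hv, sumRoots_sq]
    simp only [BiquadraticAlgebra.algebraMap_eq]
    ext <;> simp <;> ring
  · have hς' := congrArg (algebraMap R (BiquadraticAlgebra R p q)) hς
    simp only [hMdef, map_sub, map_add, map_mul, map_pow, map_ofNat, map_one] at hς' ⊢
    linear_combination (64 * v ^ 2 * (algebraMap R _ y₀) ^ 2 * (algebraMap R _ y₂) ^ 2) * hς'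

end Tower

/-! ### The quadrics in rescaled coordinates -/

section Scaled

variable {K : Type*} [Field K]

/-- The `i`-th quadric, for the coordinates `σᵢ Yᵢ`. -/
noncomputable def scaledQuadric (σ c : Fin 4 → K) : Fin 4 → MvPolynomial (Fin 8) K :=
  ![X 0 ^ 2 - (C (σ 0 ^ 2) * X 4 ^ 2 + C (σ 1 ^ 2) * X 5 ^ 2
      - 2 * C (c 0 * (σ 0 * σ 1)) * X 4 * X 5),
    X 1 ^ 2 - (C (σ 1 ^ 2) * X 5 ^ 2 + C (σ 2 ^ 2) * X 6 ^ 2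
      - 2 * C (c 1 * (σ 1 * σ 2)) * X 5 * X 6),
    X 2 ^ 2 - (C (σ 2 ^ 2) * X 6 ^ 2 + C (σ 3 ^ 2) * X 7 ^ 2
      - 2 * C (c 2 * (σ 2 * σ 3)) * X 6 * X 7),
    (X 0 + X 1 + X 2) ^ 2 - (C (σ 3 ^ 2) * X 7 ^ 2 + C (σ 0 ^ 2) * X 4 ^ 2
      - 2 * C (c 3 * (σ 3 * σ 0)) * X 7 * X 4)]

variable {P : Type*} [CommRing P] [Algebra K P]

/-- The form `a ^ 2 + b ^ 2 - 2 c a b`. -/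
def cosineForm {R : Type*} [CommRing R] (c a b : R) : R := a ^ 2 + b ^ 2 - 2 * c * a * b

theorem map_cosineForm {R S : Type*} [CommRing R] [CommRing S] (f : R →+* S) (c a b : R) :
    f (cosineForm c a b) = cosineForm (f c) (f a) (f b) := by
  simp [cosineForm, map_ofNat]

/-- The ring `P[w₀, w₁]` modulo the first two quadrics. -/
abbrev PairTower (c : Fin 4 → K) (y₀ y₁ y₂ : P) : Type _ :=
  BiquadraticAlgebra P
    (cosineForm (algebraMap K P (c 0)) y₀ y₁) (cosineForm (algebraMap K P (c 1)) y₁ y₂)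

/-- The ring `P[w₀, w₁, w₂, Y]` modulo the first three quadrics. -/
abbrev QuadricTower (c : Fin 4 → K) (y₀ y₁ y₂ : P) : Type _ :=
  QuadraticAlgebra (Polynomial (PairTower c y₀ y₁ y₂))
    (conicPoly (algebraMap P _ (algebraMap K P (c 2) * y₂)) (algebraMap P _ (y₂ ^ 2))) 0

variable (σ c : Fin 4 → K) (x y₀ y₁ y₂ : P)

/-- The element of `QuadricTower` that corresponds to the last quadric. -/
noncomputable def lastQuadric : QuadricTower c y₀ y₁ y₂ :=
  conicLine _ _ (sumRoots _ _)
    (algebraMap P _ (algebraMap K P (c 2) * y₂ - algebraMap K P (c 3) * y₀))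
    (algebraMap P _ (y₀ ^ 2 - y₂ ^ 2) - sumRoots _ _ ^ 2)

/-- The structure map of `QuadricTower`. -/
noncomputable def QuadricTower.ofBase : P →+* QuadricTower c y₀ y₁ y₂ :=
  (algebraMap (Polynomial (PairTower c y₀ y₁ y₂)) (QuadricTower c y₀ y₁ y₂)).comp
    (Polynomial.C.comp (algebraMap P (PairTower c y₀ y₁ y₂)))

/-- The square root `w₀`. -/
noncomputable def QuadricTower.w₀ : QuadricTower c y₀ y₁ y₂ :=
  algebraMap (Polynomial (PairTower c y₀ y₁ y₂)) (QuadricTower c y₀ y₁ y₂)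
    (Polynomial.C (algebraMap (QuadraticAlgebra P (cosineForm (algebraMap K P (c 0)) y₀ y₁) 0)
      (PairTower c y₀ y₁ y₂) QuadraticAlgebra.omega))

/-- The square root `w₁`. -/
noncomputable def QuadricTower.w₁ : QuadricTower c y₀ y₁ y₂ :=
  algebraMap (Polynomial (PairTower c y₀ y₁ y₂)) (QuadricTower c y₀ y₁ y₂)
    (Polynomial.C (QuadraticAlgebra.omega : PairTower c y₀ y₁ y₂))

/-- The variable `Y`. -/
noncomputable def QuadricTower.y₃ : QuadricTower c y₀ y₁ y₂ :=
  algebraMap (Polynomial (PairTower c y₀ y₁ y₂)) (QuadricTower c y₀ y₁ y₂) Polynomial.X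

/-- The coordinates as elements of `QuadricTower`. -/
noncomputable def towerCoords : Fin 8 → QuadricTower c y₀ y₁ y₂ :=
    ![QuadricTower.w₀ c y₀ y₁ y₂, QuadricTower.w₁ c y₀ y₁ y₂, QuadraticAlgebra.omega,
      QuadricTower.ofBase c y₀ y₁ y₂ x,
      QuadricTower.ofBase c y₀ y₁ y₂ (algebraMap K P (σ 0)⁻¹ * y₀),
      QuadricTower.ofBase c y₀ y₁ y₂ (algebraMap K P (σ 1)⁻¹ * y₁),
      QuadricTower.ofBase c y₀ y₁ y₂ (algebraMap K P (σ 2)⁻¹ * y₂),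
      QuadricTower.ofBase c y₀ y₁ y₂ (algebraMap K P (σ 3)⁻¹) * QuadricTower.y₃ c y₀ y₁ y₂]

/-- The evaluation of polynomials in `QuadricTower`. -/
noncomputable def toTower : MvPolynomial (Fin 8) K →+* QuadricTower c y₀ y₁ y₂ :=
  eval₂Hom ((QuadricTower.ofBase c y₀ y₁ y₂).comp (algebraMap K P)) (towerCoords σ c x y₀ y₁ y₂)

theorem QuadricTower.w₀_sq : QuadricTower.w₀ c y₀ y₁ y₂ ^ 2 =
    QuadricTower.ofBase c y₀ y₁ y₂ (cosineForm (algebraMap K P (c 0)) y₀ y₁) := by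
  simp only [QuadricTower.w₀, ← map_pow, QuadraticAlgebra.omega_sq]
  rfl

theorem QuadricTower.w₁_sq : QuadricTower.w₁ c y₀ y₁ y₂ ^ 2 =
    QuadricTower.ofBase c y₀ y₁ y₂ (cosineForm (algebraMap K P (c 1)) y₁ y₂) := by
  simp only [QuadricTower.w₁, ← map_pow, QuadraticAlgebra.omega_sq]
  rfl

theorem QuadricTower.w₂_sq : (QuadraticAlgebra.omega : QuadricTower c y₀ y₁ y₂) ^ 2 =
    QuadricTower.y₃ c y₀ y₁ y₂ ^ 2 - 2 * QuadricTower.ofBase c y₀ y₁ y₂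
      (algebraMap K P (c 2) * y₂) * QuadricTower.y₃ c y₀ y₁ y₂ +
      QuadricTower.ofBase c y₀ y₁ y₂ (y₂ ^ 2) := by
  rw [QuadraticAlgebra.omega_sq, map_conicPoly]
  rfl

/-- In the fourth quadric minus the third the squares of w₂ and of Y cancel; this is the line that
cuts the conic. -/
theorem lastQuadric_eq : lastQuadric c y₀ y₁ y₂ =
    2 * (QuadricTower.w₀ c y₀ y₁ y₂ + QuadricTower.w₁ c y₀ y₁ y₂) * QuadraticAlgebra.omega -
    (2 * QuadricTower.ofBase c y₀ y₁ y₂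
      (algebraMap K P (c 2) * y₂ - algebraMap K P (c 3) * y₀) * QuadricTower.y₃ c y₀ y₁ y₂ +
      (QuadricTower.ofBase c y₀ y₁ y₂ (y₀ ^ 2 - y₂ ^ 2) -
        (QuadricTower.w₀ c y₀ y₁ y₂ + QuadricTower.w₁ c y₀ y₁ y₂) ^ 2)) := by
  have hv : QuadricTower.w₀ c y₀ y₁ y₂ + QuadricTower.w₁ c y₀ y₁ y₂ =
      algebraMap (Polynomial (PairTower c y₀ y₁ y₂)) (QuadricTower c y₀ y₁ y₂)
        (Polynomial.C (sumRoots _ _)) := by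
    simp only [QuadricTower.w₀, QuadricTower.w₁, ← map_add]
    congr 2
    ext
    · simp [sumRoots]
    · simp [sumRoots]
    · simp [sumRoots]; rfl
    · simp [sumRoots]; rfl
  rw [hv, lastQuadric, conicLine, QuadraticAlgebra.eq_add_omega ⟨_, _⟩]
  simp only [QuadricTower.y₃, QuadricTower.ofBase, RingHom.comp_apply]
  simp only [map_neg, map_add, map_mul, map_ofNat, map_sub, map_pow]
  ring

theorem cosineForm_rescale {R : Type*} [CommRing R] {s s' t t' : R} (h : s * s' = 1)
    (h' : t * t' = 1) (c a b : R) : s ^ 2 * (s' * a) ^ 2 + t ^ 2 * (t' * b) ^ 2 -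
      2 * (c * (s * t)) * (s' * a) * (t' * b) = a ^ 2 + b ^ 2 - 2 * c * a * b := by
  linear_combination (s * s' + 1) * a ^ 2 * h + (t * t' + 1) * b ^ 2 * h' -
    2 * c * a * b * (t * t' * h + h')

theorem toTower_scaledQuadric (hσ : ∀ i, σ i ≠ 0) (i : Fin 4) :
    toTower σ c x y₀ y₁ y₂ (scaledQuadric σ c i) = ![0, 0, 0, lastQuadric c y₀ y₁ y₂] i := by
  have hs : ∀ i, QuadricTower.ofBase c y₀ y₁ y₂ (algebraMap K P (σ i)) *
      QuadricTower.ofBase c y₀ y₁ y₂ (algebraMap K P (σ i)⁻¹) = 1 := by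
    intro i
    rw [← map_mul, ← map_mul, mul_inv_cancel₀ (hσ i), map_one, map_one]
  have h0 := hs 0
  have h1 := hs 1
  have h2 := hs 2
  have h3 := hs 3
  have e0 := QuadricTower.w₀_sq c y₀ y₁ y₂
  have e1 := QuadricTower.w₁_sq c y₀ y₁ y₂
  have e2 := QuadricTower.w₂_sq c y₀ y₁ y₂
  simp only [cosineForm, map_sub, map_add, map_mul, map_pow, map_ofNat] at e0 e1 e2
  fin_cases i
  all_goals simp [scaledQuadric, toTower, towerCoords, -map_inv₀]
  · linear_combination e0 - cosineForm_rescale h0 h1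
      (QuadricTower.ofBase c y₀ y₁ y₂ (algebraMap K P (c 0)))
      (QuadricTower.ofBase c y₀ y₁ y₂ y₀) (QuadricTower.ofBase c y₀ y₁ y₂ y₁)
  · linear_combination e1 - cosineForm_rescale h1 h2
      (QuadricTower.ofBase c y₀ y₁ y₂ (algebraMap K P (c 1)))
      (QuadricTower.ofBase c y₀ y₁ y₂ y₁) (QuadricTower.ofBase c y₀ y₁ y₂ y₂)
  · linear_combination e2 - cosineForm_rescale h2 h3
      (QuadricTower.ofBase c y₀ y₁ y₂ (algebraMap K P (c 2)))
      (QuadricTower.ofBase c y₀ y₁ y₂ y₂) (QuadricTower.y₃ c y₀ y₁ y₂)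
  · rw [lastQuadric_eq]
    simp only [map_sub, map_mul, map_pow]
    linear_combination e2 - cosineForm_rescale h3 h0
      (QuadricTower.ofBase c y₀ y₁ y₂ (algebraMap K P (c 3)))
      (QuadricTower.y₃ c y₀ y₁ y₂) (QuadricTower.ofBase c y₀ y₁ y₂ y₀)

set_option maxHeartbeats 1000000 in
/-- An ideal of the coordinate ring that has `QuadricTower` modulo the last quadric as its
quotient. -/
theorem comap_toTower (hσ : ∀ i, σ i ≠ 0) (I : Ideal (MvPolynomial (Fin 8) K))
    (hI : ∀ i, scaledQuadric σ c i ∈ I)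
    (hI' : ∀ f ∈ I, toTower σ c x y₀ y₁ y₂ f ∈ Ideal.span {lastQuadric c y₀ y₁ y₂})
    (ψ : P →+* MvPolynomial (Fin 8) K ⧸ I)
    (hψ : ∀ a, ψ (algebraMap K P a) = Ideal.Quotient.mk I (C a))
    (hψx : ψ x = Ideal.Quotient.mk I (X 3))
    (hψ₀ : ψ y₀ = Ideal.Quotient.mk I (C (σ 0) * X 4))
    (hψ₁ : ψ y₁ = Ideal.Quotient.mk I (C (σ 1) * X 5))
    (hψ₂ : ψ y₂ = Ideal.Quotient.mk I (C (σ 2) * X 6)) :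
    (Ideal.span {lastQuadric c y₀ y₁ y₂}).comap (toTower σ c x y₀ y₁ y₂) = I := by
  have hq : ∀ i, Ideal.Quotient.mk I (scaledQuadric σ c i) = 0 := fun i =>
    Ideal.Quotient.eq_zero_iff_mem.2 (hI i)
  have hq0 := hq 0
  have hq1 := hq 1
  have hq2 := hq 2
  have hq3 := hq 3
  simp [scaledQuadric, map_ofNat] at hq0 hq1 hq2 hq3
  simp only [map_mul] at hψ₀ hψ₁ hψ₂
  -- The map ψ is extended through the tower, one generator at a time, each time by the matching
  -- quadric of `I`. The resulting ψ4 kills the last quadric and composes with `toTower` to the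
  -- quotient map, so nothing outside `I` maps into the ideal of the last quadric.
  let ψ1 := QuadraticAlgebra.liftRingHom (q := cosineForm (algebraMap K P (c 0)) y₀ y₁) ψ
    (Ideal.Quotient.mk I (X 0)) (by
      simp only [map_cosineForm, hψ, hψ₀, hψ₁]
      simp only [cosineForm]
      linear_combination hq0)
  let ψ2 := QuadraticAlgebra.liftRingHom
    (q := algebraMap _ _ (cosineForm (algebraMap K P (c 1)) y₁ y₂)) ψ1
    (Ideal.Quotient.mk I (X 1)) (by
      simp only [ψ1, QuadraticAlgebra.liftRingHom_algebraMap, map_cosineForm, hψ, hψ₂, hψ₁]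
      simp only [cosineForm]
      linear_combination hq1)
  have hψ2 : ∀ p : P, ψ2 (algebraMap P _ p) = ψ p := by
    intro p
    rw [IsScalarTower.algebraMap_apply P
      (QuadraticAlgebra P (cosineForm (algebraMap K P (c 0)) y₀ y₁) 0) (PairTower c y₀ y₁ y₂)]
    simp only [ψ2, ψ1, QuadraticAlgebra.liftRingHom_algebraMap]
  let ψ3 := Polynomial.eval₂RingHom ψ2 (Ideal.Quotient.mk I (C (σ 3) * X 7))
  have hψ3 : ∀ p : P, ψ3 (Polynomial.C (algebraMap P _ p)) = ψ p := by
    intro p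
    simp only [ψ3, Polynomial.coe_eval₂RingHom, Polynomial.eval₂_C, hψ2]
  have hψ3X : ψ3 Polynomial.X = Ideal.Quotient.mk I (C (σ 3) * X 7) := by
    simp only [ψ3, Polynomial.coe_eval₂RingHom, Polynomial.eval₂_X]
  let ψ4 := QuadraticAlgebra.liftRingHom
    (q := conicPoly (algebraMap P _ (algebraMap K P (c 2) * y₂)) (algebraMap P _ (y₂ ^ 2))) ψ3
    (Ideal.Quotient.mk I (X 2)) (by
      rw [map_conicPoly, hψ3X]
      simp only [hψ3, map_mul, map_pow, hψ, hψ₂]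
      linear_combination hq2)
  have hψ4 : ∀ p : P, ψ4 (QuadricTower.ofBase c y₀ y₁ y₂ p) = ψ p := by
    intro p
    simp only [ψ4, QuadricTower.ofBase, RingHom.comp_apply, hψ3,
      QuadraticAlgebra.liftRingHom_algebraMap]
  have hw0 : ψ4 (QuadricTower.w₀ c y₀ y₁ y₂) = Ideal.Quotient.mk I (X 0) := by
    simp only [ψ4, ψ3, ψ2, ψ1, QuadricTower.w₀, QuadraticAlgebra.liftRingHom_algebraMap,
      Polynomial.coe_eval₂RingHom, Polynomial.eval₂_C, QuadraticAlgebra.liftRingHom_omega]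
  have hw1 : ψ4 (QuadricTower.w₁ c y₀ y₁ y₂) = Ideal.Quotient.mk I (X 1) := by
    simp only [ψ4, ψ3, ψ2, ψ1, QuadricTower.w₁, QuadraticAlgebra.liftRingHom_algebraMap,
      Polynomial.coe_eval₂RingHom, Polynomial.eval₂_C, QuadraticAlgebra.liftRingHom_omega]
  have hw2 : ψ4 QuadraticAlgebra.omega = Ideal.Quotient.mk I (X 2) := by
    simp only [ψ4, QuadraticAlgebra.liftRingHom_omega]
  have hy3 : ψ4 (QuadricTower.y₃ c y₀ y₁ y₂) = Ideal.Quotient.mk I (C (σ 3) * X 7) := by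
    simp only [ψ4, QuadricTower.y₃, QuadraticAlgebra.liftRingHom_algebraMap, hψ3X]
  clear_value ψ4
  have hg : ψ4 (lastQuadric c y₀ y₁ y₂) = 0 := by
    rw [lastQuadric_eq]
    simp only [map_sub, map_add, map_mul, map_pow, map_ofNat, hψ4, hw0, hw1, hw2, hy3, hψ, hψ₀,
      hψ₂]
    linear_combination hq3 - hq2
  have hcomp : ψ4.comp (toTower σ c x y₀ y₁ y₂) = Ideal.Quotient.mk I := by
    have hs : ∀ i, ψ (algebraMap K P (σ i)⁻¹) * Ideal.Quotient.mk I (C (σ i)) = 1 := by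
      intro i
      rw [hψ, ← map_mul, ← map_mul, inv_mul_cancel₀ (hσ i), map_one, map_one]
    apply MvPolynomial.ringHom_ext
    · intro a
      simp [toTower, hψ4, hψ]
    · intro i
      have hX : toTower σ c x y₀ y₁ y₂ (X i) = towerCoords σ c x y₀ y₁ y₂ i := by
        simp only [toTower, coe_eval₂Hom, eval₂_X]
      rw [RingHom.comp_apply, hX]
      fin_cases i
      · exact hw0
      · exact hw1
      · exact hw2
      · exact (hψ4 _).trans hψx
      · refine (hψ4 _).trans ?_
        rw [map_mul, hψ₀, ← mul_assoc, hs, one_mul]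
        rfl
      · refine (hψ4 _).trans ?_
        rw [map_mul, hψ₁, ← mul_assoc, hs, one_mul]
        rfl
      · refine (hψ4 _).trans ?_
        rw [map_mul, hψ₂, ← mul_assoc, hs, one_mul]
        rfl
      · refine (map_mul ψ4 _ _).trans ?_
        rw [hψ4, hy3, map_mul, ← mul_assoc, hs, one_mul]
        rfl
  apply le_antisymm
  · intro f hf
    rw [Ideal.mem_comap, Ideal.mem_span_singleton] at hf
    obtain ⟨z, hz⟩ := hf
    rw [← Ideal.Quotient.eq_zero_iff_mem, ← hcomp, RingHom.comp_apply, hz]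
    exact (map_mul ψ4 _ _).trans (by rw [hg, zero_mul])
  · exact hI'

end Scaled

/-! ### Squares among univariate polynomials -/

section Univariate

variable {K : Type*} [Field K]

theorem not_isSquare_quadratic {a b e : K} (h : b ^ 2 - 4 * a * e ≠ 0) :
    ¬ IsSquare (Polynomial.C a * Polynomial.X ^ 2 + Polynomial.C b * Polynomial.X +
      Polynomial.C e) := by
  rintro ⟨S, hS⟩
  have hdeg : S.natDegree ≤ 1 := by
    have h1 : (S * S).natDegree ≤ 2 := by rw [← hS]; exact Polynomial.natDegree_quadratic_le
    rcases eq_or_ne S 0 with rfl | h0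
    · simp
    · rw [Polynomial.natDegree_mul h0 h0] at h1; omega
  obtain ⟨u, v, rfl⟩ := Polynomial.exists_eq_X_add_C_of_natDegree_le_one hdeg
  have hS' : Polynomial.C a * Polynomial.X ^ 2 + Polynomial.C b * Polynomial.X + Polynomial.C e =
      Polynomial.C (u ^ 2) * Polynomial.X ^ 2 + Polynomial.C (2 * u * v) * Polynomial.X +
      Polynomial.C (v ^ 2) := by
    rw [hS]; simp only [map_mul, map_pow, map_ofNat]; ring
  have e2 := congrArg (fun p => Polynomial.coeff p 2) hS'
  have e1 := congrArg (fun p => Polynomial.coeff p 1) hS'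
  have e0 := congrArg (fun p => Polynomial.coeff p 0) hS'
  simp [Polynomial.coeff_X, Polynomial.coeff_C, -map_pow, -map_mul] at e0 e1 e2
  apply h
  rw [e0, e1, e2]; ring

/-- A square vanishes together with its derivative; at a root of `g` the product rule leaves g′h. -/
theorem eval_derivative_mul_eval_eq_zero {g h : Polynomial K} (hgh : IsSquare (g * h)) {ρ : K}
    (hρ : g.eval ρ = 0) : g.derivative.eval ρ * h.eval ρ = 0 := by
  obtain ⟨S, hS⟩ := hgh
  have hS0 : S.eval ρ = 0 := by
    have := congrArg (Polynomial.eval ρ) hS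
    simpa [hρ] using this
  have := congrArg (fun p => (Polynomial.derivative p).eval ρ) hS
  simpa [Polynomial.derivative_mul, hρ, hS0] using this

theorem isSquare_of_X_pow_mul {f : Polynomial K} (h : IsSquare (Polynomial.X ^ 2 * f)) :
    IsSquare f := by
  obtain ⟨S, hS⟩ := h
  have : Polynomial.X ∣ S := by
    have h1 : Polynomial.X ∣ S * S := ⟨Polynomial.X * f, by rw [← hS]; ring⟩
    exact (Polynomial.prime_X.dvd_or_dvd h1).elim id id
  obtain ⟨T, rfl⟩ := this
  refine ⟨T, mul_left_cancel₀ (pow_ne_zero 2 Polynomial.X_ne_zero) (hS.trans (by ring))⟩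

/-- Two quadratic polynomials with the same leading coefficient whose product is a square are
equal if one of them is separable. -/
theorem eq_of_isSquare_mul_quadratic [IsAlgClosed K] (h2 : (2 : K) ≠ 0) {l m n m' n' : K}
    (hl : l ≠ 0)
    (hdisc : m ^ 2 - 4 * l * n ≠ 0)
    (hsq : IsSquare ((Polynomial.C l * Polynomial.X ^ 2 + Polynomial.C m * Polynomial.X +
      Polynomial.C n) * (Polynomial.C l * Polynomial.X ^ 2 + Polynomial.C m' * Polynomial.X +
      Polynomial.C n'))) : m = m' ∧ n = n' := by
  obtain ⟨δ, hδ⟩ := IsAlgClosed.exists_pow_nat_eq (m ^ 2 - 4 * l * n) (n := 2) (by norm_num)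
  have hδ0 : δ ≠ 0 := by rintro rfl; apply hdisc; rw [← hδ]; simp
  -- Each root ρ of the first quadratic is simple, so it must be a root of the second too. Two
  -- quadratics with the same leading coefficient and two distinct common roots agree.
  have key : ∀ ρ, l * ρ ^ 2 + m * ρ + n = 0 → l * ρ ^ 2 + m' * ρ + n' = 0 := by
    intro ρ hρ
    have := eval_derivative_mul_eval_eq_zero hsq (ρ := ρ) (by simpa using hρ)
    simp only [Polynomial.derivative_add, Polynomial.derivative_mul, Polynomial.derivative_C,
      Polynomial.derivative_X_pow, Polynomial.derivative_X, Polynomial.eval_add,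
      Polynomial.eval_mul, Polynomial.eval_C, Polynomial.eval_X, Polynomial.eval_pow] at this
    simp at this
    refine this.resolve_left ?_
    intro h
    apply hdisc
    linear_combination -4 * l * hρ + (2 * l * ρ + m) * h
  have h1 := key ((-m + δ) / (2 * l)) (by field_simp; linear_combination hδ)
  have h3 := key ((-m - δ) / (2 * l)) (by field_simp; linear_combination hδ)
  have e1 : l * ((-m + δ) / (2 * l)) ^ 2 + m * ((-m + δ) / (2 * l)) + n = 0 := by
    field_simp; linear_combination hδ
  have e3 : l * ((-m - δ) / (2 * l)) ^ 2 + m * ((-m - δ) / (2 * l)) + n = 0 := by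
    field_simp; linear_combination hδ
  have hm : (m - m') * (δ / l) = 0 := by
    have : δ / l = (-m + δ) / (2 * l) - (-m - δ) / (2 * l) := by field_simp; ring
    rw [this]
    linear_combination e1 - e3 - h1 + h3
  have hm' : m = m' := by
    have := (mul_eq_zero.1 hm).resolve_right (div_ne_zero hδ0 hl)
    exact sub_eq_zero.1 this
  subst hm'
  exact ⟨rfl, by linear_combination e1 - h1⟩

/-- The polynomial of degree at most `8` with given coefficients. -/
noncomputable def octic (f : Fin 9 → K) : Polynomial K :=
  ∑ i : Fin 9, Polynomial.C (f i) * Polynomial.X ^ (i : ℕ)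

theorem octic_injective : Function.Injective (octic (K := K)) := by
  intro f g h
  funext i
  have := congrArg (fun p => Polynomial.coeff p i) h
  simpa [octic, Polynomial.finsetSum_coeff, Polynomial.coeff_X_pow, Fin.val_inj] using this

/-- In a family of polynomials of degree `8` with constant leading coefficient, the squares form a
closed subset. -/
theorem finite_isSquare_octic (h2 : (2 : K) ≠ 0) (f : Fin 9 → Polynomial K) {l : K} (hl : l ≠ 0)
    (hf : f 8 = Polynomial.C (l ^ 2)) (h0 : ¬ IsSquare (octic fun i => (f i).eval 0)) :
    {k : K | IsSquare (octic fun i => (f i).eval k)}.Finite := by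
  have hl2 : 2 * l ≠ 0 := mul_ne_zero h2 hl
  -- A square root with leading coefficient `l` is determined by the coefficients of degree 7, 6, 5,
  -- 4, which give `g3`, `g2`, `g1`, `g0` in turn as polynomials in k. The remaining coefficients of
  -- degree 0 to 3 must then match, which means that `r` vanishes at k.
  let i : Polynomial K := Polynomial.C (2 * l)⁻¹
  let g3 := i * f 7
  let g2 := i * (f 6 - g3 ^ 2)
  let g1 := i * (f 5 - 2 * g3 * g2)
  let g0 := i * (f 4 - 2 * g3 * g1 - g2 ^ 2)
  let r : Fin 4 → Polynomial K := ![f 0 - g0 ^ 2, f 1 - 2 * g1 * g0, f 2 - 2 * g2 * g0 - g1 ^ 2,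
    f 3 - 2 * g3 * g0 - 2 * g2 * g1]
  have sq : ∀ s4 s3 s2 s1 s0 : K, (Polynomial.C s4 * Polynomial.X ^ 4 +
      Polynomial.C s3 * Polynomial.X ^ 3 + Polynomial.C s2 * Polynomial.X ^ 2 +
      Polynomial.C s1 * Polynomial.X + Polynomial.C s0) * (Polynomial.C s4 * Polynomial.X ^ 4 +
      Polynomial.C s3 * Polynomial.X ^ 3 + Polynomial.C s2 * Polynomial.X ^ 2 +
      Polynomial.C s1 * Polynomial.X + Polynomial.C s0) = octic ![s0 ^ 2, 2 * s1 * s0,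
        2 * s2 * s0 + s1 ^ 2, 2 * s3 * s0 + 2 * s2 * s1, 2 * s4 * s0 + 2 * s3 * s1 + s2 ^ 2,
        2 * s4 * s1 + 2 * s3 * s2, 2 * s4 * s2 + s3 ^ 2, 2 * s4 * s3, s4 ^ 2] := by
    intro s4 s3 s2 s1 s0
    simp [octic, Fin.sum_univ_succ, map_ofNat]
    ring
  have hsub : ∀ k, IsSquare (octic fun i => (f i).eval k) → ∀ j, (r j).eval k = 0 := by
    rintro k ⟨S, hS⟩
    have hdeg : ∀ S : Polynomial K, (octic fun i => (f i).eval k) = S * S → S.natDegree < 5 := by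
      intro S hS
      have h1 : (S * S).natDegree ≤ 8 := by
        rw [← hS]
        refine Polynomial.natDegree_sum_le_of_forall_le _ _ ?_
        intro i _
        exact (Polynomial.natDegree_C_mul_X_pow_le _ _).trans (by omega)
      rcases eq_or_ne S 0 with rfl | h0
      · simp
      · rw [Polynomial.natDegree_mul h0 h0] at h1; omega
    have hexp : ∀ S : Polynomial K, S.natDegree < 5 → S = Polynomial.C (S.coeff 4) *
        Polynomial.X ^ 4 +
        Polynomial.C (S.coeff 3) * Polynomial.X ^ 3 + Polynomial.C (S.coeff 2) * Polynomial.X ^ 2 +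
        Polynomial.C (S.coeff 1) * Polynomial.X + Polynomial.C (S.coeff 0) := by
      intro S hS
      have hS5 := S.as_sum_range' 5 hS
      simp only [Finset.sum_range_succ, Finset.sum_range_zero,
        ← Polynomial.C_mul_X_pow_eq_monomial] at hS5
      conv_lhs => rw [hS5]
      ring
    have h8 : S.coeff 4 ^ 2 = l ^ 2 := by
      have h := hS
      rw [hexp S (hdeg S hS), sq] at h
      have := congrFun (octic_injective h) 8
      simp only [hf, Polynomial.eval_C] at this
      exact this.symm
    obtain ⟨T, hT, hT4⟩ : ∃ T : Polynomial K, (octic fun i => (f i).eval k) = T * T ∧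
        T.coeff 4 = l := by
      rcases sq_eq_sq_iff_eq_or_eq_neg.1 h8 with h | h
      · exact ⟨S, hS, h⟩
      · exact ⟨-S, by rw [hS]; ring, by rw [Polynomial.coeff_neg, h, neg_neg]⟩
    have hss := hT
    rw [hexp T (hdeg T hT), sq] at hss
    generalize T.coeff 4 = s4 at hss hT4
    generalize T.coeff 3 = s3 at hss
    generalize T.coeff 2 = s2 at hss
    generalize T.coeff 1 = s1 at hss
    generalize T.coeff 0 = s0 at hss
    have hcoef := octic_injective hss
    have c0 : (f 0).eval k = s0 ^ 2 := congrFun hcoef 0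
    have c1 : (f 1).eval k = 2 * s1 * s0 := congrFun hcoef 1
    have c2 : (f 2).eval k = 2 * s2 * s0 + s1 ^ 2 := congrFun hcoef 2
    have c3 : (f 3).eval k = 2 * s3 * s0 + 2 * s2 * s1 := congrFun hcoef 3
    have c4 : (f 4).eval k = 2 * s4 * s0 + 2 * s3 * s1 + s2 ^ 2 := congrFun hcoef 4
    have c5 : (f 5).eval k = 2 * s4 * s1 + 2 * s3 * s2 := congrFun hcoef 5
    have c6 : (f 6).eval k = 2 * s4 * s2 + s3 ^ 2 := congrFun hcoef 6
    have c7 : (f 7).eval k = 2 * s4 * s3 := congrFun hcoef 7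
    subst hT4
    have hi : i.eval k = (2 * s4)⁻¹ := by simp only [i, Polynomial.eval_C]
    have G3 : g3.eval k = s3 := by
      simp only [g3, Polynomial.eval_mul, hi, c7]; field_simp
    have G2 : g2.eval k = s2 := by
      simp only [g2, Polynomial.eval_mul, Polynomial.eval_sub, Polynomial.eval_pow, hi, c6, G3]
      field_simp; ring
    have G1 : g1.eval k = s1 := by
      simp only [g1, Polynomial.eval_mul, Polynomial.eval_sub, hi, c5, G3, G2,
        Polynomial.eval_ofNat]
      field_simp; ring
    have G0 : g0.eval k = s0 := by
      simp only [g0, Polynomial.eval_mul, Polynomial.eval_sub, Polynomial.eval_pow, hi, c4, G3, G2,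
        G1, Polynomial.eval_ofNat]
      field_simp; ring
    intro j
    fin_cases j
    · simp [r, c0, G0]
    · simp [r, c1, G0, G1]
    · simp [r, c2, G0, G1, G2]
    · simp [r, c3, G0, G1, G2, G3]
  -- Either some `r j` is a nonzero polynomial, with finitely many roots k, or all vanish
  -- identically and the octic at k = 0 is a square after all.
  by_cases hr : ∃ j, r j ≠ 0
  · obtain ⟨j, hj⟩ := hr
    refine (Polynomial.finite_setOfPred_isRoot hj).subset ?_
    intro k hk
    exact hsub k hk j
  · exfalso
    push Not at hr
    apply h0
    refine ⟨_, Eq.trans ?_ (sq l (g3.eval 0) (g2.eval 0) (g1.eval 0) (g0.eval 0)).symm⟩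
    congr 1
    have hi : i.eval 0 = (2 * l)⁻¹ := by simp only [i, Polynomial.eval_C]
    have G3 : g3.eval 0 = (2 * l)⁻¹ * (f 7).eval 0 := by simp [g3, hi]
    have G2 : g2.eval 0 = (2 * l)⁻¹ * ((f 6).eval 0 - (g3.eval 0) ^ 2) := by simp [g2, hi]
    have G1 : g1.eval 0 = (2 * l)⁻¹ * ((f 5).eval 0 - 2 * (g3.eval 0) * (g2.eval 0)) := by
      simp [g1, hi]
    have G0 : g0.eval 0 = (2 * l)⁻¹ * ((f 4).eval 0 - 2 * (g3.eval 0) * (g1.eval 0) -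
      (g2.eval 0) ^ 2) := by simp [g0, hi]
    have r0 := congrArg (Polynomial.eval 0) (hr 0)
    have r1 := congrArg (Polynomial.eval 0) (hr 1)
    have r2 := congrArg (Polynomial.eval 0) (hr 2)
    have r3 := congrArg (Polynomial.eval 0) (hr 3)
    simp [r] at r0 r1 r2 r3
    clear_value g0 g1 g2 g3
    funext j
    fin_cases j
    · simp; linear_combination r0
    · simp; linear_combination r1
    · simp; linear_combination r2
    · simp; linear_combination r3
    · simp; rw [G0]; field_simp; ring
    · simp; rw [G1]; field_simp; ring
    · simp; rw [G2]; field_simp; ring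
    · simp; rw [G3]; field_simp
    · simp [hf]

end Univariate

/-! ### The exceptional hyperplanes -/

section Exceptional

variable {K : Type*} [Field K]

/-- Generic cosines `c` and slope `t`. -/
structure IsGenericCosines (c : Fin 4 → K) (ς t : K) : Prop where
  two_ne_zero : (2 : K) ≠ 0
  sq_ne_one : ∀ i, c i ^ 2 ≠ 1
  c_two_ne_zero : c 2 ≠ 0
  sq_ne_sq : c 0 ^ 2 ≠ c 1 ^ 2
  t_ne_zero : t ≠ 0
  form_ne_zero : t ^ 2 - 2 * c 1 * t + 1 ≠ 0
  mul_ne_one : c 1 * t ≠ 1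
  sines : ς ^ 2 = (1 - c 2 ^ 2) * (1 - c 3 ^ 2)
  angles : c 0 * c 1 = c 2 * c 3 → c 0 ^ 2 + c 1 ^ 2 ≠ c 2 ^ 2 + c 3 ^ 2

/-- The hyperplane `y₂ = t y₁ + k y₀` is in general position. -/
structure IsGenericHyperplane (c : Fin 4 → K) (ς t k : K) : Prop where
  not_isSquare_left : ¬ IsSquare (cosineForm (Polynomial.C (c 0)) 1 Polynomial.X)
  not_isSquare_right : ¬ IsSquare (cosineForm (Polynomial.C (c 1)) Polynomial.X
    (Polynomial.C t * Polynomial.X + Polynomial.C k))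
  not_isSquare_mul : ¬ IsSquare (cosineForm (Polynomial.C (c 0)) 1 Polynomial.X *
    cosineForm (Polynomial.C (c 1)) Polynomial.X
      (Polynomial.C t * Polynomial.X + Polynomial.C k))
  not_isSquare_heron : ¬ IsSquare (
    heron (cosineForm (Polynomial.C (c 0)) 1 Polynomial.X)
      (cosineForm (Polynomial.C (c 1)) Polynomial.X
        (Polynomial.C t * Polynomial.X + Polynomial.C k))
      1 (Polynomial.C t * Polynomial.X + Polynomial.C k) (Polynomial.C (c 2 * c 3 - ς)) *
    heron (cosineForm (Polynomial.C (c 0)) 1 Polynomial.X)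
      (cosineForm (Polynomial.C (c 1)) Polynomial.X
        (Polynomial.C t * Polynomial.X + Polynomial.C k))
      1 (Polynomial.C t * Polynomial.X + Polynomial.C k) (Polynomial.C (c 2 * c 3 + ς)))
  sub_ne_zero : ∀ r, c 2 * r - c 3 = 0 →
    cosineForm (c 0) 1 ((r - k) / t) - cosineForm (c 1) ((r - k) / t) r ≠ 0
  norm_ne_zero : ∀ r, (1 - r ^ 2 - (c 2 * r - c 3) ^ 2) ^ 2 - 4 * (c 2 * r - c 3) ^ 2 * r ^ 2 = 0 →
    ((c 2 * r - c 3) ^ 2 - cosineForm (c 0) 1 ((r - k) / t) -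
      cosineForm (c 1) ((r - k) / t) r) ^ 2 -
    4 * (cosineForm (c 0) 1 ((r - k) / t) * cosineForm (c 1) ((r - k) / t) r) ≠ 0

variable {c : Fin 4 → K} {ς t : K}

theorem IsGenericCosines.ς_ne_zero (h : IsGenericCosines c ς t) : ς ≠ 0 := by
  intro h0
  have := h.sines
  rw [h0] at this
  have h1 : (1 - c 2 ^ 2) * (1 - c 3 ^ 2) = 0 := by rw [← this]; simp
  rcases mul_eq_zero.1 h1 with h2 | h2
  · exact h.sq_ne_one 2 (sub_eq_zero.1 h2).symm
  · exact h.sq_ne_one 3 (sub_eq_zero.1 h2).symm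

/-- The coefficients of a quarter of the norm of `√p + √q + √r` on the line
`y₂ = t y₁ + k y₀`. -/
def heronCoeff {R : Type*} [CommRing R] (c₀ c₁ d t k : R) : Fin 5 → R :=
  ![-((1 - d ^ 2) * k ^ 2),
    -2 * (1 - d ^ 2) * t * k + 2 * (c₁ - d * c₀) * k + 2 * (c₀ - d * c₁) * k ^ 2,
    -((1 - d ^ 2) * t ^ 2) - (1 - c₀ ^ 2) - (1 - c₁ ^ 2) * k ^ 2 + 2 * (d - c₀ * c₁) * k +
      2 * (c₁ - d * c₀) * t + 4 * (c₀ - d * c₁) * t * k,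
    -2 * (1 - c₁ ^ 2) * t * k + 2 * (d - c₀ * c₁) * t + 2 * (c₀ - d * c₁) * t ^ 2,
    -((1 - c₁ ^ 2) * t ^ 2)]

theorem heron_eq {R : Type*} [CommRing R] (c₀ c₁ d t k x : R) :
    heron (cosineForm c₀ 1 x) (cosineForm c₁ x (t * x + k)) 1 (t * x + k) d =
      4 * ∑ i : Fin 5, heronCoeff c₀ c₁ d t k i * x ^ (i : ℕ) := by
  simp [heron, cosineForm, heronCoeff, Fin.sum_univ_succ]
  ring

/-- The coefficients of the product of two quartics. -/
def convolution {R : Type*} [CommRing R] (a b : Fin 5 → R) : Fin 9 → R :=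
  ![a 0 * b 0, a 0 * b 1 + a 1 * b 0, a 0 * b 2 + a 1 * b 1 + a 2 * b 0,
    a 0 * b 3 + a 1 * b 2 + a 2 * b 1 + a 3 * b 0,
    a 0 * b 4 + a 1 * b 3 + a 2 * b 2 + a 3 * b 1 + a 4 * b 0,
    a 1 * b 4 + a 2 * b 3 + a 3 * b 2 + a 4 * b 1,
    a 2 * b 4 + a 3 * b 3 + a 4 * b 2, a 3 * b 4 + a 4 * b 3, a 4 * b 4]

theorem octic_convolution (a b : Fin 5 → K) : octic (convolution a b) =
    (∑ i : Fin 5, Polynomial.C (a i) * Polynomial.X ^ (i : ℕ)) *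
    ∑ i : Fin 5, Polynomial.C (b i) * Polynomial.X ^ (i : ℕ) := by
  simp [octic, convolution, Fin.sum_univ_succ]
  ring

theorem map_convolution {R S : Type*} [CommRing R] [CommRing S] (f : R →+* S) (a b : Fin 5 → R)
    (i : Fin 9) : f (convolution a b i) = convolution (fun i => f (a i)) (fun i => f (b i)) i := by
  fin_cases i <;> simp [convolution]

theorem map_heronCoeff {R S : Type*} [CommRing R] [CommRing S] (f : R →+* S) (c₀ c₁ d t k : R)
    (i : Fin 5) :
    f (heronCoeff c₀ c₁ d t k i) = heronCoeff (f c₀) (f c₁) (f d) (f t) (f k) i := by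
  fin_cases i <;> simp [heronCoeff, map_ofNat]

/-- At k = 0 each quartic is X² times a quadratic Q d, where d = c₂c₃ ∓ ς. The two quadratics share
the leading coefficient, and their middle coefficients differ by 4ςt(1 - c₁t) ≠ 0. The discriminant
of Q d is -4t²(t² - 2c₁t + 1) times the Gram determinant G d of the cosines c₀, c₁, d. If both Gram
determinants vanished, subtracting them would give c₀c₁ = c₂c₃, and then c₀² + c₁² = c₂² + c₃²,
against `angles`. So one quadratic is separable, and the product cannot be a square. -/
theorem IsGenericCosines.not_isSquare_octic [IsAlgClosed K] (h : IsGenericCosines c ς t) :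
    ¬ IsSquare (octic (convolution (heronCoeff (c 0) (c 1) (c 2 * c 3 - ς) t 0)
      (heronCoeff (c 0) (c 1) (c 2 * c 3 + ς) t 0))) := by
  intro hsq
  have hs1 : 1 - c 1 ^ 2 ≠ 0 := fun h1 => h.sq_ne_one 1 (sub_eq_zero.1 h1).symm
  have hl : -((1 - c 1 ^ 2) * t ^ 2) ≠ 0 :=
    neg_ne_zero.2 (mul_ne_zero hs1 (pow_ne_zero 2 h.t_ne_zero))
  let m : K → K := fun d => 2 * (d - c 0 * c 1) * t + 2 * (c 0 - d * c 1) * t ^ 2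
  let n : K → K := fun d => -((1 - d ^ 2) * t ^ 2) - (1 - c 0 ^ 2) + 2 * (c 1 - d * c 0) * t
  let Q : K → Polynomial K := fun d => Polynomial.C (-((1 - c 1 ^ 2) * t ^ 2)) * Polynomial.X ^ 2 +
    Polynomial.C (m d) * Polynomial.X + Polynomial.C (n d)
  have hQ : ∀ d, (∑ i : Fin 5, Polynomial.C (heronCoeff (c 0) (c 1) d t 0 i) *
      Polynomial.X ^ (i : ℕ)) = Polynomial.X ^ 2 * Q d := by
    intro d
    simp [heronCoeff, Fin.sum_univ_succ, Q, m, n]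
    ring
  rw [octic_convolution, hQ, hQ, mul_assoc] at hsq
  have hsq := isSquare_of_X_pow_mul hsq
  rw [mul_left_comm] at hsq
  have hsq := isSquare_of_X_pow_mul hsq
  have hmne : m (c 2 * c 3 - ς) ≠ m (c 2 * c 3 + ς) := by
    intro hm
    have : 4 * ς * t * (1 - c 1 * t) = 0 := by
      simp only [m] at hm
      linear_combination -hm
    have h4 : (4 : K) ≠ 0 := by
      have : (4 : K) = 2 * 2 := by norm_num
      rw [this]; exact mul_ne_zero h.two_ne_zero h.two_ne_zero
    refine mul_ne_zero (mul_ne_zero (mul_ne_zero h4 h.ς_ne_zero) h.t_ne_zero) ?_ this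
    intro h1
    exact h.mul_ne_one (sub_eq_zero.1 h1).symm
  let G : K → K := fun d => 1 + 2 * c 0 * c 1 * d - c 0 ^ 2 - c 1 ^ 2 - d ^ 2
  have hdisc : ∀ d, m d ^ 2 - 4 * (-((1 - c 1 ^ 2) * t ^ 2)) * n d =
      -(2 * t) ^ 2 * (G d * (t ^ 2 - 2 * c 1 * t + 1)) := by
    intro d
    simp only [m, n, G]
    ring
  have hG : ∀ d, G d ≠ 0 → m d ^ 2 - 4 * (-((1 - c 1 ^ 2) * t ^ 2)) * n d ≠ 0 := by
    intro d hd
    rw [hdisc]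
    exact mul_ne_zero (neg_ne_zero.2 (pow_ne_zero 2 (mul_ne_zero h.two_ne_zero h.t_ne_zero)))
      (mul_ne_zero hd h.form_ne_zero)
  by_cases h1 : G (c 2 * c 3 - ς) = 0
  · by_cases h2 : G (c 2 * c 3 + ς) = 0
    · simp only [G] at h1 h2
      have e1 : 4 * ς * (c 0 * c 1 - c 2 * c 3) = 0 := by linear_combination h2 - h1
      have h4 : (4 : K) ≠ 0 := by
        have : (4 : K) = 2 * 2 := by norm_num
        rw [this]; exact mul_ne_zero h.two_ne_zero h.two_ne_zero
      have e2 : c 0 * c 1 = c 2 * c 3 := by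
        have := (mul_eq_zero.1 e1).resolve_left (mul_ne_zero h4 h.ς_ne_zero)
        exact sub_eq_zero.1 this
      apply h.angles e2
      linear_combination -h1 - h.sines + 2 * (c 2 * c 3 - ς) * e2
    · exact hmne (eq_of_isSquare_mul_quadratic h.two_ne_zero hl (hG _ h2)
        (by rw [mul_comm] at hsq; exact hsq)).1.symm
  · exact hmne (eq_of_isSquare_mul_quadratic h.two_ne_zero hl (hG _ h1) hsq).1

/-- The coefficients are polynomials in k and the leading one, ((1 - c₁²)t²)², is constant, so the
degenerate value k = 0 decides for almost all k. The factor 4 in each `heron` is a unit and does not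
matter. -/
theorem IsGenericCosines.finite_isSquare_heron [IsAlgClosed K] (h : IsGenericCosines c ς t) :
    {k : K | IsSquare (heron (cosineForm (Polynomial.C (c 0)) 1 Polynomial.X)
      (cosineForm (Polynomial.C (c 1)) Polynomial.X
        (Polynomial.C t * Polynomial.X + Polynomial.C k))
      1 (Polynomial.C t * Polynomial.X + Polynomial.C k) (Polynomial.C (c 2 * c 3 - ς)) *
    heron (cosineForm (Polynomial.C (c 0)) 1 Polynomial.X)
      (cosineForm (Polynomial.C (c 1)) Polynomial.X
        (Polynomial.C t * Polynomial.X + Polynomial.C k))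
      1 (Polynomial.C t * Polynomial.X + Polynomial.C k)
        (Polynomial.C (c 2 * c 3 + ς)))}.Finite := by
  have hs1 : 1 - c 1 ^ 2 ≠ 0 := fun h1 => h.sq_ne_one 1 (sub_eq_zero.1 h1).symm
  have key : ∀ k, (octic fun i => (convolution (heronCoeff (Polynomial.C (c 0))
      (Polynomial.C (c 1)) (Polynomial.C (c 2 * c 3 - ς)) (Polynomial.C t) Polynomial.X)
      (heronCoeff (Polynomial.C (c 0)) (Polynomial.C (c 1)) (Polynomial.C (c 2 * c 3 + ς))
        (Polynomial.C t) Polynomial.X) i).eval k) = octic (convolution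
        (heronCoeff (c 0) (c 1) (c 2 * c 3 - ς) t k)
        (heronCoeff (c 0) (c 1) (c 2 * c 3 + ς) t k)) := by
    intro k
    congr 1
    funext i
    rw [← Polynomial.coe_evalRingHom, map_convolution]
    congr 1 <;> funext j <;> rw [map_heronCoeff] <;> simp
  have hfin := finite_isSquare_octic h.two_ne_zero (l := (1 - c 1 ^ 2) * t ^ 2) (convolution
      (heronCoeff (Polynomial.C (c 0))
      (Polynomial.C (c 1)) (Polynomial.C (c 2 * c 3 - ς)) (Polynomial.C t) Polynomial.X)
      (heronCoeff (Polynomial.C (c 0)) (Polynomial.C (c 1)) (Polynomial.C (c 2 * c 3 + ς))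
        (Polynomial.C t) Polynomial.X)) (mul_ne_zero hs1 (pow_ne_zero 2 h.t_ne_zero))
      (by simp [convolution, heronCoeff]; ring) (by
        rw [key]; exact h.not_isSquare_octic)
  refine hfin.subset ?_
  intro k hk
  rw [Set.mem_ofPred_eq, key, octic_convolution]
  rw [Set.mem_ofPred_eq, heron_eq, heron_eq] at hk
  have h4 : IsUnit (4 : Polynomial K) := by
    have : (4 : Polynomial K) = Polynomial.C (2 * 2) := by simp [map_ofNat]; norm_num
    rw [this, Polynomial.isUnit_C]
    exact (mul_ne_zero h.two_ne_zero h.two_ne_zero).isUnit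
  obtain ⟨u, hu⟩ := h4.exists_left_inv
  obtain ⟨S, hS⟩ := hk
  simp only [← map_heronCoeff] at hS
  refine ⟨u * S, ?_⟩
  linear_combination u ^ 2 * hS - ((∑ i : Fin 5,
    Polynomial.C (heronCoeff (c 0) (c 1) (c 2 * c 3 - ς) t k i) * Polynomial.X ^ (i : ℕ)) *
    ∑ i : Fin 5, Polynomial.C (heronCoeff (c 0) (c 1) (c 2 * c 3 + ς) t k i) *
      Polynomial.X ^ (i : ℕ)) * (1 + u * 4) * hu

end Exceptional

/-! ### Finiteness of the set of exceptional parameters k. -/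

section Exceptional

variable {K : Type*} [Field K] {c : Fin 4 → K} {ς t : K}

theorem finite_quadratic_eq_zero {a b e : K} (h : ¬ (a = 0 ∧ b = 0 ∧ e = 0)) :
    {x : K | a * x ^ 2 + b * x + e = 0}.Finite := by
  have hp : Polynomial.C a * Polynomial.X ^ 2 + Polynomial.C b * Polynomial.X +
      Polynomial.C e ≠ 0 := by
    intro h0
    apply h
    refine ⟨?_, ?_, ?_⟩
    · simpa [Polynomial.coeff_X, Polynomial.coeff_C] using congrArg (fun p => Polynomial.coeff p 2) h0
    · simpa [Polynomial.coeff_X, Polynomial.coeff_C] using congrArg (fun p => Polynomial.coeff p 1) h0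
    · simpa [Polynomial.coeff_X, Polynomial.coeff_C] using congrArg (fun p => Polynomial.coeff p 0) h0
  refine (Polynomial.finite_setOfPred_isRoot hp).subset ?_
  intro x hx
  simpa [Polynomial.IsRoot] using hx

theorem not_isSquare_cosineForm_left (h2 : (2 : K) ≠ 0) {a : K} (ha : a ^ 2 ≠ 1) :
    ¬ IsSquare (cosineForm (Polynomial.C a) 1 Polynomial.X) := by
  have h := not_isSquare_quadratic (a := 1) (b := -2 * a) (e := (1 : K)) (by
    have : (-2 * a) ^ 2 - 4 * 1 * 1 = 2 * 2 * (a ^ 2 - 1) := by ring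
    rw [this]
    exact mul_ne_zero (mul_ne_zero h2 h2) (sub_ne_zero.2 ha))
  convert h using 2
  simp [cosineForm, map_ofNat]
  ring

theorem cosineForm_line (a t k : K) : cosineForm (Polynomial.C a) Polynomial.X
    (Polynomial.C t * Polynomial.X + Polynomial.C k) =
    Polynomial.C (t ^ 2 - 2 * a * t + 1) * Polynomial.X ^ 2 +
      Polynomial.C (2 * (t - a) * k) * Polynomial.X + Polynomial.C (k ^ 2) := by
  simp [cosineForm, map_ofNat]
  ring

theorem not_isSquare_cosineForm_right (h2 : (2 : K) ≠ 0) {a t k : K} (ha : a ^ 2 ≠ 1)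
    (hk : k ≠ 0) : ¬ IsSquare (cosineForm (Polynomial.C a) Polynomial.X
    (Polynomial.C t * Polynomial.X + Polynomial.C k)) := by
  rw [cosineForm_line]
  apply not_isSquare_quadratic
  have : (2 * (t - a) * k) ^ 2 - 4 * (t ^ 2 - 2 * a * t + 1) * k ^ 2 =
    (2 * k) ^ 2 * (a ^ 2 - 1) := by ring
  rw [this]
  exact mul_ne_zero (pow_ne_zero 2 (mul_ne_zero h2 hk)) (sub_ne_zero.2 ha)

/-- The first form has the simple root c₀ + δ. If the product is a square, the second form vanishes
there too, which is a monic quadratic equation for k. -/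
theorem IsGenericCosines.finite_isSquare_mul [IsAlgClosed K] (h : IsGenericCosines c ς t) :
    {k : K | IsSquare (cosineForm (Polynomial.C (c 0)) 1 Polynomial.X *
      cosineForm (Polynomial.C (c 1)) Polynomial.X
      (Polynomial.C t * Polynomial.X + Polynomial.C k))}.Finite := by
  obtain ⟨δ, hδ⟩ := IsAlgClosed.exists_pow_nat_eq (c 0 ^ 2 - 1) (n := 2) (by norm_num)
  have hδ0 : δ ≠ 0 := by
    rintro rfl
    exact sub_ne_zero.2 (h.sq_ne_one 0) (by rw [← hδ]; simp)
  refine (finite_quadratic_eq_zero (a := 1) (b := 2 * (t - c 1) * (c 0 + δ))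
    (e := (t ^ 2 - 2 * c 1 * t + 1) * (c 0 + δ) ^ 2) (by simp)).subset ?_
  intro k hk
  have := eval_derivative_mul_eval_eq_zero hk (ρ := c 0 + δ) (by
    simp [cosineForm]
    linear_combination hδ)
  rw [cosineForm_line] at this
  have hd : (Polynomial.derivative (cosineForm (Polynomial.C (c 0)) 1 Polynomial.X)).eval
      (c 0 + δ) = 2 * δ := by
    simp [cosineForm]
    ring
  rw [hd] at this
  have := (mul_eq_zero.1 this).resolve_left (mul_ne_zero h.two_ne_zero hδ0)
  simp at this
  rw [Set.mem_ofPred_eq]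
  linear_combination this

theorem finite_of_line {S : Set K} (hS : S.Finite) (r : K) (ht : t ≠ 0) :
    {k : K | (r - k) / t ∈ S}.Finite := by
  refine hS.preimage (f := fun k => (r - k) / t) ?_
  intro a _ b _ hab
  have := (div_left_inj' ht).1 hab
  linear_combination -this

/-- The line y₂ = ty₁ + k passes through y₂ = r at y₁ = (r - k)/t. For fixed r = c₃/c₂ the
difference of the two forms is linear in y₁; if it vanished identically, then c₀ = c₁r and r² = 1,
so c₀² = c₁². -/
theorem IsGenericCosines.finite_sub (h : IsGenericCosines c ς t) :
    {k : K | ∃ r, c 2 * r - c 3 = 0 ∧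
      cosineForm (c 0) 1 ((r - k) / t) - cosineForm (c 1) ((r - k) / t) r = 0}.Finite := by
  have hfin : {x : K | 0 * x ^ 2 + 2 * (c 1 * (c 3 / c 2) - c 0) * x +
      (1 - (c 3 / c 2) ^ 2) = 0}.Finite := by
    apply finite_quadratic_eq_zero
    rintro ⟨-, h1, h3⟩
    have h1' : c 1 * (c 3 / c 2) = c 0 := by
      exact sub_eq_zero.1 ((mul_eq_zero.1 h1).resolve_left h.two_ne_zero)
    apply h.sq_ne_sq
    rw [← h1']
    linear_combination -(c 1) ^ 2 * h3
  refine (finite_of_line hfin (c 3 / c 2) h.t_ne_zero).subset ?_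
  rintro k ⟨r, hr, hk⟩
  have hr' : r = c 3 / c 2 := by
    rw [eq_div_iff h.c_two_ne_zero]; linear_combination hr
  subst hr'
  simp only [cosineForm] at hk
  simp only [Set.mem_ofPred_eq]
  linear_combination hk

/-- There are finitely many r, as the quartic has leading coefficient (1 - c₂²)². For each of them
(m² - p - q)² - 4pq = m⁴ - 2m²(p + q) + (p - q)² is at most quadratic in x = (r - k)/t, because p -
q is linear in x. It remains to see that it is not identically zero. -/
theorem IsGenericCosines.finite_norm (h : IsGenericCosines c ς t) :
    {k : K | ∃ r, (1 - r ^ 2 - (c 2 * r - c 3) ^ 2) ^ 2 - 4 * (c 2 * r - c 3) ^ 2 * r ^ 2 = 0 ∧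
      ((c 2 * r - c 3) ^ 2 - cosineForm (c 0) 1 ((r - k) / t) -
      cosineForm (c 1) ((r - k) / t) r) ^ 2 -
      4 * (cosineForm (c 0) 1 ((r - k) / t) * cosineForm (c 1) ((r - k) / t) r) = 0}.Finite := by
  have hr : {r : K | (1 - r ^ 2 - (c 2 * r - c 3) ^ 2) ^ 2 -
      4 * (c 2 * r - c 3) ^ 2 * r ^ 2 = 0}.Finite := by
    have hc : (1 - c 2 ^ 2) ^ 2 ≠ 0 := pow_ne_zero 2 (sub_ne_zero.2 (h.sq_ne_one 2).symm)
    have hp : (1 - Polynomial.X ^ 2 - (Polynomial.C (c 2) * Polynomial.X -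
        Polynomial.C (c 3)) ^ 2) ^ 2 - 4 * (Polynomial.C (c 2) * Polynomial.X -
        Polynomial.C (c 3)) ^ 2 * Polynomial.X ^ 2 ≠ (0 : Polynomial K) := by
      intro h0
      have he : (1 - Polynomial.X ^ 2 - (Polynomial.C (c 2) * Polynomial.X -
        Polynomial.C (c 3)) ^ 2) ^ 2 - 4 * (Polynomial.C (c 2) * Polynomial.X -
        Polynomial.C (c 3)) ^ 2 * Polynomial.X ^ 2 =
        octic ![(1 - c 3 ^ 2) ^ 2, 4 * (1 - c 3 ^ 2) * c 2 * c 3,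
          -2 * (1 - c 3 ^ 2) * (1 + c 2 ^ 2) + 4 * c 2 ^ 2 * c 3 ^ 2 - 4 * c 3 ^ 2,
          -4 * c 2 * c 3 * (1 + c 2 ^ 2) + 8 * c 2 * c 3, (1 - c 2 ^ 2) ^ 2, 0, 0, 0, 0] := by
        simp [octic, Fin.sum_univ_succ, map_ofNat]
        ring
      have hz : (0 : Polynomial K) = octic 0 := by simp [octic]
      rw [he, hz] at h0
      exact hc (congrFun (octic_injective h0) 4)
    refine (Polynomial.finite_setOfPred_isRoot hp).subset ?_
    intro x hx
    simpa [Polynomial.IsRoot] using hx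
  have hbi : (⋃ r ∈ {r : K | (1 - r ^ 2 - (c 2 * r - c 3) ^ 2) ^ 2 -
      4 * (c 2 * r - c 3) ^ 2 * r ^ 2 = 0}, {k : K | (r - k) / t ∈
        {x : K | (4 * (c 1 * r - c 0) ^ 2 - 4 * (c 2 * r - c 3) ^ 2) * x ^ 2 +
        (4 * ((c 2 * r - c 3) ^ 2 + 1 - r ^ 2) * (c 1 * r - c 0) +
          8 * (c 2 * r - c 3) ^ 2 * c 0) * x +
        (((c 2 * r - c 3) ^ 2 + 1 - r ^ 2) ^ 2 - 4 * (c 2 * r - c 3) ^ 2) = 0}}).Finite := by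
    refine hr.biUnion fun r _ => finite_of_line (finite_quadratic_eq_zero ?_) r h.t_ne_zero
    rintro ⟨e2, e1, e0⟩
    set m := c 2 * r - c 3
    set A := m ^ 2 + 1 - r ^ 2 with hA
    set B := c 1 * r - c 0
    have h20 := h.two_ne_zero
    have h4 : (4 : K) ≠ 0 := by
      have : (4 : K) = 2 * 2 := by norm_num
      rw [this]; exact mul_ne_zero h20 h20
    -- A combination of the three coefficients in which A and B cancel. It forces m = 0, and then A
    -- = B = 0 gives r² = 1 and c₀ = c₁r, against c₀² ≠ c₁².
    have hm4 : (2 * 2 * 2 * 2 : K) * m ^ 4 * (1 - c 0 ^ 2) = 0 := by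
      linear_combination -4 * B ^ 2 * e0 - 4 * m ^ 2 * e2 + (A * B - 2 * m ^ 2 * c 0) * e1
    have hm : m = 0 := by
      have := (mul_eq_zero.1 hm4).resolve_right (sub_ne_zero.2 (h.sq_ne_one 0).symm)
      have := (mul_eq_zero.1 this).resolve_left (mul_ne_zero (mul_ne_zero (mul_ne_zero h20 h20) h20) h20)
      exact pow_eq_zero_iff (by norm_num) |>.1 this
    rw [hm] at e0 e2 hA
    have hA0 : A = 0 := by simpa using e0
    have hB0 : B = 0 := by
      have : 4 * B ^ 2 = 0 := by linear_combination e2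
      simpa [h4] using this
    apply h.sq_ne_sq
    have hB' : c 0 = c 1 * r := by linear_combination -hB0
    rw [hB']
    linear_combination -(c 1) ^ 2 * (hA0 - hA)
  refine hbi.subset ?_
  rintro k ⟨r, hr, hk⟩
  simp only [Set.mem_iUnion]
  refine ⟨r, hr, ?_⟩
  simp only [cosineForm] at hk
  simp only [Set.mem_ofPred_eq]
  linear_combination hk

theorem IsGenericCosines.finite_not_isGenericHyperplane [IsAlgClosed K]
    (h : IsGenericCosines c ς t) : {k : K | ¬ IsGenericHyperplane c ς t k}.Finite := by
  -- The value k = 0 is removed because the second form becomes a multiple of X² there.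
  refine ((((Set.finite_singleton (0 : K)).union h.finite_isSquare_mul).union
    h.finite_isSquare_heron).union (h.finite_sub.union h.finite_norm)).subset ?_
  intro k hk
  by_contra hcon
  simp only [Set.mem_union, Set.mem_singleton_iff, not_or] at hcon
  obtain ⟨⟨⟨h0, h1⟩, h3⟩, h4, h5⟩ := hcon
  apply hk
  refine ⟨not_isSquare_cosineForm_left h.two_ne_zero (h.sq_ne_one 0),
    not_isSquare_cosineForm_right h.two_ne_zero (h.sq_ne_one 1) h0, h1, h3, ?_, ?_⟩
  · intro r hr hr'
    exact h4 ⟨r, hr, hr'⟩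
  · intro r hr hr'
    exact h5 ⟨r, hr, hr'⟩

end Exceptional

/-! ### The prime ideals of the variety and of its sections -/

section PrimeIdeals

variable {K : Type*} [Field K] {c : Fin 4 → K} {ς t k : K}

theorem RegularMod.of_isUnit_left {R : Type*} [CommRing R] {b a : R} (h : IsUnit b) :
    RegularMod b a := fun _ _ => h.dvd

/-- Everything is tested on the line given by `ev`. A square in `P` restricts to a square, so
non-squareness may be checked after `ev`. The divisors in the coprimality conditions are products of
units and primes y₂ - r y₀; such a prime restricts to a form vanishing at y₁ = (r - k)/t, so it
divides no element with a nonzero value there. -/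
theorem isPrime_span_lastQuadric {P : Type*} [CommRing P] [IsDomain P]
    [UniqueFactorizationMonoid P] [Algebra K P] (h : IsGenericCosines c ς t)
    (hk : IsGenericHyperplane c ς t k) (ev : P →ₐ[K] Polynomial K) {y₀ y₁ y₂ : P}
    (h₀ : ev y₀ = 1) (h₁ : ev y₁ = Polynomial.X)
    (h₂ : ev y₂ = Polynomial.C t * Polynomial.X + Polynomial.C k)
    (hprime : ∀ r : K, Prime (y₂ - algebraMap K P r * y₀)) :
    (Ideal.span {lastQuadric c y₀ y₁ y₂}).IsPrime := by
  have hc : ∀ a : K, ev (algebraMap K P a) = Polynomial.C a := fun a => by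
    rw [AlgHom.commutes]; rfl
  have hns : ∀ f : P, ¬ IsSquare (ev f) → NonsquareFrac f := fun f hf =>
    nonsquareFrac_of_not_isSquare fun hsq => hf (hsq.map ev)
  have hev : ∀ a x y, ev (cosineForm a x y) = cosineForm (ev a) (ev x) (ev y) := fun a x y =>
    map_cosineForm ev.toRingHom a x y
  have hreg : ∀ (r : K) (f : P), (ev f).eval ((r - k) / t) ≠ 0 →
      RegularMod (y₂ - algebraMap K P r * y₀) f := by
    intro r f hf
    refine (hprime r).regularMod ?_
    rintro ⟨g, rfl⟩
    apply hf
    rw [map_mul, map_sub, map_mul, hc, h₀, h₂]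
    simp
    left
    field_simp [h.t_ne_zero]
    ring
  have hunit : ∀ a : K, a ≠ 0 → IsUnit (algebraMap K P a) := fun a ha =>
    ha.isUnit.map (algebraMap K P)
  have hev1 : ∀ r : K, t * ((r - k) / t) + k = r := by
    intro r
    field_simp [h.t_ne_zero]
    ring
  have h2 : IsUnit (2 : P) := by
    have := hunit 2 h.two_ne_zero
    rwa [map_ofNat] at this
  have hM : algebraMap K P (c 2) * y₂ - algebraMap K P (c 3) * y₀ =
      algebraMap K P (c 2) * (y₂ - algebraMap K P (c 3 / c 2) * y₀) := by
    have : algebraMap K P (c 3) = algebraMap K P (c 2) * algebraMap K P (c 3 / c 2) := by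
      rw [← map_mul, mul_div_cancel₀ _ h.c_two_ne_zero]
    rw [this]; ring
  have hp1 : 1 + c 2 ≠ 0 := by
    intro h0
    apply h.sq_ne_one 2
    linear_combination (c 2 - 1) * h0
  have hm1 : 1 - c 2 ≠ 0 := by
    intro h0
    apply h.sq_ne_one 2
    linear_combination -(c 2 + 1) * h0
  -- With M = c₂y₂ - c₃y₀ this is the product of y₀² - (y₂ + M)² and y₀² - (y₂ - M)², each a
  -- difference of squares. The four ratios r are the zeros of the linear factors.
  have hfac : (y₀ ^ 2 - y₂ ^ 2 - (algebraMap K P (c 2) * y₂ - algebraMap K P (c 3) * y₀) ^ 2) ^ 2 -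
      4 * (algebraMap K P (c 2) * y₂ - algebraMap K P (c 3) * y₀) ^ 2 * y₂ ^ 2 =
      algebraMap K P ((1 + c 2) ^ 2 * (1 - c 2) ^ 2) *
      (y₂ - algebraMap K P ((1 + c 3) / (1 + c 2)) * y₀) *
      (y₂ - algebraMap K P ((c 3 - 1) / (1 + c 2)) * y₀) *
      (y₂ - algebraMap K P ((1 - c 3) / (1 - c 2)) * y₀) *
      (y₂ - algebraMap K P (-(1 + c 3) / (1 - c 2)) * y₀) := by
    have e1 : algebraMap K P ((1 + c 3) / (1 + c 2)) * (1 + algebraMap K P (c 2)) =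
        1 + algebraMap K P (c 3) := by
      rw [← map_one (algebraMap K P), ← map_add, ← map_mul, ← map_add, div_mul_cancel₀ _ hp1]
    have e2 : algebraMap K P ((c 3 - 1) / (1 + c 2)) * (1 + algebraMap K P (c 2)) =
        algebraMap K P (c 3) - 1 := by
      rw [← map_one (algebraMap K P), ← map_add, ← map_mul, ← map_sub, div_mul_cancel₀ _ hp1]
    have e3 : algebraMap K P ((1 - c 3) / (1 - c 2)) * (1 - algebraMap K P (c 2)) =
        1 - algebraMap K P (c 3) := by
      rw [← map_one (algebraMap K P), ← map_sub, ← map_mul, ← map_sub, div_mul_cancel₀ _ hm1]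
    have e4 : algebraMap K P (-(1 + c 3) / (1 - c 2)) * (1 - algebraMap K P (c 2)) =
        -(1 + algebraMap K P (c 3)) := by
      rw [← map_one (algebraMap K P), ← map_sub, ← map_mul, ← map_add, ← map_neg,
        div_mul_cancel₀ _ hm1]
    have h1 : ((1 + algebraMap K P (c 2)) * (y₂ - algebraMap K P ((1 + c 3) / (1 + c 2)) * y₀)) =
      ((1 + algebraMap K P (c 2)) * y₂ - (1 + algebraMap K P (c 3)) * y₀) := by
      linear_combination -y₀ * e1
    have h2 : ((1 + algebraMap K P (c 2)) * (y₂ - algebraMap K P ((c 3 - 1) / (1 + c 2)) * y₀)) =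
      ((1 + algebraMap K P (c 2)) * y₂ - (algebraMap K P (c 3) - 1) * y₀) := by
      linear_combination -y₀ * e2
    have h3 : ((1 - algebraMap K P (c 2)) * (y₂ - algebraMap K P ((1 - c 3) / (1 - c 2)) * y₀)) =
      ((1 - algebraMap K P (c 2)) * y₂ - (1 - algebraMap K P (c 3)) * y₀) := by
      linear_combination -y₀ * e3
    have h4 : ((1 - algebraMap K P (c 2)) * (y₂ - algebraMap K P (-(1 + c 3) / (1 - c 2)) * y₀)) =
      ((1 - algebraMap K P (c 2)) * y₂ + (1 + algebraMap K P (c 3)) * y₀) := by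
      linear_combination -y₀ * e4
    have hL : algebraMap K P ((1 + c 2) ^ 2 * (1 - c 2) ^ 2) =
        (1 + algebraMap K P (c 2)) * (1 + algebraMap K P (c 2)) *
        ((1 - algebraMap K P (c 2)) * (1 - algebraMap K P (c 2))) := by
      simp only [map_mul, map_pow, map_add, map_sub, map_one]; ring
    calc _ = (((1 + algebraMap K P (c 2)) * y₂ - (1 + algebraMap K P (c 3)) * y₀) *
        ((1 + algebraMap K P (c 2)) * y₂ - (algebraMap K P (c 3) - 1) * y₀)) *
        (((1 - algebraMap K P (c 2)) * y₂ - (1 - algebraMap K P (c 3)) * y₀) *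
        ((1 - algebraMap K P (c 2)) * y₂ + (1 + algebraMap K P (c 3)) * y₀)) := by ring
      _ = _ := by rw [← h1, ← h2, ← h3, ← h4, hL]; ring
  have hcu : IsUnit (algebraMap K P ((1 + c 2) ^ 2 * (1 - c 2) ^ 2)) :=
    hunit _ (mul_ne_zero (pow_ne_zero 2 hp1) (pow_ne_zero 2 hm1))
  have hnorm : ∀ r, (1 - r ^ 2 - (c 2 * r - c 3) ^ 2) ^ 2 -
      4 * (c 2 * r - c 3) ^ 2 * r ^ 2 = 0 → RegularMod (y₂ - algebraMap K P r * y₀)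
      (((algebraMap K P (c 2) * y₂ - algebraMap K P (c 3) * y₀) ^ 2 -
      cosineForm (algebraMap K P (c 0)) y₀ y₁ - cosineForm (algebraMap K P (c 1)) y₁ y₂) ^ 2 -
      4 * (cosineForm (algebraMap K P (c 0)) y₀ y₁ *
        cosineForm (algebraMap K P (c 1)) y₁ y₂)) := by
    intro r hr
    refine hreg r _ ?_
    have := hk.norm_ne_zero r hr
    simp only [map_sub, map_mul, map_pow, hev, hc, h₀, h₁, h₂, map_ofNat]
    simp only [← Polynomial.coe_evalRingHom, map_sub, map_mul, map_pow, map_cosineForm, map_ofNat,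
      map_one, map_add]
    simp only [Polynomial.coe_evalRingHom, Polynomial.eval_C, Polynomial.eval_X, hev1, mul_one]
    exact this
  refine isPrime_span_conicLine_tower (ς := algebraMap K P ς) h2 ?_ ?_ ?_ ?_ ?_ ?_ ?_ ?_ ?_
  · apply hns
    rw [hev, hc, h₀, h₁]
    exact hk.not_isSquare_left
  · apply hns
    rw [hev, hc, h₂, h₁]
    exact hk.not_isSquare_right
  · apply hns
    rw [map_mul, hev, hev, hc, hc, h₀, h₂, h₁]
    exact hk.not_isSquare_mul
  · rw [← map_pow, h.sines]
    simp
  · apply hns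
    have := hk.not_isSquare_heron
    simp only [heron, map_sub, map_mul, map_pow, map_add, hev, hc, h₀, h₁, h₂, map_ofNat] at this ⊢
    exact this
  · rw [hM]
    exact mul_ne_zero (hunit _ h.c_two_ne_zero).ne_zero (hprime _).ne_zero
  · rw [hM]
    refine RegularMod.mul_left (hunit _ h.c_two_ne_zero).ne_zero
      (RegularMod.of_isUnit_left (hunit _ h.c_two_ne_zero)) (hreg _ _ ?_)
    have := hk.sub_ne_zero (c 3 / c 2) (by rw [mul_div_cancel₀ _ h.c_two_ne_zero, sub_self])
    simp only [map_sub, hev, hc, h₀, h₁, h₂]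
    simp only [← Polynomial.coe_evalRingHom, map_sub, map_mul, map_cosineForm,
      map_one, map_add]
    simp only [Polynomial.coe_evalRingHom, Polynomial.eval_C, Polynomial.eval_X, hev1]
    exact this
  · rw [hfac]
    exact mul_ne_zero (mul_ne_zero (mul_ne_zero (mul_ne_zero hcu.ne_zero (hprime _).ne_zero)
      (hprime _).ne_zero) (hprime _).ne_zero) (hprime _).ne_zero
  · rw [hfac]
    refine RegularMod.mul_left (mul_ne_zero (mul_ne_zero (mul_ne_zero hcu.ne_zero
      (hprime _).ne_zero) (hprime _).ne_zero) (hprime _).ne_zero) (RegularMod.mul_left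
      (mul_ne_zero (mul_ne_zero hcu.ne_zero (hprime _).ne_zero) (hprime _).ne_zero)
      (RegularMod.mul_left (mul_ne_zero hcu.ne_zero (hprime _).ne_zero) (RegularMod.mul_left
      hcu.ne_zero (RegularMod.of_isUnit_left hcu) (hnorm _ ?_)) (hnorm _ ?_)) (hnorm _ ?_))
      (hnorm _ ?_)
    all_goals field_simp; ring

end PrimeIdeals

/-! ### Primality for the variety and for its sections. -/

section PrimeIdeals

variable {K : Type*} [Field K] {c : Fin 4 → K} {ς t k : K}

theorem MvPolynomial.prime_linear {τ : Type*} {i j : τ} (hij : i ≠ j) {a b : K} (ha : a ≠ 0) :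
    Prime (C a * X i + C b * X j : MvPolynomial τ K) := by
  classical
  have h := irreducible_sumSMulX (Finsupp.single i a + Finsupp.single j b) ⟨i, by
    simp [hij, ha]⟩ (by
    intro r hr
    have := hr i
    simp only [Finsupp.add_apply, Finsupp.single_eq_same, Finsupp.single_apply, hij.symm, if_false,
      add_zero] at this
    exact isUnit_of_dvd_unit this ha.isUnit)
  have he : sumSMulX (Finsupp.single i a + Finsupp.single j b) =
      (C a * X i + C b * X j : MvPolynomial τ K) := by
    rw [map_add]
    simp [sumSMulX, MvPolynomial.smul_eq_C_mul]
  rw [he] at h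
  exact h.prime

/-- The ideal of the variety, in rescaled coordinates. -/
noncomputable def varietyIdeal (σ c : Fin 4 → K) : Ideal (MvPolynomial (Fin 8) K) :=
  Ideal.span (Set.range (scaledQuadric σ c))

/-- The ideal of a hyperplane section, in rescaled coordinates. -/
noncomputable def sectionIdeal (σ c : Fin 4 → K) (k : K) : Ideal (MvPolynomial (Fin 8) K) :=
  Ideal.span (insert (hyperplaneForm k) (Set.range (scaledQuadric σ c)))

theorem IsGenericCosines.exists_isGenericHyperplane [IsAlgClosed K]
    (h : IsGenericCosines c ς t) : ∃ k, IsGenericHyperplane c ς t k := by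
  have : Infinite K := IsAlgClosed.instInfinite
  obtain ⟨k, hk⟩ := h.finite_not_isGenericHyperplane.infinite_compl.nonempty
  exact ⟨k, not_not.1 hk⟩

/-- Here y₀, y₁, y₂ and the free coordinate X₃ are independent variables. A single generic k is
enough, since it serves only to choose a test line in this polynomial ring. -/
theorem isPrime_varietyIdeal [IsAlgClosed K] (h : IsGenericCosines c ς t) {σ : Fin 4 → K}
    (hσ : ∀ i, σ i ≠ 0) : (varietyIdeal σ c).IsPrime := by
  obtain ⟨k, hk⟩ := h.exists_isGenericHyperplane
  have hp := isPrime_span_lastQuadric (P := MvPolynomial (Fin 4) K) (y₀ := X 0) (y₁ := X 1)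
    (y₂ := X 2) h hk
    (aeval ![1, Polynomial.X, Polynomial.C t * Polynomial.X + Polynomial.C k, 0])
    (by simp) (by simp) (by simp) (by
      intro r
      have := MvPolynomial.prime_linear (K := K) (i := (2 : Fin 4)) (j := 0) (by decide)
        (a := 1) (b := -r) one_ne_zero
      convert this using 1
      simp [MvPolynomial.algebraMap_eq]
      ring)
  rw [← comap_toTower σ c (X 3) (X 0) (X 1) (X 2) hσ (varietyIdeal σ c)
    (fun i => Ideal.subset_span ⟨i, rfl⟩) ?_
    (eval₂Hom ((Ideal.Quotient.mk _).comp C) ![Ideal.Quotient.mk _ (C (σ 0) * X 4),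
      Ideal.Quotient.mk _ (C (σ 1) * X 5), Ideal.Quotient.mk _ (C (σ 2) * X 6),
      Ideal.Quotient.mk _ (X 3)])
    (by intro a; simp [MvPolynomial.algebraMap_eq]) (by simp) (by simp) (by simp) (by simp)]
  · exact hp.comap _
  · have : varietyIdeal σ c ≤ (Ideal.span {lastQuadric c (X 0 : MvPolynomial (Fin 4) K) (X 1)
      (X 2)}).comap (toTower σ c (X 3) (X 0) (X 1) (X 2)) := by
      rw [varietyIdeal, Ideal.span_le]
      rintro _ ⟨i, rfl⟩
      rw [SetLike.mem_coe, Ideal.mem_comap, toTower_scaledQuadric σ c _ _ _ _ hσ]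
      fin_cases i
      · exact zero_mem _
      · exact zero_mem _
      · exact zero_mem _
      · exact Ideal.mem_span_singleton_self _
    exact this

/-- The hyperplane eliminates y₂. In the coordinates yᵢ = σᵢYᵢ, the equation Y₂ = Y₁ + kY₀ reads y₂
= (σ₂/σ₁)y₁ + k(σ₂/σ₀)y₀, which explains the slope and the rescaled parameter. -/
theorem isPrime_sectionIdeal {σ : Fin 4 → K} (h : IsGenericCosines c ς (σ 2 / σ 1))
    (hσ : ∀ i, σ i ≠ 0) (hk : IsGenericHyperplane c ς (σ 2 / σ 1) (k * (σ 2 / σ 0))) :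
    (sectionIdeal σ c k).IsPrime := by
  set y₂ : MvPolynomial (Fin 3) K := C (σ 2 / σ 1) * X 1 + C (k * (σ 2 / σ 0)) * X 0 with hy₂
  have hp := isPrime_span_lastQuadric (P := MvPolynomial (Fin 3) K) (y₀ := X 0) (y₁ := X 1)
    (y₂ := y₂) h hk
    (aeval ![1, Polynomial.X, 0])
    (by simp) (by simp) (by
      simp only [hy₂, map_add, map_mul, MvPolynomial.algHom_C, aeval_X, Polynomial.algebraMap_apply]
      simp) (by
      intro r
      have := MvPolynomial.prime_linear (K := K) (i := (1 : Fin 3)) (j := 0) (by decide)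
        (a := σ 2 / σ 1) (b := k * (σ 2 / σ 0) - r) h.t_ne_zero
      convert this using 1
      simp [MvPolynomial.algebraMap_eq, hy₂]
      ring)
  have hL : Ideal.Quotient.mk (sectionIdeal σ c k) (X 6) =
      Ideal.Quotient.mk (sectionIdeal σ c k) (X 5 + C k * X 4) := by
    rw [Ideal.Quotient.mk_eq_mk_iff_sub_mem]
    have : hyperplaneForm k ∈ sectionIdeal σ c k := Ideal.subset_span (Set.mem_insert _ _)
    convert this using 1
    rw [hyperplaneForm]; ring
  rw [← comap_toTower σ c (X 2) (X 0) (X 1) y₂ hσ (sectionIdeal σ c k)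
    (fun i => Ideal.subset_span (Set.mem_insert_of_mem _ ⟨i, rfl⟩)) ?_
    (eval₂Hom ((Ideal.Quotient.mk _).comp C) ![Ideal.Quotient.mk _ (C (σ 0) * X 4),
      Ideal.Quotient.mk _ (C (σ 1) * X 5), Ideal.Quotient.mk _ (X 3)])
    (by intro a; simp [MvPolynomial.algebraMap_eq]) (by simp) (by simp) (by simp) ?_]
  · exact hp.comap _
  · have : sectionIdeal σ c k ≤ (Ideal.span {lastQuadric c (X 0 : MvPolynomial (Fin 3) K) (X 1)
      y₂}).comap (toTower σ c (X 2) (X 0) (X 1) y₂) := by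
      rw [sectionIdeal, Ideal.span_le]
      rintro _ (rfl | ⟨i, rfl⟩)
      · rw [SetLike.mem_coe, Ideal.mem_comap]
        have h0 : (C (σ 2)⁻¹ * y₂ - C (σ 1)⁻¹ * X 1 - C k * (C (σ 0)⁻¹ * X 0) :
            MvPolynomial (Fin 3) K) = 0 := by
          have e1 : σ 2 / σ 1 = σ 2 * (σ 1)⁻¹ := div_eq_mul_inv _ _
          have e2 : k * (σ 2 / σ 0) = k * σ 2 * (σ 0)⁻¹ := by rw [div_eq_mul_inv]; ring
          have e3 : (C (σ 2)⁻¹ * C (σ 2) : MvPolynomial (Fin 3) K) = 1 := by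
            rw [← C_mul, inv_mul_cancel₀ (hσ 2), C_1]
          rw [hy₂, e1, e2]
          simp only [C_mul]
          linear_combination (C (σ 1)⁻¹ * X 1 + C k * C (σ 0)⁻¹ * X 0) * e3
        have h1 : toTower σ c (X 2) (X 0) (X 1) y₂ (hyperplaneForm k) =
            QuadricTower.ofBase c (X 0) (X 1) y₂
              (C (σ 2)⁻¹ * y₂ - C (σ 1)⁻¹ * X 1 - C k * (C (σ 0)⁻¹ * X 0)) := by
          simp [hyperplaneForm, toTower, towerCoords, MvPolynomial.algebraMap_eq, -map_inv₀]
        rw [h1.trans ((congrArg _ h0).trans (map_zero _))]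
        exact zero_mem _
      · rw [SetLike.mem_coe, Ideal.mem_comap, toTower_scaledQuadric σ c _ _ _ _ hσ]
        fin_cases i
        · exact zero_mem _
        · exact zero_mem _
        · exact zero_mem _
        · exact Ideal.mem_span_singleton_self _
    exact this
  · have hR : Ideal.Quotient.mk (sectionIdeal σ c k) (C (σ 2) * X 6) =
        Ideal.Quotient.mk (sectionIdeal σ c k) (C (σ 2) * (X 5 + C k * X 4)) := by
      rw [map_mul, hL, ← map_mul]
    rw [hR, hy₂]
    simp only [map_add, map_mul, coe_eval₂Hom, eval₂_C, eval₂_X, RingHom.comp_apply]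
    simp only [Matrix.cons_val_zero, Matrix.cons_val_one, map_mul]
    simp only [← map_mul, ← map_add]
    refine congrArg _ ?_
    have e1 : (C (σ 2 / σ 1) * C (σ 1) : MvPolynomial (Fin 8) K) = C (σ 2) := by
      rw [← C_mul, div_mul_cancel₀ _ (hσ 1)]
    have e2 : (C (k * (σ 2 / σ 0)) * C (σ 0) : MvPolynomial (Fin 8) K) = C k * C (σ 2) := by
      rw [← C_mul, mul_assoc, div_mul_cancel₀ _ (hσ 0), C_mul]
    linear_combination X 5 * e1 + X 4 * e2

end PrimeIdeals

/-! ### The ideals of the first quadrics -/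

section PartialIdeals

theorem Ideal.isPrime_of_comp_eq_mk {R D : Type*} [CommRing R] [CommRing D] [IsDomain D]
    {I : Ideal R} (π : R →+* D) (hI : I ≤ RingHom.ker π) (ψ : D →+* R ⧸ I)
    (h : ψ.comp π = Ideal.Quotient.mk I) : RingHom.ker π = I := by
  apply le_antisymm _ hI
  intro f hf
  rw [← Ideal.Quotient.eq_zero_iff_mem, ← h, RingHom.comp_apply, RingHom.mem_ker.1 hf, map_zero]

variable {K : Type*} [Field K]

/-- The squares of the first three coordinates. -/
noncomputable def radicand (σ c : Fin 4 → K) : Fin 3 → MvPolynomial (Fin 8) K :=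
  ![C (σ 0 ^ 2) * X 4 ^ 2 + C (σ 1 ^ 2) * X 5 ^ 2 - 2 * C (c 0 * (σ 0 * σ 1)) * X 4 * X 5,
    C (σ 1 ^ 2) * X 5 ^ 2 + C (σ 2 ^ 2) * X 6 ^ 2 - 2 * C (c 1 * (σ 1 * σ 2)) * X 5 * X 6,
    C (σ 2 ^ 2) * X 6 ^ 2 + C (σ 3 ^ 2) * X 7 ^ 2 - 2 * C (c 2 * (σ 2 * σ 3)) * X 6 * X 7]

variable (σ c : Fin 4 → K)

/-- The evaluation along a line in the coordinates `σᵢ Yᵢ`. -/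
noncomputable def lineEval (y : Fin 4 → Polynomial K) : MvPolynomial (Fin 8) K →ₐ[K] Polynomial K :=
  aeval ![0, 0, 0, 0, Polynomial.C (σ 0)⁻¹ * y 0, Polynomial.C (σ 1)⁻¹ * y 1,
    Polynomial.C (σ 2)⁻¹ * y 2, Polynomial.C (σ 3)⁻¹ * y 3]

variable {σ}

theorem lineEval_radicand (hσ : ∀ i, σ i ≠ 0) (y : Fin 4 → Polynomial K) (i : Fin 3) :
    lineEval σ y (radicand σ c i) =
      ![cosineForm (Polynomial.C (c 0)) (y 0) (y 1), cosineForm (Polynomial.C (c 1)) (y 1) (y 2),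
        cosineForm (Polynomial.C (c 2)) (y 2) (y 3)] i := by
  have hs : ∀ i, (Polynomial.C (σ i) * Polynomial.C (σ i)⁻¹ : Polynomial K) = 1 := by
    intro i
    rw [← Polynomial.C_mul, mul_inv_cancel₀ (hσ i), Polynomial.C_1]
  fin_cases i
  all_goals simp [radicand, lineEval, cosineForm, -map_inv₀, MvPolynomial.algHom_C]
  · linear_combination cosineForm_rescale (hs 0) (hs 1) (Polynomial.C (c 0)) (y 0) (y 1)
  · linear_combination cosineForm_rescale (hs 1) (hs 2) (Polynomial.C (c 1)) (y 1) (y 2)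
  · linear_combination cosineForm_rescale (hs 2) (hs 3) (Polynomial.C (c 2)) (y 2) (y 3)

theorem not_isSquare_cosineForm_one (h2 : (2 : K) ≠ 0) {e : K} (he : e ^ 2 ≠ 1) :
    ¬ IsSquare (cosineForm (Polynomial.C e) 1 Polynomial.X) := by
  have h := not_isSquare_quadratic (a := (1 : K)) (b := -2 * e) (e := 1) (by
    intro h0
    apply he
    have : (2 : K) ^ 2 * (e ^ 2 - 1) = 0 := by linear_combination h0
    exact sub_eq_zero.1 ((mul_eq_zero.1 this).resolve_left (pow_ne_zero _ h2)))
  convert h using 2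
  simp [cosineForm, map_ofNat]
  ring

/-- On the line y = (1, 0, 1, X) the first two radicands become 1 and the third a separable
quadratic, so all four products restrict to the same non-square. -/
theorem not_isSquare_radicand_two (hσ : ∀ i, σ i ≠ 0) (h2 : (2 : K) ≠ 0) (hc : ∀ i, c i ^ 2 ≠ 1) :
    NonsquareFrac (radicand σ c 2) ∧ NonsquareFrac (radicand σ c 0 * radicand σ c 2) ∧
    NonsquareFrac (radicand σ c 1 * radicand σ c 2) ∧
    NonsquareFrac (radicand σ c 0 * radicand σ c 1 * radicand σ c 2) := by
  have key := lineEval_radicand c hσ ![1, 0, 1, Polynomial.X]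
  have h := not_isSquare_cosineForm_one h2 (hc 2)
  refine ⟨?_, ?_, ?_, ?_⟩ <;>
  · refine nonsquareFrac_of_not_isSquare fun hs => h ?_
    have := hs.map (lineEval σ ![1, 0, 1, Polynomial.X])
    simp only [map_mul, key] at this
    simpa [cosineForm] using this

theorem not_isSquare_radicand_zero (hσ : ∀ i, σ i ≠ 0) (h2 : (2 : K) ≠ 0) (hc : ∀ i, c i ^ 2 ≠ 1) :
    NonsquareFrac (radicand σ c 0) ∧ NonsquareFrac (radicand σ c 0 * radicand σ c 1) := by
  have key := lineEval_radicand c hσ ![Polynomial.X, 1, 0, 0]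
  have h := not_isSquare_cosineForm_one h2 (hc 0)
  refine ⟨?_, ?_⟩ <;>
  · refine nonsquareFrac_of_not_isSquare fun hs => h ?_
    have := hs.map (lineEval σ ![Polynomial.X, 1, 0, 0])
    simp only [map_mul, key] at this
    refine (congrArg IsSquare ?_).mp this
    simp [cosineForm]
    ring

theorem not_isSquare_radicand_one (hσ : ∀ i, σ i ≠ 0) (h2 : (2 : K) ≠ 0) (hc : ∀ i, c i ^ 2 ≠ 1) :
    NonsquareFrac (radicand σ c 1) := by
  have key := lineEval_radicand c hσ ![0, 1, Polynomial.X, 0]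
  have h := not_isSquare_cosineForm_one h2 (hc 1)
  refine nonsquareFrac_of_not_isSquare fun hs => h ?_
  have := hs.map (lineEval σ ![0, 1, Polynomial.X, 0])
  simp only [key] at this
  simpa using this

variable (σ)

theorem scaledQuadric_zero : scaledQuadric σ c 0 = X 0 ^ 2 - radicand σ c 0 := rfl
theorem scaledQuadric_one : scaledQuadric σ c 1 = X 1 ^ 2 - radicand σ c 1 := rfl
theorem scaledQuadric_two : scaledQuadric σ c 2 = X 2 ^ 2 - radicand σ c 2 := rfl

/-- A ring homomorphism on the coordinate ring that agrees with `ι` on all coordinates but the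
first three. -/
noncomputable def coordHom {D : Type*} [CommRing D] (ι : MvPolynomial (Fin 8) K →+* D)
    (u₀ u₁ u₂ : D) : MvPolynomial (Fin 8) K →+* D :=
  eval₂Hom (ι.comp C) ![u₀, u₁, u₂, ι (X 3), ι (X 4), ι (X 5), ι (X 6), ι (X 7)]

section CoordHom

variable {D : Type*} [CommRing D] (ι : MvPolynomial (Fin 8) K →+* D) (u₀ u₁ u₂ : D)

theorem coordHom_X_zero : coordHom ι u₀ u₁ u₂ (X 0) = u₀ := by simp [coordHom]
theorem coordHom_X_one : coordHom ι u₀ u₁ u₂ (X 1) = u₁ := by simp [coordHom]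
theorem coordHom_X_two : coordHom ι u₀ u₁ u₂ (X 2) = u₂ := by simp [coordHom]

theorem coordHom_radicand (i : Fin 3) :
    coordHom ι u₀ u₁ u₂ (radicand σ c i) = ι (radicand σ c i) := by
  fin_cases i <;> simp [coordHom, radicand, map_ofNat]

theorem comp_coordHom {S : Type*} [CommRing S] (ψ : D →+* S) (g : MvPolynomial (Fin 8) K →+* S)
    (hψ : ∀ a, ψ (ι a) = g a) (h₀ : ψ u₀ = g (X 0)) (h₁ : ψ u₁ = g (X 1)) (h₂ : ψ u₂ = g (X 2)) :
    ψ.comp (coordHom ι u₀ u₁ u₂) = g := by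
  apply MvPolynomial.ringHom_ext
  · intro a
    simp [coordHom, hψ]
  · intro i
    have hX : coordHom ι u₀ u₁ u₂ (X i) =
        ![u₀, u₁, u₂, ι (X 3), ι (X 4), ι (X 5), ι (X 6), ι (X 7)] i := by
      simp only [coordHom, coe_eval₂Hom, eval₂_X]
    rw [RingHom.comp_apply, hX]
    fin_cases i
    exacts [h₀, h₁, h₂, hψ _, hψ _, hψ _, hψ _, hψ _]

end CoordHom

/-- The ideals of the first quadrics. -/
noncomputable def partialIdeal : Fin 4 → Ideal (MvPolynomial (Fin 8) K) :=
  ![⊥, Ideal.span {scaledQuadric σ c 0},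
    Ideal.span {scaledQuadric σ c 0} ⊔ Ideal.span {scaledQuadric σ c 1},
    Ideal.span {scaledQuadric σ c 0} ⊔ Ideal.span {scaledQuadric σ c 1} ⊔
      Ideal.span {scaledQuadric σ c 2}]

theorem Set.range_fin_four {α : Type*} (f : Fin 4 → α) :
    Set.range f = {f 0} ∪ {f 1} ∪ {f 2} ∪ {f 3} := by
  ext a
  constructor
  · rintro ⟨i, rfl⟩
    fin_cases i <;> simp
  · rintro (((rfl | rfl) | rfl) | rfl) <;> exact ⟨_, rfl⟩

theorem varietyIdeal_eq :
    varietyIdeal σ c = partialIdeal σ c 3 ⊔ Ideal.span {scaledQuadric σ c 3} := by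
  rw [varietyIdeal, Set.range_fin_four, Ideal.span_union, Ideal.span_union, Ideal.span_union]
  rfl

variable {σ}

/-- The target of `π` adjoins √ to the full polynomial ring, so it keeps the replaced coordinates as
superfluous variables. This is harmless: only the kernel of `π` matters, and `ψ` shows that it is no
larger than the ideal. The omission of the next quadric is what makes it a nonzerodivisor modulo
this prime. -/
theorem isPrime_partialIdeal_one (hσ : ∀ i, σ i ≠ 0) (h2 : (2 : K) ≠ 0) (hc : ∀ i, c i ^ 2 ≠ 1) :
    (partialIdeal σ c 1).IsPrime ∧ scaledQuadric σ c 1 ∉ partialIdeal σ c 1 := by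
  have := (not_isSquare_radicand_zero c hσ h2 hc).1.isDomain
  let D := QuadraticAlgebra (MvPolynomial (Fin 8) K) (radicand σ c 0) 0
  let ι : MvPolynomial (Fin 8) K →+* D := algebraMap _ _
  let π : MvPolynomial (Fin 8) K →+* D := coordHom ι QuadraticAlgebra.omega (ι (X 1)) (ι (X 2))
  have hr : ∀ i, π (radicand σ c i) = ι (radicand σ c i) := coordHom_radicand σ c _ _ _ _
  have hX1 : π (X 1) = ι (X 1) := coordHom_X_one _ _ _ _
  have h0 : π (X 0) = QuadraticAlgebra.omega := coordHom_X_zero _ _ _ _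
  let I := partialIdeal σ c 1
  let ψ : D →+* MvPolynomial (Fin 8) K ⧸ I := QuadraticAlgebra.liftRingHom (Ideal.Quotient.mk I)
    (Ideal.Quotient.mk I (X 0)) (by
      rw [← map_pow, Ideal.Quotient.mk_eq_mk_iff_sub_mem]
      exact Ideal.mem_span_singleton_self _)
  have hψ : ∀ a, ψ (ι a) = Ideal.Quotient.mk I a := fun a =>
    QuadraticAlgebra.liftRingHom_algebraMap _ _ _ _
  have hk : RingHom.ker π = I := by
    refine Ideal.isPrime_of_comp_eq_mk π ?_ ψ ?_
    · refine (Ideal.span_singleton_le_iff_mem _).2 ?_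
      rw [RingHom.mem_ker, scaledQuadric_zero, map_sub, map_pow, h0, hr,
        QuadraticAlgebra.omega_sq, sub_self]
    · exact comp_coordHom _ _ _ _ _ _ hψ (QuadraticAlgebra.liftRingHom_omega _ _ _) (hψ _) (hψ _)
  refine ⟨?_, ?_⟩
  · change I.IsPrime
    rw [← hk]
    exact RingHom.ker_isPrime π
  · change scaledQuadric σ c 1 ∉ I
    rw [← hk, RingHom.mem_ker, scaledQuadric_one, map_sub, hr, map_pow, hX1, ← map_pow, ← map_sub]
    intro h
    have h' : (X 1 ^ 2 - radicand σ c 1 : MvPolynomial (Fin 8) K) = 0 :=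
      congrArg QuadraticAlgebra.re h
    have h3 := congrArg (eval ![0, 1, 0, 0, 0, 0, 0, 0]) h'
    simp [radicand] at h3

theorem isPrime_partialIdeal_two (hσ : ∀ i, σ i ≠ 0) (h2 : (2 : K) ≠ 0) (hc : ∀ i, c i ^ 2 ≠ 1) :
    (partialIdeal σ c 2).IsPrime ∧ scaledQuadric σ c 2 ∉ partialIdeal σ c 2 := by
  have h2' : (2 : MvPolynomial (Fin 8) K) ≠ 0 := by
    rw [← map_ofNat C 2]
    exact C_ne_zero.2 h2
  obtain ⟨n0, n01⟩ := not_isSquare_radicand_zero c hσ h2 hc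
  have n1 := not_isSquare_radicand_one c hσ h2 hc
  have := n0.isDomain
  have := (NonsquareFrac.quadraticAlgebra h2' n0 n1 n01).isDomain
  let D := BiquadraticAlgebra (MvPolynomial (Fin 8) K) (radicand σ c 0) (radicand σ c 1)
  let D1 := QuadraticAlgebra (MvPolynomial (Fin 8) K) (radicand σ c 0) 0
  let ι1 : D1 →+* D := algebraMap _ _
  let ι : MvPolynomial (Fin 8) K →+* D := ι1.comp (algebraMap _ _)
  let π : MvPolynomial (Fin 8) K →+* D := coordHom ι (ι1 QuadraticAlgebra.omega) QuadraticAlgebra.omega (ι (X 2))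
  have hr : ∀ i, π (radicand σ c i) = ι (radicand σ c i) := coordHom_radicand σ c _ _ _ _
  have hX2 : π (X 2) = ι (X 2) := coordHom_X_two _ _ _ _
  have h0 : π (X 0) = ι1 QuadraticAlgebra.omega := coordHom_X_zero _ _ _ _
  have h1 : π (X 1) = QuadraticAlgebra.omega := coordHom_X_one _ _ _ _
  let I := partialIdeal σ c 2
  let ψ1 : D1 →+* MvPolynomial (Fin 8) K ⧸ I := QuadraticAlgebra.liftRingHom (Ideal.Quotient.mk I)
    (Ideal.Quotient.mk I (X 0)) (by
      rw [← map_pow, Ideal.Quotient.mk_eq_mk_iff_sub_mem]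
      exact Ideal.mem_sup_left (Ideal.mem_span_singleton_self _))
  have hψ1 : ∀ a, ψ1 (algebraMap _ _ a) = Ideal.Quotient.mk I a := fun a =>
    QuadraticAlgebra.liftRingHom_algebraMap _ _ _ _
  let ψ : D →+* MvPolynomial (Fin 8) K ⧸ I := QuadraticAlgebra.liftRingHom ψ1
    (Ideal.Quotient.mk I (X 1)) (by
      rw [hψ1, ← map_pow, Ideal.Quotient.mk_eq_mk_iff_sub_mem]
      exact Ideal.mem_sup_right (Ideal.mem_span_singleton_self _))
  have hψι1 : ∀ a, ψ (ι1 a) = ψ1 a := fun a => QuadraticAlgebra.liftRingHom_algebraMap _ _ _ _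
  have hψ : ∀ a, ψ (ι a) = Ideal.Quotient.mk I a := fun a => (hψι1 _).trans (hψ1 a)
  have hk : RingHom.ker π = I := by
    refine Ideal.isPrime_of_comp_eq_mk π (sup_le ?_ ?_) ψ ?_
    · refine (Ideal.span_singleton_le_iff_mem _).2 ?_
      rw [RingHom.mem_ker, scaledQuadric_zero, map_sub, map_pow, h0, hr, ← map_pow,
        QuadraticAlgebra.omega_sq]
      exact sub_self _
    · refine (Ideal.span_singleton_le_iff_mem _).2 ?_
      rw [RingHom.mem_ker, scaledQuadric_one, map_sub, map_pow, h1, hr, QuadraticAlgebra.omega_sq]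
      exact sub_self _
    · exact comp_coordHom _ _ _ _ _ _ hψ
        ((hψι1 _).trans (QuadraticAlgebra.liftRingHom_omega _ _ _))
        (QuadraticAlgebra.liftRingHom_omega _ _ _) (hψ _)
  refine ⟨?_, ?_⟩
  · change I.IsPrime
    rw [← hk]
    exact RingHom.ker_isPrime π
  · change scaledQuadric σ c 2 ∉ I
    rw [← hk, RingHom.mem_ker, scaledQuadric_two, map_sub, hr, map_pow, hX2, ← map_pow, ← map_sub]
    intro h
    have h' : (X 2 ^ 2 - radicand σ c 2 : MvPolynomial (Fin 8) K) = 0 :=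
      congrArg (fun z => QuadraticAlgebra.re (QuadraticAlgebra.re z)) h
    have h3 := congrArg (eval ![0, 0, 1, 0, 0, 0, 0, 0]) h'
    simp [radicand] at h3

theorem isPrime_partialIdeal_three (hσ : ∀ i, σ i ≠ 0) (h2 : (2 : K) ≠ 0)
    (hc : ∀ i, c i ^ 2 ≠ 1) :
    (partialIdeal σ c 3).IsPrime ∧ scaledQuadric σ c 3 ∉ partialIdeal σ c 3 := by
  have h2' : (2 : MvPolynomial (Fin 8) K) ≠ 0 := by
    rw [← map_ofNat C 2]
    exact C_ne_zero.2 h2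
  obtain ⟨n0, n01⟩ := not_isSquare_radicand_zero c hσ h2 hc
  have n1 := not_isSquare_radicand_one c hσ h2 hc
  obtain ⟨n2, n02, n12, n012⟩ := not_isSquare_radicand_two c hσ h2 hc
  have := n0.isDomain
  have m1 := NonsquareFrac.quadraticAlgebra h2' n0 n1 n01
  have := m1.isDomain
  have m2 := NonsquareFrac.quadraticAlgebra h2' n0 n2 n02
  have m12 := NonsquareFrac.quadraticAlgebra h2' n0 n12 (by rwa [mul_assoc] at n012)
  rw [map_mul] at m12
  let R := MvPolynomial (Fin 8) K
  let D1 := QuadraticAlgebra R (radicand σ c 0) 0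
  let D2 := BiquadraticAlgebra R (radicand σ c 0) (radicand σ c 1)
  have h2'' : (2 : D1) ≠ 0 := by
    intro h
    exact h2' (congrArg QuadraticAlgebra.re h)
  have := (NonsquareFrac.quadraticAlgebra h2'' m1 m2 m12).isDomain
  let D := QuadraticAlgebra D2 (algebraMap D1 D2 (algebraMap R D1 (radicand σ c 2))) 0
  let ι1 : D1 →+* D2 := algebraMap _ _
  let ι2 : D2 →+* D := algebraMap _ _
  let ι : R →+* D := (ι2.comp ι1).comp (algebraMap _ _)
  let π : R →+* D := coordHom ι (ι2 (ι1 QuadraticAlgebra.omega))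
    (ι2 QuadraticAlgebra.omega) QuadraticAlgebra.omega
  have hr : ∀ i, π (radicand σ c i) = ι (radicand σ c i) := coordHom_radicand σ c _ _ _ _
  have h0 : π (X 0) = ι2 (ι1 QuadraticAlgebra.omega) := coordHom_X_zero _ _ _ _
  have h1 : π (X 1) = ι2 QuadraticAlgebra.omega := coordHom_X_one _ _ _ _
  have hw2 : π (X 2) = QuadraticAlgebra.omega := coordHom_X_two _ _ _ _
  let I := partialIdeal σ c 3
  let ψ1 : D1 →+* R ⧸ I := QuadraticAlgebra.liftRingHom (Ideal.Quotient.mk I)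
    (Ideal.Quotient.mk I (X 0)) (by
      rw [← map_pow, Ideal.Quotient.mk_eq_mk_iff_sub_mem]
      exact Ideal.mem_sup_left (Ideal.mem_sup_left (Ideal.mem_span_singleton_self _)))
  have hψ1 : ∀ a, ψ1 (algebraMap _ _ a) = Ideal.Quotient.mk I a := fun a =>
    QuadraticAlgebra.liftRingHom_algebraMap _ _ _ _
  let ψ2 : D2 →+* R ⧸ I := QuadraticAlgebra.liftRingHom ψ1
    (Ideal.Quotient.mk I (X 1)) (by
      rw [hψ1, ← map_pow, Ideal.Quotient.mk_eq_mk_iff_sub_mem]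
      exact Ideal.mem_sup_left (Ideal.mem_sup_right (Ideal.mem_span_singleton_self _)))
  have hψι1 : ∀ a, ψ2 (ι1 a) = ψ1 a := fun a => QuadraticAlgebra.liftRingHom_algebraMap _ _ _ _
  let ψ : D →+* R ⧸ I := QuadraticAlgebra.liftRingHom ψ2
    (Ideal.Quotient.mk I (X 2)) (by
      rw [hψι1, hψ1, ← map_pow, Ideal.Quotient.mk_eq_mk_iff_sub_mem]
      exact Ideal.mem_sup_right (Ideal.mem_span_singleton_self _))
  have hψι2 : ∀ a, ψ (ι2 a) = ψ2 a := fun a => QuadraticAlgebra.liftRingHom_algebraMap _ _ _ _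
  have hψ : ∀ a, ψ (ι a) = Ideal.Quotient.mk I a := fun a =>
    (hψι2 _).trans ((hψι1 _).trans (hψ1 a))
  have hk : RingHom.ker π = I := by
    refine Ideal.isPrime_of_comp_eq_mk π (sup_le (sup_le ?_ ?_) ?_) ψ ?_
    · refine (Ideal.span_singleton_le_iff_mem _).2 ?_
      rw [RingHom.mem_ker, scaledQuadric_zero, map_sub, map_pow, h0, hr, ← map_pow, ← map_pow,
        QuadraticAlgebra.omega_sq]
      exact sub_self _
    · refine (Ideal.span_singleton_le_iff_mem _).2 ?_
      rw [RingHom.mem_ker, scaledQuadric_one, map_sub, map_pow, h1, hr, ← map_pow,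
        QuadraticAlgebra.omega_sq]
      exact sub_self _
    · refine (Ideal.span_singleton_le_iff_mem _).2 ?_
      rw [RingHom.mem_ker, scaledQuadric_two, map_sub, map_pow, hw2, hr, QuadraticAlgebra.omega_sq]
      exact sub_self _
    · exact comp_coordHom _ _ _ _ _ _ hψ
        ((hψι2 _).trans ((hψι1 _).trans (QuadraticAlgebra.liftRingHom_omega _ _ _)))
        ((hψι2 _).trans (QuadraticAlgebra.liftRingHom_omega _ _ _))
        (QuadraticAlgebra.liftRingHom_omega _ _ _)
  refine ⟨?_, ?_⟩
  · change I.IsPrime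
    rw [← hk]
    exact RingHom.ker_isPrime π
  · intro h
    -- At this point the first three quadrics vanish, while the fourth has the value (1 + 1)² ≠ 0.
    let v : Fin 8 → K := ![1, 1, 0, 0, 0, (σ 1)⁻¹, 0, 0]
    have hle : partialIdeal σ c 3 ≤ RingHom.ker (eval v) := by
      refine sup_le (sup_le ?_ ?_) ?_ <;>
        rw [Ideal.span_singleton_le_iff_mem, RingHom.mem_ker] <;>
        simp [scaledQuadric, v, hσ]
    have h3 := RingHom.mem_ker.1 (hle h)
    simp [scaledQuadric, v] at h3
    rw [one_add_one_eq_two] at h3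
    exact h2 h3

end PartialIdeals

/-! ### The Zariski topology on projective space -/

section ProjectiveTopology

variable {K : Type*} [Field K] {τ : Type*}

theorem MvPolynomial.IsHomogeneous.eval_smul {f : MvPolynomial τ K} {n : ℕ}
    (hf : f.IsHomogeneous n) (a : K) (v : τ → K) : eval (a • v) f = a ^ n * eval v f := by
  rw [eval_eq, eval_eq, Finset.mul_sum]
  refine Finset.sum_congr rfl fun d hd => ?_
  have hn : d.degree = n := by
    rw [Finsupp.degree_eq_weight_one]
    exact hf (mem_support_iff.1 hd)
  simp only [Pi.smul_apply, smul_eq_mul, mul_pow, Finset.prod_mul_distrib]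
  rw [Finset.prod_pow_eq_pow_sum, ← Finsupp.degree_apply, hn]
  ring

theorem MvPolynomial.IsHomogeneous.eval_rep_eq_zero_iff {f : MvPolynomial τ K} {n : ℕ}
    (hf : f.IsHomogeneous n) {v : τ → K} (hv : v ≠ 0) :
    eval (Projectivization.mk K v hv).rep f = 0 ↔ eval v f = 0 := by
  obtain ⟨a, ha⟩ := (Projectivization.mk_eq_mk_iff' K _ _ hv
    (Projectivization.rep_nonzero _)).1 (Projectivization.mk_rep (Projectivization.mk K v hv)).symm
  have ha0 : a ≠ 0 := by
    rintro rfl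
    exact hv (by rw [← ha, zero_smul])
  conv_rhs => rw [← ha, hf.eval_smul]
  simp [ha0]

theorem isOpen_setOf_eval_rep_ne_zero {f : MvPolynomial τ K} {n : ℕ} (hf : f.IsHomogeneous n) :
    IsOpen {P : ℙ K (τ → K) | eval P.rep f ≠ 0} :=
  TopologicalSpace.isOpen_generateFrom_of_mem ⟨f, n, hf, rfl⟩

theorem isClosed_projectiveZeroLocus {S : Set (MvPolynomial τ K)}
    (hS : ∀ f ∈ S, ∃ n, f.IsHomogeneous n) : IsClosed (projectiveZeroLocus S) := by
  have : projectiveZeroLocus S = ⋂ f ∈ S, {P | eval P.rep f ≠ 0}ᶜ := by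
    ext P
    simp [projectiveZeroLocus]
  rw [this]
  refine isClosed_biInter fun f hf => ?_
  obtain ⟨n, hn⟩ := hS f hf
  exact (isOpen_setOf_eval_rep_ne_zero hn).isClosed_compl

/-- Products of forms are forms, so the generating non-vanishing loci are stable under intersection
and, with the whole space, form a basis. -/
theorem exists_isHomogeneous_of_isOpen {U : Set (ℙ K (τ → K))} (hU : IsOpen U)
    {P : ℙ K (τ → K)} (hP : P ∈ U) : ∃ (f : MvPolynomial τ K) (n : ℕ), f.IsHomogeneous n ∧
      eval P.rep f ≠ 0 ∧ ∀ Q : ℙ K (τ → K), eval Q.rep f ≠ 0 → Q ∈ U := by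
  have hb := TopologicalSpace.isTopologicalBasis_of_subbasis_of_inter
    (r := {U | ∃ (f : MvPolynomial τ K) (n : ℕ), f.IsHomogeneous n ∧
      U = {P : ℙ K (τ → K) | eval P.rep f ≠ 0}}) rfl (by
    rintro _ ⟨f, n, hf, rfl⟩ _ ⟨g, m, hg, rfl⟩
    refine ⟨f * g, n + m, hf.mul hg, ?_⟩
    ext P
    simp)
  obtain ⟨W, hW, hPW, hWU⟩ := hb.exists_subset_of_mem_open hP hU
  rcases hW with rfl | ⟨f, n, hf, rfl⟩
  · exact ⟨1, 0, isHomogeneous_one _ _, by simp, fun Q _ => hWU (Set.mem_univ Q)⟩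
  · exact ⟨f, n, hf, hPW, fun Q hQ => hWU hQ⟩

theorem mem_vanishingIdeal_affineCone {Z : Set (ℙ K (τ → K))} (hZ : Z.Nonempty)
    {f : MvPolynomial τ K} {n : ℕ} (hf : f.IsHomogeneous n) :
    f ∈ vanishingIdeal K (affineCone Z) ↔ ∀ P ∈ Z, eval P.rep f = 0 := by
  rw [mem_vanishingIdeal_iff]
  simp only [aeval_eq_eval]
  constructor
  · intro h P hP
    refine h _ fun hv => ?_
    rwa [Projectivization.mk_rep]
  · intro h v hv
    rcases eq_or_ne v 0 with rfl | hv0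
    -- The value at the origin is 0ⁿ times the value at a point of Z; for n = 0 this uses that Z is
    -- nonempty.
    · obtain ⟨P, hP⟩ := hZ
      have := hf.eval_smul 0 P.rep
      rwa [zero_smul, h P hP, mul_zero] at this
    · exact (hf.eval_rep_eq_zero_iff hv0).1 (h _ (hv hv0))

theorem isIrreducible_of_isPrime {Z : Set (ℙ K (τ → K))} (hZ : Z.Nonempty)
    {𝔮 : Ideal (MvPolynomial τ K)} (h𝔮 : 𝔮.IsPrime)
    (h : ∀ (f : MvPolynomial τ K) (n : ℕ), f.IsHomogeneous n →
      (∀ P ∈ Z, eval P.rep f = 0) → f ∈ 𝔮)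
    (h' : ∀ f ∈ 𝔮, ∀ P ∈ Z, eval P.rep f = 0) : IsIrreducible Z := by
  refine ⟨hZ, ?_⟩
  rintro U W hU hW ⟨P, hPZ, hPU⟩ ⟨Q, hQZ, hQW⟩
  obtain ⟨f, n, hf, hfP, hfU⟩ := exists_isHomogeneous_of_isOpen hU hPU
  obtain ⟨g, m, hg, hgQ, hgW⟩ := exists_isHomogeneous_of_isOpen hW hQW
  have hfq : f ∉ 𝔮 := fun hfq => hfP (h' f hfq P hPZ)
  have hgq : g ∉ 𝔮 := fun hgq => hgQ (h' g hgq Q hQZ)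
  have hfg : f * g ∉ 𝔮 := fun hfg => (h𝔮.mem_or_mem hfg).elim hfq hgq
  have : ¬ ∀ P ∈ Z, eval P.rep (f * g) = 0 := fun hv => hfg (h _ _ (hf.mul hg) hv)
  push Not at this
  obtain ⟨T, hTZ, hT⟩ := this
  rw [map_mul, mul_ne_zero_iff] at hT
  exact ⟨T, hTZ, hfU T hT.1, hgW T hT.2⟩

/-- The cone is stable under scaling. Along a ↦ a v, the value of f is a polynomial in a whose
coefficients are the values of the components of f; over an infinite field it vanishes only if they
all do. -/
theorem isHomogeneous_vanishingIdeal_affineCone [Infinite K] (Z : Set (ℙ K (τ → K))) :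
    letI := MvPolynomial.gradedAlgebra (σ := τ) (R := K)
    (vanishingIdeal K (affineCone Z)).IsHomogeneous (homogeneousSubmodule τ K) := by
  let _ := MvPolynomial.gradedAlgebra (σ := τ) (R := K)
  intro i f hf
  change (decomposition.decompose' f i : MvPolynomial τ K) ∈ _
  rw [decomposition.decompose'_apply]
  rw [mem_vanishingIdeal_iff] at hf ⊢
  simp only [aeval_eq_eval] at hf ⊢
  intro v hv
  have hcone : ∀ a : K, a • v ∈ affineCone Z := by
    intro a hav
    have ha : a ≠ 0 := by rintro rfl; simp at hav
    have hv0 : v ≠ 0 := by rintro rfl; simp at hav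
    have he : Projectivization.mk K (a • v) hav = Projectivization.mk K v hv0 :=
      (Projectivization.mk_eq_mk_iff' K _ _ _ _).2 ⟨a, rfl⟩
    rw [he]
    exact hv hv0
  have hp : (∑ j ∈ Finset.range (f.totalDegree + 1),
      Polynomial.monomial j (eval v (homogeneousComponent j f))) = (0 : Polynomial K) := by
    apply Polynomial.funext
    intro a
    rw [Polynomial.eval_finsetSum, Polynomial.eval_zero, ← hf _ (hcone a)]
    conv_rhs => rw [← sum_homogeneousComponent f, map_sum]
    refine Finset.sum_congr rfl fun j _ => ?_
    rw [Polynomial.eval_monomial, (homogeneousComponent_isHomogeneous j f).eval_smul, mul_comm]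
  by_cases hi : i ∈ Finset.range (f.totalDegree + 1)
  · have := congrArg (fun p => Polynomial.coeff p i) hp
    simpa [Polynomial.finsetSum_coeff, Polynomial.coeff_monomial, Finset.sum_ite_eq',
      Finset.mem_range.1 hi] using this
  · rw [homogeneousComponent_eq_zero _ _ (by simpa using hi), map_zero]

theorem isPrime_vanishingIdeal_affineCone [Infinite K] {Z : Set (ℙ K (τ → K))}
    (hZ : IsIrreducible Z) : (vanishingIdeal K (affineCone Z)).IsPrime := by
  let _ := MvPolynomial.gradedAlgebra (σ := τ) (R := K)
  refine (isHomogeneous_vanishingIdeal_affineCone Z).isPrime_of_homogeneous_mem_or_mem ?_ ?_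
  · obtain ⟨P, hP⟩ := hZ.nonempty
    intro h
    have h1 : (1 : MvPolynomial τ K) ∈ vanishingIdeal K (affineCone Z) := h ▸ Submodule.mem_top
    have := (mem_vanishingIdeal_affineCone hZ.nonempty (isHomogeneous_one _ _)).1 h1 P hP
    simp at this
  · rintro f g ⟨n, hf⟩ ⟨m, hg⟩ hfg
    by_contra! hcon
    rw [mem_vanishingIdeal_affineCone hZ.nonempty hf,
      mem_vanishingIdeal_affineCone hZ.nonempty hg] at hcon
    obtain ⟨h1, h2⟩ := hcon
    push Not at h1 h2
    obtain ⟨P, hP, hP'⟩ := h1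
    obtain ⟨Q, hQ, hQ'⟩ := h2
    obtain ⟨T, hT, hT1, hT2⟩ := hZ.2 _ _ (isOpen_setOf_eval_rep_ne_zero hf)
      (isOpen_setOf_eval_rep_ne_zero hg) ⟨P, hP, hP'⟩ ⟨Q, hQ, hQ'⟩
    have := (mem_vanishingIdeal_affineCone hZ.nonempty (IsHomogeneous.mul hf hg)).1 hfg T hT
    rw [map_mul, mul_eq_zero] at this
    exact this.elim hT1 hT2

theorem vanishingIdeal_affineCone_lt {Z W : Set (ℙ K (τ → K))} (hZ : Z.Nonempty)
    (hZc : IsClosed Z) (h : Z ⊂ W) :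
    vanishingIdeal K (affineCone W) < vanishingIdeal K (affineCone Z) := by
  refine lt_of_le_of_ne (vanishingIdeal_anti_mono fun v hv hv0 => h.1 (hv hv0)) fun he => ?_
  obtain ⟨P, hPW, hPZ⟩ := Set.exists_of_ssubset h
  obtain ⟨f, n, hf, hfP, hfZ⟩ := exists_isHomogeneous_of_isOpen hZc.isOpen_compl hPZ
  have hm : f ∈ vanishingIdeal K (affineCone Z) := by
    rw [mem_vanishingIdeal_affineCone hZ hf]
    intro Q hQ
    by_contra hQ'
    exact hfZ Q hQ' hQ
  rw [← he, mem_vanishingIdeal_affineCone ⟨P, hPW⟩ hf] at hm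
  exact hfP (hm P hPW)

/-- The maximal ideal of the origin contains the ideal of every nonempty set strictly. -/
theorem vanishingIdeal_affineCone_lt_origin {Z : Set (ℙ K (τ → K))} (hZ : Z.Nonempty) :
    vanishingIdeal K (affineCone Z) < RingHom.ker (eval (0 : τ → K)) := by
  constructor
  · intro f hf
    exact hf 0 fun h => absurd rfl h
  · intro hle
    obtain ⟨P, hP⟩ := hZ
    apply P.rep_nonzero
    funext i
    have : (X i : MvPolynomial τ K) ∈ vanishingIdeal K (affineCone Z) := hle (by simp)
    simpa using (mem_vanishingIdeal_affineCone ⟨P, hP⟩ (isHomogeneous_X K i)).1 this P hP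

/-- A chain of irreducible closed subsets gives a reversed chain of primes above `I`. It starts in
height at least h and stays strictly inside the ideal of the origin, whose height is at most the
number of variables. -/
theorem topologicalKrullDim_le_of_height [Infinite K] [Finite τ] {V : Set (ℙ K (τ → K))}
    (hV : IsClosed V) {I : Ideal (MvPolynomial τ K)} (hI : I ≤ vanishingIdeal K (affineCone V))
    {h d : ℕ} (hh : (h : ℕ∞) ≤ I.height) (hd : Nat.card τ ≤ h + d + 1) :
    topologicalKrullDim V ≤ d := by
  refine iSup_le fun p => ?_
  let Φ : Fin (p.length + 1) → Set (ℙ K (τ → K)) := fun i => closure (Subtype.val '' (p i : Set V))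
  have hΦirr : ∀ i, IsIrreducible (Φ i) := fun i =>
    ((p i).isIrreducible.image _ continuous_subtype_val.continuousOn).closure
  have hΦV : ∀ i, Φ i ⊆ V := fun i =>
    closure_minimal (by rintro _ ⟨x, _, rfl⟩; exact x.2) hV
  have hΦlt : ∀ i j, i < j → Φ i ⊂ Φ j := by
    intro i j hij
    have := TopologicalSpace.IrreducibleCloseds.map_strictMono_of_isInducing
      (IsInducing.subtypeVal (t := V)) (p.strictMono hij)
    exact this
  let J : Fin (p.length + 1) → Ideal (MvPolynomial τ K) := fun i =>
    vanishingIdeal K (affineCone (Φ i))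
  have hJ : ∀ i, (J i).IsPrime := fun i => isPrime_vanishingIdeal_affineCone (hΦirr i)
  have hdim : ∀ i, (J i).height + 1 ≤ (Nat.card τ : ℕ∞) := by
    intro i
    have hm : (RingHom.ker (eval (0 : τ → K))).IsPrime := RingHom.ker_isPrime _
    have h1 := Ideal.height_add_one_le_of_lt_of_isPrime
      (vanishingIdeal_affineCone_lt_origin (hΦirr i).nonempty)
    have h2 := Ideal.height_le_ringKrullDim_of_ne_top hm.ne_top
    rw [MvPolynomial.ringKrullDim_of_isNoetherianRing, ringKrullDim_eq_zero_of_field, zero_add] at h2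
    exact h1.trans (by exact_mod_cast h2)
  have hIJ : ∀ i, I ≤ J i := fun i =>
    hI.trans (vanishingIdeal_anti_mono fun v hv hv0 => hΦV i (hv hv0))
  have key : ∀ n (hn : n < p.length + 1),
      (h : ℕ∞) + n ≤ (J ⟨p.length - n, by omega⟩).height := by
    intro n
    induction n with
    | zero => intro hn; simpa using hh.trans (Ideal.height_mono (hIJ _))
    | succ n ih =>
      intro hn
      have h1 := Ideal.height_add_one_le_of_lt_of_isPrime
        (vanishingIdeal_affineCone_lt (hΦirr ⟨p.length - (n + 1), by omega⟩).nonempty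
          isClosed_closure (hΦlt ⟨p.length - (n + 1), by omega⟩ ⟨p.length - n, by omega⟩
            (by rw [Fin.lt_def]; simp; omega)))
      refine le_trans ?_ h1
      push_cast
      rw [← add_assoc]
      gcongr
      exact ih (by omega)
  have h3 := (add_le_add_left (key p.length (by omega)) 1).trans (hdim _)
  have h4 : h + p.length + 1 ≤ Nat.card τ := by exact_mod_cast h3
  have h5 : p.length ≤ d := by omega
  exact_mod_cast h5

theorem succ_le_topologicalKrullDim {X : Type*} [TopologicalSpace X] {W V : Set X}
    (hW : IsClosed W) (hV : IsIrreducible V) (h : W ⊂ V) {n : ℕ}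
    (hn : (n : WithBot ℕ∞) ≤ topologicalKrullDim W) :
    ((n + 1 : ℕ) : WithBot ℕ∞) ≤ topologicalKrullDim V := by
  obtain ⟨l, hl⟩ := Order.le_krullDim_iff.1 hn
  have hind : IsInducing (Set.inclusion h.1) := (IsEmbedding.inclusion h.1).isInducing
  have : IrreducibleSpace V := Subtype.irreducibleSpace hV
  let l' := l.map _ (TopologicalSpace.IrreducibleCloseds.map_strictMono_of_isInducing hind)
  let T : TopologicalSpace.IrreducibleCloseds V :=
    ⟨Set.univ, IrreducibleSpace.isIrreducible_univ V, isClosed_univ⟩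
  refine Order.le_krullDim_iff.2 ⟨l'.snoc T ?_, congrArg Nat.succ hl⟩
  obtain ⟨P, hPV, hPW⟩ := Set.exists_of_ssubset h
  have hsub : (l'.last : Set V) ⊆ Subtype.val ⁻¹' W := by
    refine closure_minimal ?_ (hW.preimage continuous_subtype_val)
    rintro _ ⟨x, _, rfl⟩
    exact x.2
  change (l'.last : Set V) < (Set.univ : Set V)
  refine lt_of_le_of_ne (Set.subset_univ _) fun he => ?_
  have : (⟨P, hPV⟩ : V) ∈ (l'.last : Set V) := by rw [he]; trivial
  exact hPW (hsub this)

theorem affineCone_projectiveZeroLocus {S : Set (MvPolynomial τ K)}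
    (hS : ∀ f ∈ S, ∃ n, n ≠ 0 ∧ f.IsHomogeneous n) :
    affineCone (projectiveZeroLocus S) = zeroLocus K (Ideal.span S) := by
  rw [zeroLocus_span]
  ext v
  constructor
  · intro hv f hf
    obtain ⟨n, hn, hfn⟩ := hS f hf
    rw [aeval_eq_eval]
    rcases eq_or_ne v 0 with rfl | hv0
    · have := hfn.eval_smul 0 (0 : τ → K)
      rwa [zero_smul, zero_pow hn, zero_mul] at this
    · exact (hfn.eval_rep_eq_zero_iff hv0).1 (hv hv0 f hf)
  · intro hv hv0 f hf
    obtain ⟨n, hn, hfn⟩ := hS f hf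
    rw [hfn.eval_rep_eq_zero_iff hv0, ← aeval_eq_eval]
    exact hv f hf

theorem vanishingIdeal_affineCone_projectiveZeroLocus [IsAlgClosed K] [Finite τ]
    {S : Set (MvPolynomial τ K)} (hS : ∀ f ∈ S, ∃ n, n ≠ 0 ∧ f.IsHomogeneous n)
    (hp : (Ideal.span S).IsPrime) :
    vanishingIdeal K (affineCone (projectiveZeroLocus S)) = Ideal.span S := by
  rw [affineCone_projectiveZeroLocus hS, IsPrime.vanishingIdeal_zeroLocus]

theorem isIrreducible_projectiveZeroLocus [IsAlgClosed K] [Finite τ]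
    {S : Set (MvPolynomial τ K)} (hS : ∀ f ∈ S, ∃ n, n ≠ 0 ∧ f.IsHomogeneous n)
    (hp : (Ideal.span S).IsPrime) (hne : (projectiveZeroLocus S).Nonempty) :
    IsIrreducible (projectiveZeroLocus S) := by
  refine isIrreducible_of_isPrime hne hp ?_ ?_
  · intro f n hf h
    rwa [← vanishingIdeal_affineCone_projectiveZeroLocus hS hp,
      mem_vanishingIdeal_affineCone hne hf]
  · intro f hf P hP
    rw [← vanishingIdeal_affineCone_projectiveZeroLocus hS hp] at hf
    have := hf P.rep fun hv => by rwa [Projectivization.mk_rep]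
    rwa [aeval_eq_eval] at this

theorem projectiveZeroLocus_inter (S T : Set (MvPolynomial τ K)) :
    projectiveZeroLocus S ∩ projectiveZeroLocus T = projectiveZeroLocus (S ∪ T) := by
  ext P
  simp only [projectiveZeroLocus, Set.mem_inter_iff, Set.mem_ofPred_eq, Set.mem_union]
  constructor
  · rintro ⟨h1, h2⟩ f (hf | hf)
    exacts [h1 f hf, h2 f hf]
  · exact fun h => ⟨fun f hf => h f (Or.inl hf), fun f hf => h f (Or.inr hf)⟩

end ProjectiveTopology

/-! ### The dimensions of the variety and of its hyperplane sections -/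

section Dimension

variable {K : Type*} [Field K] {σ c : Fin 4 → K} {ς k : K}

theorem isHomogeneous_quadraticForm (a b e : K) (i j : Fin 8) :
    (C a * X i ^ 2 + C b * X j ^ 2 - 2 * C e * X i * X j :
      MvPolynomial (Fin 8) K).IsHomogeneous 2 := by
  have hX : ∀ i, (X i ^ 2 : MvPolynomial (Fin 8) K).IsHomogeneous 2 := fun i =>
    isHomogeneous_X_pow i 2
  have h3 : (2 * C e * X i * X j : MvPolynomial (Fin 8) K) = C (2 * e) * (X i * X j) := by
    rw [C_mul, map_ofNat]; ring
  rw [h3]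
  exact ((IsHomogeneous.C_mul (hX i) a).add (IsHomogeneous.C_mul (hX j) b)).sub
    (IsHomogeneous.C_mul ((isHomogeneous_X K i).mul (isHomogeneous_X K j)) _)

theorem isHomogeneous_scaledQuadric (i : Fin 4) : (scaledQuadric σ c i).IsHomogeneous 2 := by
  have hX : ∀ i, (X i ^ 2 : MvPolynomial (Fin 8) K).IsHomogeneous 2 := fun i =>
    isHomogeneous_X_pow i 2
  fin_cases i
  · exact (hX 0).sub (isHomogeneous_quadraticForm _ _ _ _ _)
  · exact (hX 1).sub (isHomogeneous_quadraticForm _ _ _ _ _)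
  · exact (hX 2).sub (isHomogeneous_quadraticForm _ _ _ _ _)
  · exact IsHomogeneous.sub ((((isHomogeneous_X K 0).add (isHomogeneous_X K 1)).add
      (isHomogeneous_X K 2)).pow 2) (isHomogeneous_quadraticForm _ _ _ _ _)

theorem isHomogeneous_hyperplaneForm (k : K) : (hyperplaneForm k).IsHomogeneous 1 :=
  ((isHomogeneous_X K 6).sub (isHomogeneous_X K 5)).sub
    (IsHomogeneous.C_mul (isHomogeneous_X K 4) k)

theorem exists_isHomogeneous_range_scaledQuadric :
    ∀ f ∈ Set.range (scaledQuadric σ c), ∃ n, n ≠ 0 ∧ f.IsHomogeneous n := by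
  rintro _ ⟨i, rfl⟩
  exact ⟨2, two_ne_zero, isHomogeneous_scaledQuadric i⟩

theorem exists_isHomogeneous_insert_hyperplaneForm :
    ∀ f ∈ insert (hyperplaneForm k) (Set.range (scaledQuadric σ c)),
      ∃ n, n ≠ 0 ∧ f.IsHomogeneous n := by
  rintro _ (rfl | ⟨i, rfl⟩)
  · exact ⟨1, one_ne_zero, isHomogeneous_hyperplaneForm k⟩
  · exact ⟨2, two_ne_zero, isHomogeneous_scaledQuadric i⟩

variable (σ) in
/-- A point of the line `X₂ = σ₃ X₇`, `X₀ = X₁ = X₄ = X₅ = X₆ = 0`. -/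
def linePoint (x y : K) : Fin 8 → K := ![0, 0, σ 3 * y, x, 0, 0, 0, y]

variable (σ) in
/-- The linear forms that vanish on the line. -/
noncomputable def lineForms : Set (MvPolynomial (Fin 8) K) :=
  {X 0, X 1, X 2 - C (σ 3) * X 7, X 4, X 5, X 6}

theorem eq_linePoint {v : Fin 8 → K} (h : ∀ f ∈ lineForms σ, eval v f = 0) :
    v = linePoint σ (v 3) (v 7) := by
  simp only [lineForms, Set.mem_insert_iff, Set.mem_singleton_iff, forall_eq_or_imp, forall_eq,
    eval_X, map_sub, map_mul, eval_C] at h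
  obtain ⟨h0, h1, h2, h4, h5, h6⟩ := h
  funext i
  fin_cases i
  exacts [h0, h1, sub_eq_zero.1 h2, rfl, h4, h5, h6, rfl]

theorem eval_linePoint (x y : K) : ∀ f ∈ lineForms σ, eval (linePoint σ x y) f = 0 := by
  simp [lineForms, linePoint]

theorem exists_isHomogeneous_lineForms :
    ∀ f ∈ lineForms σ, ∃ n, n ≠ 0 ∧ f.IsHomogeneous n := by
  have hX := isHomogeneous_X (σ := Fin 8) K
  rintro f (rfl | rfl | rfl | rfl | rfl | rfl)
  · exact ⟨1, one_ne_zero, hX _⟩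
  · exact ⟨1, one_ne_zero, hX _⟩
  · exact ⟨1, one_ne_zero, (hX _).sub (IsHomogeneous.C_mul (hX _) _)⟩
  · exact ⟨1, one_ne_zero, hX _⟩
  · exact ⟨1, one_ne_zero, hX _⟩
  · exact ⟨1, one_ne_zero, hX _⟩

theorem mk_mem_projectiveZeroLocus {τ : Type*} {S : Set (MvPolynomial τ K)}
    (hS : ∀ f ∈ S, ∃ n, n ≠ 0 ∧ f.IsHomogeneous n) {v : τ → K} (hv : v ≠ 0) :
    Projectivization.mk K v hv ∈ projectiveZeroLocus S ↔ ∀ f ∈ S, eval v f = 0 := by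
  refine forall₂_congr fun f hf => ?_
  obtain ⟨n, -, hn⟩ := hS f hf
  exact hn.eval_rep_eq_zero_iff hv

theorem linePoint_ne_zero_left {x y : K} (h : x ≠ 0) : linePoint σ x y ≠ 0 :=
  fun h0 => h (congrFun h0 3)

theorem linePoint_ne_zero_right {x y : K} (h : y ≠ 0) : linePoint σ x y ≠ 0 :=
  fun h0 => h (congrFun h0 7)

theorem isIrreducible_line [Infinite K] : IsIrreducible (projectiveZeroLocus (lineForms σ)) := by
  have hne : (projectiveZeroLocus (lineForms σ)).Nonempty :=
    ⟨_, (mk_mem_projectiveZeroLocus exists_isHomogeneous_lineForms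
      (linePoint_ne_zero_left (x := 1) (y := 0) one_ne_zero)).2 (eval_linePoint _ _)⟩
  let π : MvPolynomial (Fin 8) K →+* MvPolynomial (Fin 2) K :=
    (aeval ![0, 0, C (σ 3) * X 1, X 0, 0, 0, 0, X 1] :
      MvPolynomial (Fin 8) K →ₐ[K] MvPolynomial (Fin 2) K).toRingHom
  have hπ : ∀ (f : MvPolynomial (Fin 8) K) (u : Fin 2 → K),
      eval u (π f) = eval (linePoint σ (u 0) (u 1)) f := by
    intro f u
    have : (eval u).comp π = eval (linePoint σ (u 0) (u 1)) := by
      apply MvPolynomial.ringHom_ext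
      · intro a
        simp [π, MvPolynomial.algebraMap_eq]
      · intro i
        fin_cases i <;> simp [π, linePoint]
    exact congrArg (fun g => g f) this
  refine isIrreducible_of_isPrime hne (RingHom.ker_isPrime π) ?_ ?_
  · intro f n hf h
    rw [RingHom.mem_ker]
    apply MvPolynomial.funext
    intro u
    rw [hπ, map_zero]
    have := (mem_vanishingIdeal_affineCone hne hf).2 h (linePoint σ (u 0) (u 1)) fun hv =>
      (mk_mem_projectiveZeroLocus exists_isHomogeneous_lineForms hv).2 (eval_linePoint _ _)
    rwa [aeval_eq_eval] at this
  · intro f hf P hP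
    have h1 := hπ f ![P.rep 3, P.rep 7]
    rw [RingHom.mem_ker.1 hf, map_zero] at h1
    rw [eq_linePoint hP]
    exact h1.symm

/-- The lower bounds on dimensions come from an explicit flag: a point, this line, the hyperplane
section, the variety. The line lies on every section, since there only w₂² = y₃² remains of the
equations. -/
theorem one_le_topologicalKrullDim_line [Infinite K] :
    ((1 : ℕ) : WithBot ℕ∞) ≤ topologicalKrullDim (projectiveZeroLocus (lineForms σ)) := by
  have hhom : ∀ f ∈ insert (X 7) (lineForms σ), ∃ n, n ≠ 0 ∧ f.IsHomogeneous n := by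
    rintro f (rfl | hf)
    · exact ⟨1, one_ne_zero, isHomogeneous_X _ _⟩
    · exact exists_isHomogeneous_lineForms f hf
  have hcl : IsClosed (projectiveZeroLocus (insert (X 7) (lineForms σ))) :=
    isClosed_projectiveZeroLocus fun f hf => (hhom f hf).imp fun n hn => hn.2
  refine succ_le_topologicalKrullDim (n := 0) hcl isIrreducible_line ⟨?_, ?_⟩ ?_
  · exact fun P hP f hf => hP f (Set.mem_insert_of_mem _ hf)
  · intro hle
    have h0 : linePoint σ 0 1 ≠ 0 := linePoint_ne_zero_right one_ne_zero
    have h1 := (mk_mem_projectiveZeroLocus hhom h0).1 (hle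
      ((mk_mem_projectiveZeroLocus exists_isHomogeneous_lineForms h0).2 (eval_linePoint _ _)))
      (X 7) (Set.mem_insert _ _)
    simp [linePoint] at h1
  · have h0 : linePoint σ 1 0 ≠ 0 := linePoint_ne_zero_left one_ne_zero
    have hm : Projectivization.mk K _ h0 ∈ projectiveZeroLocus (insert (X 7) (lineForms σ)) := by
      rw [mk_mem_projectiveZeroLocus hhom h0]
      rintro f (rfl | hf)
      · simp [linePoint]
      · exact eval_linePoint _ _ f hf
    have : Nonempty (projectiveZeroLocus (insert (X 7) (lineForms σ))) := ⟨⟨_, hm⟩⟩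
    have : Nonempty (TopologicalSpace.IrreducibleCloseds
        (projectiveZeroLocus (insert (X 7) (lineForms σ)))) :=
      ⟨⟨closure {⟨_, hm⟩}, isIrreducible_singleton.closure, isClosed_closure⟩⟩
    exact Order.krullDim_nonneg

theorem height_varietyIdeal [IsAlgClosed K] {t : K} (h : IsGenericCosines c ς t)
    (hσ : ∀ i, σ i ≠ 0) : ((4 : ℕ) : ℕ∞) ≤ (varietyIdeal σ c).height := by
  have h1 := isPrime_partialIdeal_one c hσ h.two_ne_zero h.sq_ne_one
  have h2 := isPrime_partialIdeal_two c hσ h.two_ne_zero h.sq_ne_one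
  have h3 := isPrime_partialIdeal_three c hσ h.two_ne_zero h.sq_ne_one
  have := h1.1
  have := h2.1
  have := h3.1
  have := isPrime_varietyIdeal h hσ
  have h0 : scaledQuadric σ c 0 ≠ 0 := by
    intro h0
    have := congrArg (eval ![1, 0, 0, 0, 0, 0, 0, 0]) h0
    simp [scaledQuadric] at this
  have e1 : (⊥ : Ideal (MvPolynomial (Fin 8) K)) < partialIdeal σ c 1 := by
    rw [bot_lt_iff_ne_bot]
    exact fun he => h0 (Ideal.span_singleton_eq_bot.1 he)
  have e2 : partialIdeal σ c 1 < partialIdeal σ c 2 := by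
    refine lt_of_le_of_ne le_sup_left fun he => h1.2 ?_
    rw [he]
    exact Ideal.mem_sup_right (Ideal.mem_span_singleton_self _)
  have e3 : partialIdeal σ c 2 < partialIdeal σ c 3 := by
    refine lt_of_le_of_ne le_sup_left fun he => h2.2 ?_
    rw [he]
    exact Ideal.mem_sup_right (Ideal.mem_span_singleton_self _)
  have e4 : partialIdeal σ c 3 < varietyIdeal σ c := by
    rw [varietyIdeal_eq]
    refine lt_of_le_of_ne le_sup_left fun he => h3.2 ?_
    rw [he]
    exact Ideal.mem_sup_right (Ideal.mem_span_singleton_self _)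
  have f1 := Ideal.height_add_one_le_of_lt_of_isPrime e1
  have f2 := Ideal.height_add_one_le_of_lt_of_isPrime e2
  have f3 := Ideal.height_add_one_le_of_lt_of_isPrime e3
  have f4 := Ideal.height_add_one_le_of_lt_of_isPrime e4
  calc ((4 : ℕ) : ℕ∞) = 0 + 1 + 1 + 1 + 1 := by norm_num
    _ ≤ (⊥ : Ideal (MvPolynomial (Fin 8) K)).height + 1 + 1 + 1 + 1 := by gcongr; exact zero_le
    _ ≤ (partialIdeal σ c 1).height + 1 + 1 + 1 := by gcongr
    _ ≤ (partialIdeal σ c 2).height + 1 + 1 := by gcongr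
    _ ≤ (partialIdeal σ c 3).height + 1 := by gcongr
    _ ≤ _ := f4

variable (σ) in
/-- A point of the variety outside of the hyperplanes. -/
def outerPoint : Fin 8 → K := ![1, -1, 0, 0, 0, (σ 1)⁻¹, 0, 0]

theorem eval_outerPoint (hσ : ∀ i, σ i ≠ 0) :
    ∀ f ∈ Set.range (scaledQuadric σ c), eval (outerPoint σ) f = 0 := by
  rintro _ ⟨i, rfl⟩
  fin_cases i <;> simp [scaledQuadric, outerPoint, hσ]

theorem eval_outerPoint_hyperplaneForm (hσ : ∀ i, σ i ≠ 0) :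
    eval (outerPoint σ) (hyperplaneForm k) ≠ 0 := by
  simp [hyperplaneForm, outerPoint, hσ]

theorem hyperplaneForm_notMem_varietyIdeal (hσ : ∀ i, σ i ≠ 0) :
    hyperplaneForm k ∉ varietyIdeal σ c := by
  intro hm
  have hle : varietyIdeal σ c ≤ RingHom.ker (eval (outerPoint σ)) :=
    Ideal.span_le.2 fun f hf => RingHom.mem_ker.2 (eval_outerPoint hσ f hf)
  exact eval_outerPoint_hyperplaneForm hσ (RingHom.mem_ker.1 (hle hm))

theorem height_sectionIdeal [IsAlgClosed K] (h : IsGenericCosines c ς (σ 2 / σ 1))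
    (hσ : ∀ i, σ i ≠ 0) (hk : IsGenericHyperplane c ς (σ 2 / σ 1) (k * (σ 2 / σ 0))) :
    ((5 : ℕ) : ℕ∞) ≤ (sectionIdeal σ c k).height := by
  have := isPrime_varietyIdeal h hσ
  have := isPrime_sectionIdeal h hσ hk
  have hlt : varietyIdeal σ c < sectionIdeal σ c k := by
    refine lt_of_le_of_ne (Ideal.span_mono (Set.subset_insert _ _)) fun he => ?_
    apply hyperplaneForm_notMem_varietyIdeal (c := c) (k := k) hσ
    rw [he]
    exact Ideal.subset_span (Set.mem_insert _ _)
  refine le_trans ?_ (Ideal.height_add_one_le_of_lt_of_isPrime hlt)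
  have := height_varietyIdeal h hσ
  calc ((5 : ℕ) : ℕ∞) = ((4 : ℕ) : ℕ∞) + 1 := by norm_num
    _ ≤ _ := by gcongr

/-- Both signs of s are needed: s = σ₃ gives the line itself, and s = -σ₃ gives points of the
section off the line. -/
theorem eval_linePoint_section :
    ∀ f ∈ insert (hyperplaneForm k) (Set.range (scaledQuadric σ c)),
      ∀ x y s : K, s ^ 2 = σ 3 ^ 2 → eval ![0, 0, s * y, x, 0, 0, 0, y] f = 0 := by
  rintro _ (rfl | ⟨i, rfl⟩) x y s hs
  · simp [hyperplaneForm]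
  · fin_cases i <;> simp [scaledQuadric, mul_pow, hs]

theorem isIrreducible_section [IsAlgClosed K] (h : IsGenericCosines c ς (σ 2 / σ 1))
    (hσ : ∀ i, σ i ≠ 0) (hk : IsGenericHyperplane c ς (σ 2 / σ 1) (k * (σ 2 / σ 0))) :
    IsIrreducible (projectiveZeroLocus
      (insert (hyperplaneForm k) (Set.range (scaledQuadric σ c)))) := by
  have h0 : linePoint σ 1 0 ≠ 0 := linePoint_ne_zero_left one_ne_zero
  refine isIrreducible_projectiveZeroLocus exists_isHomogeneous_insert_hyperplaneForm
    (isPrime_sectionIdeal h hσ hk) ⟨Projectivization.mk K _ h0, (mk_mem_projectiveZeroLocus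
      exists_isHomogeneous_insert_hyperplaneForm h0).2 ?_⟩
  exact fun f hf => eval_linePoint_section f hf 1 0 (σ 3) rfl

theorem isIrreducible_variety [IsAlgClosed K] (h : IsGenericCosines c ς (σ 2 / σ 1))
    (hσ : ∀ i, σ i ≠ 0) :
    IsIrreducible (projectiveZeroLocus (Set.range (scaledQuadric σ c))) := by
  have h0 : outerPoint σ ≠ 0 := fun h0 => one_ne_zero (α := K) (congrFun h0 0)
  exact isIrreducible_projectiveZeroLocus exists_isHomogeneous_range_scaledQuadric
    (isPrime_varietyIdeal h hσ) ⟨_, (mk_mem_projectiveZeroLocus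
      exists_isHomogeneous_range_scaledQuadric h0).2 (eval_outerPoint hσ)⟩

theorem topologicalKrullDim_section [IsAlgClosed K] (h : IsGenericCosines c ς (σ 2 / σ 1))
    (hσ : ∀ i, σ i ≠ 0) (hk : IsGenericHyperplane c ς (σ 2 / σ 1) (k * (σ 2 / σ 0))) :
    topologicalKrullDim (projectiveZeroLocus
      (insert (hyperplaneForm k) (Set.range (scaledQuadric σ c)))) = 2 := by
  have : Infinite K := IsAlgClosed.instInfinite
  have hhom := exists_isHomogeneous_insert_hyperplaneForm (σ := σ) (c := c) (k := k)
  apply le_antisymm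
  · refine topologicalKrullDim_le_of_height (isClosed_projectiveZeroLocus fun f hf =>
      (hhom f hf).imp fun n hn => hn.2) (I := sectionIdeal σ c k) ?_
      (height_sectionIdeal h hσ hk) (d := 2) (by simp)
    rw [vanishingIdeal_affineCone_projectiveZeroLocus hhom (isPrime_sectionIdeal h hσ hk)]
    exact le_rfl
  · refine succ_le_topologicalKrullDim (W := projectiveZeroLocus (lineForms σ))
      (isClosed_projectiveZeroLocus fun f hf =>
        (exists_isHomogeneous_lineForms f hf).imp fun n hn => hn.2)
      (isIrreducible_section h hσ hk) ⟨?_, ?_⟩ one_le_topologicalKrullDim_line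
    · intro P hP f hf
      rw [eq_linePoint hP]
      exact eval_linePoint_section f hf _ _ (σ 3) rfl
    · intro hle
      have h0 : (![0, 0, -σ 3 * 1, 0, 0, 0, 0, 1] : Fin 8 → K) ≠ 0 := fun h0 =>
        one_ne_zero (α := K) (congrFun h0 7)
      have h1 := (mk_mem_projectiveZeroLocus exists_isHomogeneous_lineForms h0).1 (hle
        ((mk_mem_projectiveZeroLocus hhom h0).2 fun f hf =>
          eval_linePoint_section f hf 0 1 (-σ 3) (by ring)))
      have h2 := congrFun (eq_linePoint h1) 2
      simp [linePoint] at h2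
      have h3 : 2 * σ 3 = 0 := by linear_combination -h2
      exact (mul_ne_zero h.two_ne_zero (hσ 3)) h3

theorem topologicalKrullDim_variety [IsAlgClosed K] (h : IsGenericCosines c ς (σ 2 / σ 1))
    (hσ : ∀ i, σ i ≠ 0) :
    topologicalKrullDim (projectiveZeroLocus (Set.range (scaledQuadric σ c))) = 3 := by
  have : Infinite K := IsAlgClosed.instInfinite
  have hhom := exists_isHomogeneous_range_scaledQuadric (σ := σ) (c := c)
  apply le_antisymm
  · refine topologicalKrullDim_le_of_height (isClosed_projectiveZeroLocus fun f hf =>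
      (hhom f hf).imp fun n hn => hn.2) (I := varietyIdeal σ c) ?_
      (height_varietyIdeal h hσ) (d := 3) (by simp)
    rw [vanishingIdeal_affineCone_projectiveZeroLocus hhom (isPrime_varietyIdeal h hσ)]
    exact le_rfl
  · obtain ⟨k', hk'⟩ := h.exists_isGenericHyperplane
    obtain ⟨k, rfl⟩ : ∃ k, k' = k * (σ 2 / σ 0) :=
      ⟨k' / (σ 2 / σ 0), (div_mul_cancel₀ _ (div_ne_zero (hσ 2) (hσ 0))).symm⟩
    have hhom' := exists_isHomogeneous_insert_hyperplaneForm (σ := σ) (c := c) (k := k)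
    refine succ_le_topologicalKrullDim (isClosed_projectiveZeroLocus fun f hf =>
        (hhom' f hf).imp fun n hn => hn.2)
      (isIrreducible_variety h hσ) ⟨?_, ?_⟩ (topologicalKrullDim_section h hσ hk').ge
    · exact fun P hP f hf => hP f (Set.mem_insert_of_mem _ hf)
    · intro hle
      have h0 : outerPoint σ ≠ 0 := fun h0 => one_ne_zero (α := K) (congrFun h0 0)
      exact eval_outerPoint_hyperplaneForm hσ ((mk_mem_projectiveZeroLocus hhom' h0).1 (hle
        ((mk_mem_projectiveZeroLocus hhom h0).2 (eval_outerPoint hσ))) _ (Set.mem_insert _ _))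

end Dimension

/-! ### Hilbert functions -/

section Hilbert

variable {K : Type*} [Field K] {τ : Type*}

theorem finrank_homogeneousSubmodule [Fintype τ] (n : ℕ) :
    Module.finrank K (homogeneousSubmodule τ K n) = (Fintype.card τ + n - 1).choose n := by
  classical
  have hs : {d : τ →₀ ℕ | d.degree = n} = ↑((Finset.univ : Finset τ).finsuppAntidiag n) := by
    ext d
    simp [Finsupp.degree_eq_sum]
  rw [homogeneousSubmodule_eq_finsupp_supported, hs,
    (AddMonoidAlgebra.supportedEquivFinsupp _).finrank_eq, Module.finrank_finsupp_self,
    ← Nat.card_eq_fintype_card, Nat.card_coe_set_eq, Set.ncard_coe_finset,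
    Finset.card_finsuppAntidiag_nat_eq_choose, Finset.card_univ]

instance [Finite τ] (n : ℕ) : FiniteDimensional K (homogeneousSubmodule τ K n) :=
  Module.Finite.iff_fg.2 (homogeneousSubmodule_fg τ K n)

theorem Submodule.finrank_map_of_injective {E : Type*} [AddCommGroup E] [Module K E] {E' : Type*}
    [AddCommGroup E'] [Module K E'] {f : E →ₗ[K] E'} (hf : Function.Injective f)
    (p : Submodule K E) : Module.finrank K (p.map f) = Module.finrank K p :=
  (Submodule.equivMapOfInjective f hf p).finrank_eq.symm

/-- The part of degree `n` of an ideal. -/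
noncomputable def idealPart (I : Ideal (MvPolynomial τ K)) (n : ℕ) :
    Submodule K (MvPolynomial τ K) :=
  I.restrictScalars K ⊓ homogeneousSubmodule τ K n

/-- The dimension of the part of degree `n` of the quotient by an ideal. -/
noncomputable def idealHilbert (I : Ideal (MvPolynomial τ K)) (n : ℕ) : ℕ :=
  Module.finrank K ((homogeneousSubmodule τ K n).map (Ideal.Quotient.mkₐ K I).toLinearMap)

theorem mem_idealPart {I : Ideal (MvPolynomial τ K)} {n : ℕ} {f : MvPolynomial τ K} :
    f ∈ idealPart I n ↔ f ∈ I ∧ f.IsHomogeneous n := Iff.rfl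

theorem homogeneousComponent_mul_of_isHomogeneous {f : MvPolynomial τ K} {d : ℕ}
    (hf : f.IsHomogeneous d) (g : MvPolynomial τ K) (n : ℕ) :
    homogeneousComponent (n + d) (f * g) = f * homogeneousComponent n g := by
  conv_lhs => rw [← sum_homogeneousComponent g, Finset.mul_sum, map_sum]
  have : ∀ j, homogeneousComponent (n + d) (f * homogeneousComponent j g) =
      if j = n then f * homogeneousComponent j g else 0 := by
    intro j
    have hj : f * homogeneousComponent j g ∈ homogeneousSubmodule τ K (j + d) := by
      rw [mul_comm]
      exact (homogeneousComponent_isHomogeneous j g).mul hf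
    rw [homogeneousComponent_of_mem hj]
    simp [eq_comm]
  simp only [this, Finset.sum_ite_eq', Finset.mem_range]
  split_ifs with h
  · rfl
  · rw [homogeneousComponent_eq_zero _ _ (by omega), mul_zero]

theorem homogeneousComponent_mem_sup {I : Ideal (MvPolynomial τ K)}
    (hI : ∀ f ∈ I, ∀ n, homogeneousComponent n f ∈ I) {f : MvPolynomial τ K} {d : ℕ}
    (hf : f.IsHomogeneous d) :
    ∀ g ∈ I ⊔ Ideal.span {f}, ∀ n, homogeneousComponent n g ∈ I ⊔ Ideal.span {f} := by
  intro g hg n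
  obtain ⟨a, ha, b, hb, rfl⟩ := Submodule.mem_sup.1 hg
  obtain ⟨h, rfl⟩ := Ideal.mem_span_singleton.1 hb
  rw [map_add]
  refine add_mem (Ideal.mem_sup_left (hI a ha n)) ?_
  rcases le_or_gt d n with hdn | hdn
  · obtain ⟨m, rfl⟩ := Nat.exists_eq_add_of_le' hdn
    rw [homogeneousComponent_mul_of_isHomogeneous hf]
    exact Ideal.mem_sup_right (Ideal.mul_mem_right _ _ (Ideal.mem_span_singleton_self f))
  · have h0 : homogeneousComponent n (f * h) = 0 := ?_
    · rw [h0]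
      exact zero_mem _
    rw [← sum_homogeneousComponent h, Finset.mul_sum, map_sum]
    refine Finset.sum_eq_zero fun j _ => ?_
    have hj : f * homogeneousComponent j h ∈ homogeneousSubmodule τ K (d + j) :=
      hf.mul (homogeneousComponent_isHomogeneous j h)
    rw [homogeneousComponent_of_mem hj, if_neg (by omega)]

variable [Finite τ]

instance (I : Ideal (MvPolynomial τ K)) (n : ℕ) : FiniteDimensional K (idealPart I n) :=
  Submodule.finiteDimensional_of_le (inf_le_right : _ ≤ homogeneousSubmodule τ K n)

theorem idealHilbert_add_finrank (I : Ideal (MvPolynomial τ K)) (n : ℕ) :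
    idealHilbert I n + Module.finrank K (idealPart I n) =
      Module.finrank K (homogeneousSubmodule τ K n) := by
  let g := (Ideal.Quotient.mkₐ K I).toLinearMap.domRestrict (homogeneousSubmodule τ K n)
  have hr : LinearMap.range g =
      (homogeneousSubmodule τ K n).map (Ideal.Quotient.mkₐ K I).toLinearMap :=
    LinearMap.range_domRestrict _ _
  have hk : (LinearMap.ker g).map (homogeneousSubmodule τ K n).subtype = idealPart I n := by
    ext f
    simp only [Submodule.mem_map, LinearMap.mem_ker, mem_idealPart]
    constructor
    · rintro ⟨x, hx, rfl⟩
      exact ⟨Ideal.Quotient.eq_zero_iff_mem.1 hx, x.2⟩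
    · rintro ⟨hf, hfn⟩
      exact ⟨⟨f, hfn⟩, Ideal.Quotient.eq_zero_iff_mem.2 hf, rfl⟩
  rw [← g.finrank_range_add_finrank_ker, hr, ← hk,
    Submodule.finrank_map_of_injective (Submodule.subtype_injective _)]
  rfl

/-- In degree n + d the enlarged ideal is I + f S, with f S isomorphic to the forms of degree n; the
intersection with I is f I because f is a nonzerodivisor modulo the prime I. -/
theorem finrank_idealPart_sup {I : Ideal (MvPolynomial τ K)} [I.IsPrime]
    (hI : ∀ f ∈ I, ∀ n, homogeneousComponent n f ∈ I) {f : MvPolynomial τ K} {d : ℕ}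
    (hf : f.IsHomogeneous d) (hfI : f ∉ I) (n : ℕ) :
    Module.finrank K (idealPart (I ⊔ Ideal.span {f}) (n + d)) +
      Module.finrank K (idealPart I n) =
    Module.finrank K (idealPart I (n + d)) +
      Module.finrank K (homogeneousSubmodule τ K n) := by
  have hf0 : f ≠ 0 := fun h => hfI (h ▸ I.zero_mem)
  have hinj : Function.Injective (LinearMap.mulLeft K f) := fun x y hxy =>
    mul_left_cancel₀ hf0 hxy
  have h1 : idealPart I (n + d) ⊔ (homogeneousSubmodule τ K n).map (LinearMap.mulLeft K f) =
      idealPart (I ⊔ Ideal.span {f}) (n + d) := by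
    apply le_antisymm
    · refine sup_le (fun g hg => ⟨Ideal.mem_sup_left hg.1, hg.2⟩) ?_
      rintro _ ⟨g, hg, rfl⟩
      refine ⟨Ideal.mem_sup_right (Ideal.mul_mem_right _ _ (Ideal.mem_span_singleton_self f)), ?_⟩
      rw [LinearMap.mulLeft_apply, add_comm]
      exact hf.mul hg
    · rintro g ⟨hg, hgn⟩
      obtain ⟨a, ha, b, hb, rfl⟩ := Submodule.mem_sup.1 hg
      obtain ⟨h, rfl⟩ := Ideal.mem_span_singleton.1 hb
      rw [← homogeneousComponent_eq_self hgn, map_add,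
        homogeneousComponent_mul_of_isHomogeneous hf]
      exact Submodule.add_mem_sup ⟨hI a ha _, homogeneousComponent_isHomogeneous _ _⟩
        ⟨_, homogeneousComponent_isHomogeneous _ _, rfl⟩
  have h2 : idealPart I (n + d) ⊓ (homogeneousSubmodule τ K n).map (LinearMap.mulLeft K f) =
      (idealPart I n).map (LinearMap.mulLeft K f) := by
    apply le_antisymm
    · rintro _ ⟨hg, ⟨g, hgn, rfl⟩⟩
      exact ⟨g, ⟨(Ideal.IsPrime.mem_or_mem ‹_› hg.1).resolve_left hfI, hgn⟩, rfl⟩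
    · rintro _ ⟨g, hg, rfl⟩
      refine ⟨⟨I.mul_mem_left _ hg.1, ?_⟩, ⟨g, hg.2, rfl⟩⟩
      rw [LinearMap.mulLeft_apply, add_comm]
      exact hf.mul hg.2
  have := Submodule.finrank_sup_add_finrank_inf_eq (idealPart I (n + d))
    ((homogeneousSubmodule τ K n).map (LinearMap.mulLeft K f))
  rwa [h1, h2, Submodule.finrank_map_of_injective hinj,
    Submodule.finrank_map_of_injective hinj] at this

theorem idealHilbert_sup {I : Ideal (MvPolynomial τ K)} [I.IsPrime]
    (hI : ∀ f ∈ I, ∀ n, homogeneousComponent n f ∈ I) {f : MvPolynomial τ K} {d : ℕ}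
    (hf : f.IsHomogeneous d) (hfI : f ∉ I) (n : ℕ) :
    idealHilbert (I ⊔ Ideal.span {f}) (n + d) + idealHilbert I n = idealHilbert I (n + d) := by
  have h1 := finrank_idealPart_sup hI hf hfI n
  have h2 := idealHilbert_add_finrank I n
  have h3 := idealHilbert_add_finrank I (n + d)
  have h4 := idealHilbert_add_finrank (I ⊔ Ideal.span {f}) (n + d)
  omega

theorem idealHilbert_bot (n : ℕ) :
    idealHilbert (⊥ : Ideal (MvPolynomial τ K)) n =
      Module.finrank K (homogeneousSubmodule τ K n) := by
  rw [← idealHilbert_add_finrank ⊥ n]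
  have : idealPart (⊥ : Ideal (MvPolynomial τ K)) n = ⊥ := by
    rw [eq_bot_iff]
    exact fun f hf => hf.1
  rw [this, finrank_bot, add_zero]

theorem cast_finrank_homogeneousSubmodule_fin_eight (n : ℕ) :
    (5040 : ℝ) * (Module.finrank K (homogeneousSubmodule (Fin 8) K n) : ℝ) =
      (n + 1) * (n + 2) * (n + 3) * (n + 4) * (n + 5) * (n + 6) * (n + 7) := by
  rw [finrank_homogeneousSubmodule, Fintype.card_fin,
    show 8 + n - 1 = n + 7 by omega, Nat.choose_symm_add]
  have := Nat.ascFactorial_eq_factorial_mul_choose n 7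
  have h2 : ((n + 1).ascFactorial 7 : ℝ) = 5040 * ((n + 7).choose 7 : ℝ) := by
    rw [this]
    norm_num [Nat.factorial]
  rw [← h2]
  simp [Nat.ascFactorial]
  ring

variable {σ c : Fin 4 → K} {ς t : K}

/-- Each quadric replaces the Hilbert function H(n) by H(n) - H(n - 2), so the result is the fourth
difference, with step 2, of the binomial coefficient (n + 7 choose 7). The shift by 8 keeps all
degrees that occur nonnegative. -/
theorem idealHilbert_varietyIdeal (hσ : ∀ i, σ i ≠ 0) (h2 : (2 : K) ≠ 0) (hc : ∀ i, c i ^ 2 ≠ 1)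
    (n : ℕ) : (6 : ℝ) * idealHilbert (varietyIdeal σ c) (n + 8) =
      16 * (n + 8 : ℝ) ^ 3 + 32 * (n + 8 : ℝ) := by
  obtain ⟨p1, n1⟩ := isPrime_partialIdeal_one c hσ h2 hc
  obtain ⟨p2, n2⟩ := isPrime_partialIdeal_two c hσ h2 hc
  obtain ⟨p3, n3⟩ := isPrime_partialIdeal_three c hσ h2 hc
  have hhom := isHomogeneous_scaledQuadric (σ := σ) (c := c)
  have n0 : scaledQuadric σ c 0 ∉ (⊥ : Ideal (MvPolynomial (Fin 8) K)) := by
    intro h0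
    have := congrArg (eval ![1, 0, 0, 0, 0, 0, 0, 0]) (Ideal.mem_bot.1 h0)
    simp [scaledQuadric] at this
  have c0 : ∀ f ∈ (⊥ : Ideal (MvPolynomial (Fin 8) K)), ∀ n,
      homogeneousComponent n f ∈ (⊥ : Ideal (MvPolynomial (Fin 8) K)) := by
    intro f hf n
    rw [Ideal.mem_bot.1 hf, map_zero]
    exact zero_mem _
  have e1 : partialIdeal σ c 1 = ⊥ ⊔ Ideal.span {scaledQuadric σ c 0} :=
    (bot_sup_eq _).symm
  have c1 := homogeneousComponent_mem_sup c0 (hhom 0)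
  have s1 := idealHilbert_sup c0 (hhom 0) n0
  rw [← e1] at c1 s1
  have e2 : partialIdeal σ c 2 = partialIdeal σ c 1 ⊔ Ideal.span {scaledQuadric σ c 1} := rfl
  have c2 := homogeneousComponent_mem_sup c1 (hhom 1)
  have s2 := idealHilbert_sup c1 (hhom 1) n1
  rw [← e2] at c2 s2
  have e3 : partialIdeal σ c 3 = partialIdeal σ c 2 ⊔ Ideal.span {scaledQuadric σ c 2} := rfl
  have c3 := homogeneousComponent_mem_sup c2 (hhom 2)
  have s3 := idealHilbert_sup c2 (hhom 2) n2
  rw [← e3] at c3 s3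
  have s4 := idealHilbert_sup c3 (hhom 3) n3
  rw [← varietyIdeal_eq] at s4
  have r0 : ∀ m, (5040 : ℝ) * idealHilbert (⊥ : Ideal (MvPolynomial (Fin 8) K)) m =
      (m + 1) * (m + 2) * (m + 3) * (m + 4) * (m + 5) * (m + 6) * (m + 7) := by
    intro m
    rw [idealHilbert_bot, cast_finrank_homogeneousSubmodule_fin_eight]
  have t : ∀ I J : Ideal (MvPolynomial (Fin 8) K),
      (∀ m, idealHilbert J (m + 2) + idealHilbert I m = idealHilbert I (m + 2)) →
      ∀ m, (idealHilbert J (m + 2) : ℝ) = idealHilbert I (m + 2) - idealHilbert I m := by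
    intro I J h m
    rw [eq_sub_iff_add_eq]
    exact_mod_cast h m
  have t1 := t _ _ s1
  have t2 := t _ _ s2
  have t3 := t _ _ s3
  have t4 := t _ _ s4
  clear t s1 s2 s3 s4
  have a0 := r0 n
  have a2 := r0 (n + 2)
  have a4 := r0 (n + 4)
  have a6 := r0 (n + 6)
  have a8 := r0 (n + 8)
  push_cast at a0 a2 a4 a6 a8
  rw [t4 (n + 6), t3 (n + 6), t3 (n + 4), t2 (n + 6), t2 (n + 4), t2 (n + 2), t1 (n + 6),
    t1 (n + 4), t1 (n + 2), t1 n]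
  -- The factor 1/840 is 6/7!.
  linear_combination (1 / 840) * (a8 - 4 * a6 + 6 * a4 - 4 * a2 + a0)

theorem tendsto_idealHilbert_varietyIdeal (hσ : ∀ i, σ i ≠ 0) (h2 : (2 : K) ≠ 0)
    (hc : ∀ i, c i ^ 2 ≠ 1) :
    Tendsto (fun n : ℕ => ((3)! : ℝ) * (idealHilbert (varietyIdeal σ c) n : ℝ) / (n : ℝ) ^ 3)
      atTop (𝓝 ((16 : ℕ) : ℝ)) := by
  have hlim : Tendsto (fun n : ℕ => 16 + 32 / ((n : ℝ) ^ 2)) atTop (𝓝 ((16 : ℕ) : ℝ)) := by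
    have := (tendsto_const_nhds (x := (32 : ℝ))).div_atTop
      ((tendsto_pow_atTop (α := ℝ) two_ne_zero).comp tendsto_natCast_atTop_atTop)
    simpa using this.const_add 16
  refine hlim.congr' ?_
  filter_upwards [eventually_ge_atTop 8] with n hn
  obtain ⟨m, rfl⟩ := Nat.exists_eq_add_of_le' hn
  have h := idealHilbert_varietyIdeal (c := c) hσ h2 hc m
  have h3 : (((3)! : ℕ) : ℝ) = 6 := by norm_num [Nat.factorial]
  have hpos : (m : ℝ) + 8 ≠ 0 := by positivity
  rw [h3, h]
  push_cast
  field_simp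

theorem hasDegree_variety [IsAlgClosed K] (h : IsGenericCosines c ς (σ 2 / σ 1))
    (hσ : ∀ i, σ i ≠ 0) :
    HasDegree (projectiveZeroLocus (Set.range (scaledQuadric σ c))) 16 := by
  refine ⟨3, by simpa using topologicalKrullDim_variety h hσ, ?_⟩
  have he : ∀ n, hilbertFunction (projectiveZeroLocus (Set.range (scaledQuadric σ c))) n =
      idealHilbert (varietyIdeal σ c) n := by
    intro n
    exact congrArg (fun I => idealHilbert I n) (vanishingIdeal_affineCone_projectiveZeroLocus
      exists_isHomogeneous_range_scaledQuadric (isPrime_varietyIdeal h hσ))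
  simp only [he]
  exact tendsto_idealHilbert_varietyIdeal hσ h.two_ne_zero h.sq_ne_one

end Hilbert

/-! ### The choice of the non-square -/

section Choice

variable {F : Type*} [Field F]

theorem ringChar_ne_two_of_card {q : ℕ} (hq_odd : Odd q) (hF : Nat.card F = q ^ 4) :
    ringChar F ≠ 2 := by
  have : Finite F := Nat.finite_of_card_ne_zero (by
    rw [hF]
    exact pow_ne_zero _ hq_odd.pos.ne')
  have := Fintype.ofFinite F
  intro h
  have h2 := FiniteField.even_card_iff_char_two.1 h
  rw [← Nat.card_eq_fintype_card, hF, ← Nat.even_iff] at h2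
  exact (Nat.not_even_iff_odd.2 (hq_odd.pow (n := 4))) h2

/-- A polynomial of small degree has a non-root among the non-squares. -/
theorem exists_not_isSquare_eval_ne_zero [Fintype F] (hF : ringChar F ≠ 2) {P : Polynomial F}
    (hP : P ≠ 0) (hdeg : P.natDegree + 1 + Fintype.card F / 2 < Fintype.card F) :
    ∃ η : F, ¬ IsSquare η ∧ P.eval η ≠ 0 := by
  by_contra! hcon
  have hpos : 0 < Fintype.card F / 2 := by
    have := Fintype.one_lt_card (α := F)
    omega
  have h0 : (Polynomial.X ^ (Fintype.card F / 2) - 1 : Polynomial F) ≠ 0 :=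
    Polynomial.X_pow_sub_C_ne_zero hpos 1
  -- The first two factors vanish at 0 and, by Euler's criterion, at all nonzero squares. If P
  -- vanished at all non-squares, the product would have more roots than its degree allows.
  have hne : Polynomial.X * (Polynomial.X ^ (Fintype.card F / 2) - 1) * P ≠ 0 :=
    mul_ne_zero (mul_ne_zero Polynomial.X_ne_zero h0) hP
  apply hne
  refine Polynomial.eq_zero_of_natDegree_lt_card_of_eval_eq_zero _ Function.injective_id ?_ ?_
  · intro η
    rcases eq_or_ne η 0 with rfl | hη
    · simp
    by_cases hs : IsSquare η
    · rw [FiniteField.isSquare_iff hF hη] at hs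
      simp [hs]
    · simp [hcon η hs]
  · refine lt_of_le_of_lt (Polynomial.natDegree_mul_le.trans
      (add_le_add_left Polynomial.natDegree_mul_le _)) ?_
    have h1 : (Polynomial.X ^ (Fintype.card F / 2) - 1 : Polynomial F).natDegree =
      Fintype.card F / 2 := Polynomial.natDegree_X_pow_sub_C
    rw [h1, Polynomial.natDegree_X]
    omega

/-- The power of η is t = σ₂/σ₁ = η^N with N = q(q - 1)/2, and b will be β^q = c₁. The excluded
values are roots of a polynomial of degree at most 3N, which is less than the number (q⁴ - 1)/2 of
non-squares. -/
theorem exists_generic_nonsquare {q : ℕ} (hq : 1 < q) (hq_odd : Odd q)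
    (hF : Nat.card F = q ^ 4) (b : F) :
    ∃ η : F, ¬ IsSquare η ∧ b * η ^ (q * (q / 2)) ≠ 1 ∧
      (η ^ (q * (q / 2))) ^ 2 - 2 * b * η ^ (q * (q / 2)) + 1 ≠ 0 := by
  have : Finite F := Nat.finite_of_card_ne_zero (by
    rw [hF]
    exact pow_ne_zero _ hq_odd.pos.ne')
  have := Fintype.ofFinite F
  have hchar := ringChar_ne_two_of_card hq_odd hF
  obtain ⟨r, rfl⟩ := hq_odd
  have hr : 1 ≤ r := by omega
  set N := (2 * r + 1) * ((2 * r + 1) / 2) with hN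
  have hN' : N = (2 * r + 1) * r := by rw [hN]; congr 1; omega
  have hN0 : N ≠ 0 := by rw [hN']; positivity
  let P1 : Polynomial F := Polynomial.C b * Polynomial.X ^ N - 1
  let P2 : Polynomial F := (Polynomial.X ^ N) ^ 2 - Polynomial.C (2 * b) * Polynomial.X ^ N + 1
  have hP1 : P1 ≠ 0 := by
    intro h
    have := congrArg (Polynomial.eval 0) h
    simp [P1, hN0] at this
  have hP2 : P2 ≠ 0 := by
    intro h
    have := congrArg (Polynomial.eval 0) h
    simp [P2, hN0] at this
  have d1 : P1.natDegree ≤ N := by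
    simp only [P1]
    compute_degree
  have d2 : P2.natDegree ≤ 2 * N := by
    simp only [P2, ← pow_mul, mul_comm N 2]
    compute_degree
    omega
  obtain ⟨η, hη, hev⟩ := exists_not_isSquare_eval_ne_zero hchar (mul_ne_zero hP1 hP2) (by
    refine lt_of_le_of_lt (b := N + 2 * N + 1 + Fintype.card F / 2) ?_ ?_
    · have := (Polynomial.natDegree_mul_le (p := P1) (q := P2))
      omega
    · rw [← Nat.card_eq_fintype_card, hF, hN']
      have h1 : (2 * r + 1) ^ 4 = 2 * (8 * r ^ 4 + 16 * r ^ 3 + 12 * r ^ 2 + 4 * r) + 1 := by ring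
      have h2 : r * 1 ≤ r * r := Nat.mul_le_mul_left _ hr
      have h3 : r * r * 1 ≤ r * r * r := Nat.mul_le_mul_left _ hr
      have h4 : (2 * r + 1) * r = 2 * (r * r) + r := by ring
      have h5 : 8 * r ^ 4 + 16 * r ^ 3 + 12 * r ^ 2 + 4 * r =
        8 * r ^ 4 + 16 * (r * r * r) + 12 * (r * r) + 4 * r := by ring
      rw [h1, h4, h5]
      omega)
  rw [Polynomial.eval_mul, mul_ne_zero_iff] at hev
  refine ⟨η, hη, fun h => hev.1 ?_, fun h => hev.2 ?_⟩
  · simp [P1, h]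
  · simpa [P2] using h

end Choice

/-! ### From the Frobenius conjugates to generic cosines. -/

section Matching

variable {F : Type*} [Field F] {K : Type*} [Field K] [Algebra F K]

/-- The conjugates of a square root of `η`. -/
def sqrtConj (q : ℕ) (s : K) : Fin 4 → K := fun i => s ^ q ^ (i : ℕ)

/-- The conjugates of `β`, with a sign. -/
def signedConj (K : Type*) [Field K] [Algebra F K] (q : ℕ) (β : F) : Fin 4 → K :=
  ![algebraMap F K β, algebraMap F K (β ^ q), algebraMap F K (β ^ q ^ 2),
    -algebraMap F K (β ^ q ^ 3)]

/-- Since η^((q+1)/2) = s s^q, the mixed coefficients are conjugates of β times products of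
consecutive σᵢ. In the last one σ₃ is followed by s^(q⁴) = -σ₀, and the sign is moved into c₃. -/
theorem quadrics_eq_range_scaledQuadric {q : ℕ} (hq : Odd q) (β : F) {η : F} {s : K}
    (hs : s ^ 2 = algebraMap F K η) (hs4 : s ^ q ^ 4 = -s) :
    quadrics K q β η = Set.range (scaledQuadric (sqrtConj q s) (signedConj K q β)) := by
  obtain ⟨r, rfl⟩ := hq
  have hr : (2 * r + 1 + 1) / 2 = r + 1 := by omega
  have h1 : ∀ i : Fin 4, frobConst K (2 * r + 1) i η = C (sqrtConj (2 * r + 1) s i ^ 2) := by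
    intro i
    rw [frobConst, sqrtConj, map_pow, ← hs, ← pow_mul, ← pow_mul, mul_comm]
  have hη : algebraMap F K (η ^ (r + 1)) = s * s ^ (2 * r + 1) := by
    rw [map_pow, ← hs]; ring
  have h2 : ∀ i : ℕ, frobConst K (2 * r + 1) i (β * η ^ ((2 * r + 1 + 1) / 2)) =
      C (algebraMap F K (β ^ (2 * r + 1) ^ i) *
        (s ^ (2 * r + 1) ^ i * s ^ (2 * r + 1) ^ (i + 1))) := by
    intro i
    rw [frobConst, hr, mul_pow, map_mul, map_pow _ (η ^ (r + 1)), hη]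
    congr 2
    rw [mul_pow, ← pow_mul s, pow_succ' (2 * r + 1) i]
  have h20 := h2 0
  have h21 := h2 1
  have h22 := h2 2
  have h23 := h2 3
  rw [hs4] at h23
  have h10 := h1 0
  have h11 := h1 1
  have h12 := h1 2
  have h13 := h1 3
  simp only [Fin.val_zero, Fin.val_one, Fin.val_two] at h10 h11 h12
  change frobConst K (2 * r + 1) 3 η = _ at h13
  rw [quadrics, Set.range_fin_four, h10, h11, h12, h13, h20, h21, h22, h23]
  have e3 : scaledQuadric (sqrtConj (2 * r + 1) s) (signedConj K (2 * r + 1) β) 3 =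
      (X 0 + X 1 + X 2) ^ 2 - (C (sqrtConj (2 * r + 1) s 3 ^ 2) * X 7 ^ 2 +
      C (sqrtConj (2 * r + 1) s 0 ^ 2) * X 4 ^ 2 - 2 * C (algebraMap F K (β ^ (2 * r + 1) ^ 3) *
        (s ^ (2 * r + 1) ^ 3 * -s)) * X 7 * X 4) := by
    have : algebraMap F K (β ^ (2 * r + 1) ^ 3) * (s ^ (2 * r + 1) ^ 3 * -s) =
        signedConj K (2 * r + 1) β 3 * (sqrtConj (2 * r + 1) s 3 * sqrtConj (2 * r + 1) s 0) := by
      simp [signedConj, sqrtConj]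
    rw [this]
    rfl
  have e0 : scaledQuadric (sqrtConj (2 * r + 1) s) (signedConj K (2 * r + 1) β) 0 =
      X 0 ^ 2 - (C (sqrtConj (2 * r + 1) s 0 ^ 2) * X 4 ^ 2 +
      C (sqrtConj (2 * r + 1) s 1 ^ 2) * X 5 ^ 2 - 2 * C (algebraMap F K (β ^ (2 * r + 1) ^ 0) *
        (s ^ (2 * r + 1) ^ 0 * s ^ (2 * r + 1) ^ (0 + 1))) * X 4 * X 5) := by
    rw [pow_zero, pow_one]
    rfl
  have e1 : scaledQuadric (sqrtConj (2 * r + 1) s) (signedConj K (2 * r + 1) β) 1 =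
      X 1 ^ 2 - (C (sqrtConj (2 * r + 1) s 1 ^ 2) * X 5 ^ 2 +
      C (sqrtConj (2 * r + 1) s 2 ^ 2) * X 6 ^ 2 - 2 * C (algebraMap F K (β ^ (2 * r + 1) ^ 1) *
        (s ^ (2 * r + 1) ^ 1 * s ^ (2 * r + 1) ^ (1 + 1))) * X 5 * X 6) := by
    rw [show β ^ (2 * r + 1) ^ 1 = β ^ (2 * r + 1) by rw [pow_one]]
    rfl
  have e2 : scaledQuadric (sqrtConj (2 * r + 1) s) (signedConj K (2 * r + 1) β) 2 =
      X 2 ^ 2 - (C (sqrtConj (2 * r + 1) s 2 ^ 2) * X 6 ^ 2 +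
      C (sqrtConj (2 * r + 1) s 3 ^ 2) * X 7 ^ 2 - 2 * C (algebraMap F K (β ^ (2 * r + 1) ^ 2) *
        (s ^ (2 * r + 1) ^ 2 * s ^ (2 * r + 1) ^ (2 + 1))) * X 6 * X 7) := rfl
  rw [e0, e1, e2, e3]
  ext f
  simp only [Set.mem_insert_iff, Set.mem_singleton_iff, Set.mem_union, or_assoc]

theorem isGenericCosines_signedConj [IsAlgClosed K] {q : ℕ} (hq_odd : Odd q)
    (hF : Nat.card F = q ^ 4) {β : F} (hβ : β ^ (2 * q) ≠ β ^ 2) {η : F} (hη : η ≠ 0)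
    (h1 : β ^ q * η ^ (q * (q / 2)) ≠ 1)
    (h2 : (η ^ (q * (q / 2))) ^ 2 - 2 * β ^ q * η ^ (q * (q / 2)) + 1 ≠ 0) :
    ∃ ς : K, IsGenericCosines (signedConj K q β) ς (algebraMap F K (η ^ (q * (q / 2)))) := by
  have : Finite F := Nat.finite_of_card_ne_zero (by
    rw [hF]
    exact pow_ne_zero _ hq_odd.pos.ne')
  have := Fintype.ofFinite F
  have hinj := (algebraMap F K).injective
  have htwo : (2 : F) ≠ 0 := Ring.two_ne_zero (ringChar_ne_two_of_card hq_odd hF)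
  have hfr : ∀ x : F, x ^ q ^ 4 = x := by
    intro x
    rw [← hF, Nat.card_eq_fintype_card, FiniteField.pow_card]
  have hβ0 : β ≠ 0 := by
    rintro rfl
    apply hβ
    rw [zero_pow (mul_ne_zero two_ne_zero hq_odd.pos.ne'), zero_pow two_ne_zero]
  have hβ1 : β ^ 2 ≠ 1 := by
    intro h
    apply hβ
    rw [pow_mul, h, one_pow]
  have hβi : ∀ i ≤ 4, (β ^ q ^ i) ^ 2 ≠ 1 := by
    intro i hi h
    have h' := congrArg (· ^ q ^ (4 - i)) h
    simp only [one_pow] at h'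
    rw [← pow_mul, ← pow_mul, mul_comm 2, ← mul_assoc, ← pow_add, Nat.add_sub_cancel' hi, pow_mul,
      hfr] at h'
    exact hβ1 h'
  obtain ⟨ς, hς⟩ := IsAlgClosed.exists_pow_nat_eq
    ((1 - signedConj K q β 2 ^ 2) * (1 - signedConj K q β 3 ^ 2)) (n := 2) two_pos
  refine ⟨ς, ?_, ?_, ?_, ?_, ?_, ?_, ?_, hς, ?_⟩
  · rw [← map_ofNat (algebraMap F K) 2]
    exact (map_ne_zero _).2 htwo
  · intro i h
    fin_cases i
    · exact hβi 0 (by norm_num) (hinj (by rw [pow_zero, pow_one]; simpa [signedConj] using h))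
    · exact hβi 1 (by norm_num) (hinj (by rw [pow_one]; simpa [signedConj] using h))
    · exact hβi 2 (by norm_num) (hinj (by simpa [signedConj] using h))
    · exact hβi 3 (by norm_num) (hinj (by simpa [signedConj] using h))
  · exact (map_ne_zero _).2 (pow_ne_zero _ hβ0)
  · intro h
    apply hβ
    apply hinj
    rw [mul_comm, pow_mul, map_pow, map_pow _ β 2]
    exact h.symm
  · exact (map_ne_zero _).2 (pow_ne_zero _ hη)
  · intro h
    apply h2
    apply hinj
    simpa [signedConj, map_ofNat] using h
  · intro h
    apply h1
    apply hinj
    simpa [signedConj] using h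
  · intro h h'
    have g : β * β ^ q = -(β ^ q ^ 2 * β ^ q ^ 3) := by
      apply hinj
      simpa [signedConj] using h
    have g' : β ^ 2 + (β ^ q) ^ 2 = (β ^ q ^ 2) ^ 2 + (β ^ q ^ 3) ^ 2 := by
      apply hinj
      simpa [signedConj] using h'
    -- The pairs β², β^(2q) and β^(2q²), β^(2q³) have the same sum and the same product, so β²
    -- equals one of the latter two. The case β² = β^(2q²) contradicts the minus sign in `g`, as q
    -- and the characteristic are odd; the case β² = β^(2q³) gives β^(2q) = β² after raising to the
    -- power q.
    have hmul : (β ^ 2 - (β ^ q ^ 2) ^ 2) * (β ^ 2 - (β ^ q ^ 3) ^ 2) = 0 := by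
      linear_combination β ^ 2 * g' - (β * β ^ q - β ^ q ^ 2 * β ^ q ^ 3) * g
    have h3 : β ^ q ^ 3 = (β ^ q ^ 2) ^ q := by rw [← pow_mul, ← pow_succ]
    have hfin : 2 * (β * β ^ q) ≠ 0 := mul_ne_zero htwo (mul_ne_zero hβ0 (pow_ne_zero _ hβ0))
    rcases mul_eq_zero.1 hmul with h0 | h0
    · rcases sq_eq_sq_iff_eq_or_eq_neg.1 (sub_eq_zero.1 h0) with h4 | h4
      · rw [h3, ← h4] at g
        exact hfin (by linear_combination g)
      · have h5 : β ^ q ^ 2 = -β := by linear_combination h4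
        rw [h3, h5, hq_odd.neg_pow] at g
        exact hfin (by linear_combination g)
    · apply hβ
      have h4 := congrArg (· ^ q) (sub_eq_zero.1 h0)
      rw [← pow_mul, ← pow_mul, ← pow_mul, mul_comm 2 q, ← mul_assoc, ← pow_succ, pow_mul β (q ^ 4),
        hfr] at h4
      rw [mul_comm 2 q]
      exact h4

end Matching

theorem mainTheorem3 {F : Type*} [Field F] {K : Type*} [Field K] [Algebra F K]
    [IsAlgClosure F K] (q : ℕ) (hq : IsPrimePow q) (hq_odd : Odd q)
    (hF : Nat.card F = q ^ 4) (β : F) (hβ : β ^ (2 * q) ≠ β ^ 2) :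
    ∃ η : F, ¬ IsSquare η ∧
      (∃ V' : Set (ℙ K (Fin 8 → K)),
        IsProjectiveComponent V' (varietyV K q β η) ∧
        topologicalKrullDim V' = 3 ∧
        HasDegree V' 16 ∧
        ∀ Z : Set (ℙ K (Fin 8 → K)), IsProjectiveComponent Z (varietyV K q β η) →
          topologicalKrullDim Z = 3 → Z = V') ∧
      {k : K | IsNonRepeatedIrreducibleSection K q β η k}.Infinite := by
  have : IsAlgClosed K := IsAlgClosure.isAlgClosed F
  have : Infinite K := IsAlgClosed.instInfinite
  obtain ⟨η, hη, h1, h2⟩ := exists_generic_nonsquare hq.one_lt hq_odd hF (β ^ q)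
  have hη0 : η ≠ 0 := by
    rintro rfl
    exact hη (IsSquare.zero)
  obtain ⟨s, hs⟩ := IsAlgClosed.exists_pow_nat_eq (algebraMap F K η) (n := 2) two_pos
  have hs0 : s ≠ 0 := by
    rintro rfl
    rw [zero_pow two_ne_zero] at hs
    exact hη0 ((map_eq_zero _).1 hs.symm)
  have hs4 : s ^ q ^ 4 = -s := by
    have : Finite F := Nat.finite_of_card_ne_zero (by
      rw [hF]
      exact pow_ne_zero _ hq_odd.pos.ne')
    have := Fintype.ofFinite F
    have hchar := ringChar_ne_two_of_card hq_odd hF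
    have hm : η ^ (Fintype.card F / 2) = -1 :=
      (FiniteField.pow_dichotomy hchar hη0).resolve_left
        fun h => hη ((FiniteField.isSquare_iff hchar hη0).2 h)
    -- By Euler's criterion s^(q⁴ - 1) = η^((q⁴ - 1)/2) = -1.
    rw [← Nat.card_eq_fintype_card, hF] at hm
    obtain ⟨m, hm'⟩ := hq_odd.pow (n := 4)
    rw [hm', show (2 * m + 1) / 2 = m by omega] at hm
    rw [hm', pow_succ, pow_mul, hs, ← map_pow, hm]
    simp
  set σ := sqrtConj q s with hσdef
  set c := signedConj K q β with hcdef
  have hσ : ∀ i, σ i ≠ 0 := fun i => pow_ne_zero _ hs0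
  have hquad : quadrics K q β η = Set.range (scaledQuadric σ c) :=
    quadrics_eq_range_scaledQuadric hq_odd β hs hs4
  obtain ⟨ς, hgen⟩ := isGenericCosines_signedConj (K := K) hq_odd hF hβ hη0 h1 h2
  have ht : algebraMap F K (η ^ (q * (q / 2))) = σ 2 / σ 1 := by
    rw [eq_div_iff (hσ 1), map_pow, ← hs, ← pow_mul]
    change _ * s ^ q ^ 1 = s ^ q ^ 2
    rw [← pow_add]
    congr 1
    obtain ⟨r, rfl⟩ := hq_odd
    rw [show (2 * r + 1) / 2 = r by omega]
    ring
  rw [ht] at hgen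
  have hV : varietyV K q β η = projectiveZeroLocus (Set.range (scaledQuadric σ c)) := by
    rw [varietyV, hquad]
  have hirr := isIrreducible_variety hgen hσ
  -- The variety is itself irreducible, hence it is its own only component.
  refine ⟨η, hη, ⟨varietyV K q β η, ⟨⟨?_, subset_rfl⟩, fun T hT _ => hT.2⟩, ?_, ?_, ?_⟩, ?_⟩
  · rw [hV]
    exact hirr
  · rw [hV]
    exact topologicalKrullDim_variety hgen hσ
  · rw [hV]
    exact hasDegree_variety hgen hσ
  · intro Z hZ _
    refine subset_antisymm hZ.1.2 (hZ.2 ⟨?_, subset_rfl⟩ hZ.1.2)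
    rw [hV]
    exact hirr
  -- The rescaling k ↦ k σ₂/σ₀ is injective, so only finitely many hyperplanes are exceptional.
  · have hfin : {k : K | ¬ IsGenericHyperplane c ς (σ 2 / σ 1) (k * (σ 2 / σ 0))}.Finite :=
      hgen.finite_not_isGenericHyperplane.preimage
        ((mul_left_injective₀ (div_ne_zero (hσ 2) (hσ 0))).injOn)
    refine hfin.infinite_compl.mono fun k hk => ?_
    have hk : IsGenericHyperplane c ς (σ 2 / σ 1) (k * (σ 2 / σ 0)) := not_not.1 hk
    have hsec : varietyV K q β η ∩ projectiveZeroLocus {hyperplaneForm k} =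
        projectiveZeroLocus (insert (hyperplaneForm k) (Set.range (scaledQuadric σ c))) := by
      rw [hV, projectiveZeroLocus_inter, Set.union_singleton]
    refine ⟨?_, ?_, ?_⟩
    · rw [hsec]
      exact isIrreducible_section hgen hσ hk
    · rw [hsec]
      exact topologicalKrullDim_section hgen hσ hk
    · rw [hquad]
      exact (isPrime_sectionIdeal hgen hσ hk).isRadical
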